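/- **Setting.** Let $d+1\ge 3$, $\eta=\mathrm{diag}(-1,1,\dots,1,-1)$ on $\mathbb R^{d+1}$ (indices $A,B=0,\dots,d$), $l>0$, and let $U\subset\mathbb R^d$ be an open coordinate patch with coordinates $x^m$ of anti-de Sitter space, described by smooth $\omega^A_{mB}, e^A_m, V^A$ on $U$ with $\omega=dx^m\omega_m$ metric-compatible ($\omega_{AB}=-\omega_{BA}$) and flat ($d\omega+\omega\omega=0$), $de+\omega e=0$, $dV+\omega V=e$, $V^AV_A=-l^2$, and $e_m(x)$, $m=0,\dots,d-1$, linearly independent for each $x$. Let $\mathcal H^{\rm T}$ be the space of formal power series in $Y^A$ with coefficients in polynomials in commuting variables $a^{\dagger A}$ and Grassmann odd ghosts $c_0,c^\dagger,b^\dagger,\xi,\mu,\nu,\theta^m$ (ghost number $-1$ for $b^\dagger$ and $+1$ for the others), and let $\Gamma(\mathcal H^{\rm T})$ be the same space with real coefficients replaced by $C^\infty(U)$. Put $$\Box=\eta^{AB}\partial_{Y^A}\partial_{Y^B},\quad S=\eta^{AB}\partial_{a^{\dagger A}}\partial_{Y^B},\quad T=\eta^{AB}\partial_{a^{\dagger A}}\partial_{a^{\dagger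 B}},\quad S^\dagger=a^{\dagger A}\partial_{Y^A},$$ $$\bar S^\dagger=(Y^A+V^A)\partial_{a^{\dagger A}},\quad h=a^{\dagger A}\partial_{a^{\dagger A}}-(Y^A+V^A)\partial_{Y^A},$$ $$\nabla=\theta^m\bigl(\partial_{x^m}-\omega^B_{mA}Y^A\partial_{Y^B}-\omega^B_{mA}a^{\dagger A}\partial_{a^{\dagger B}}\bigr),\quad \sigma=-\theta^m e^A_m\partial_{Y^A},\quad \Omega_{\rm trace}=c_0\Box+c^\dagger S+\xi T,$$ and $\Omega^{\rm T}=\nabla+\sigma+\bar\Omega$ with $$\bar\Omega=\Omega_{\rm trace}+S^\dagger\partial_{b^\dagger}+\mu(h-2)+\nu\bar S^\dagger-c^\dagger\partial_{b^\dagger}\partial_{c_0}-2\xi\partial_{b^\dagger}\partial_{c^\dagger}-2\mu c_0\partial_{c_0}+2\mu b^\dagger\partial_{b^\dagger}+2\mu\xi\partial_\xi+2\nu c_0\partial_{c^\dagger}+2\mu\nu\partial_\nu+\nu c^\dagger\partial_\xi+\nu\partial_{b^\dagger}\partial_\mu .$$ Let $\deg$ be minus the homogeneity in $c_0,c^\dagger,\xi$,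 and let $\tilde{\mathcal E}=\{\phi\in\mathcal H^{\rm T}:\Box\phi=S\phi=T\phi=0,\ \deg\phi=0\}$, with sections $\Gamma(\tilde{\mathcal E})$ defined by the same equations in $\Gamma(\mathcal H^{\rm T})$. A *BRST system* $(\Omega,\Gamma)$ is a space of sections $\Gamma$ with a differential operator $\Omega:\Gamma\to\Gamma$ of finite order, of ghost number $1$, with $\Omega^2=0$. The system $(\Omega,\Gamma(\mathcal H))$ is *consistently reduced* to $(\tilde\Omega,\Gamma(\mathcal E))$ by a decomposition $\mathcal H=\mathcal E\oplus\mathcal G\oplus\mathcal F$ into graded vector subbundles if the block $\Omega^{\mathcal G\mathcal F}=P_{\mathcal G}\Omega P_{\mathcal F}:\Gamma(\mathcal F)\to\Gamma(\mathcal G)$ is invertible among differential operators of finite order and $\tilde\Omega=\Omega^{\mathcal E\mathcal E}-\Omega^{\mathcal E\mathcal F}(\Omega^{\mathcal G\mathcal F})^{-1}\Omega^{\mathcal G\mathcal E}$. (Differential operators are required to be continuous in the $Y$-adic topology; subbundles are given by projectors of order zero.) **Proposition.** 1. The cohomology of $\Omega_{\rm trace}$ in $\mathcal H^{\rm T}$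 is concentrated in degree $0$: $H^n(\Omega_{\rm trace},\mathcal H^{\rm T})=0$ for $n\ne0$, and $\phi\mapsto[\phi]$ is an isomorphism $\tilde{\mathcal E}\cong H^0(\Omega_{\rm trace},\mathcal H^{\rm T})$. 2. The BRST system $(\Omega^{\rm T},\Gamma(\mathcal H^{\rm T}))$ can be consistently reduced to the BRST system $(\tilde\Omega^{\rm T},\Gamma(\tilde{\mathcal E}))$ with $\tilde\Omega^{\rm T}=\nabla+\sigma+\tilde\Omega$ and $$\tilde\Omega=S^\dagger\partial_{b^\dagger}+\mu(h-2)+\nu\bar S^\dagger+2\mu b^\dagger\partial_{b^\dagger}+2\mu\nu\partial_\nu+\nu\partial_{b^\dagger}\partial_\mu ,$$ by a decomposition $\mathcal H^{\rm T}=\tilde{\mathcal E}\oplus\mathcal G\oplus\mathcal F$ with $\Gamma(\mathcal G)=\mathrm{Im}\,\Omega_{\rm trace}$ and $\Gamma(\tilde{\mathcal E})\oplus\Gamma(\mathcal G)=\mathrm{Ker}\,\Omega_{\rm trace}$ on sections. 3. The operators in $\tilde\Omega$ satisfy the $sl(2)$ relations $[S^\dagger,\bar S^\dagger]=h$, $[h,S^\dagger]=2S^\dagger$,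 $[h,\bar S^\dagger]=-2\bar S^\dagger$. -/

import Mathlib

open scoped ContDiff

namespace HSParent

noncomputable section

/-! ### Smooth functions on a coordinate patch -/

/-- The algebra `C^∞(U)` of real smooth functions on an open subset `U` of `ℝ^d`. -/
def smoothFn {d : ℕ} (U : TopologicalSpace.Opens (Fin d → ℝ)) : Subalgebra ℝ (U → ℝ) where
  carrier := {f | ContDiffOn ℝ ∞ (Function.extend Subtype.val f 0) (U : Set (Fin d → ℝ))}
  mul_mem' := by
    intro f g hf hg
    refine (ContDiffOn.mul hf hg).congr ?_
    intro x hx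
    have e := fun k : U → ℝ => Subtype.val_injective.extend_apply k 0 (⟨x, hx⟩ : U)
    simp only at e
    simp [e]
  add_mem' := by
    intro f g hf hg
    refine (ContDiffOn.add hf hg).congr ?_
    intro x hx
    have e := fun k : U → ℝ => Subtype.val_injective.extend_apply k 0 (⟨x, hx⟩ : U)
    simp only at e
    simp [e]
  algebraMap_mem' := by
    intro r
    refine (contDiffOn_const (c := r)).congr ?_
    intro x hx
    have e := fun k : U → ℝ => Subtype.val_injective.extend_apply k 0 (⟨x, hx⟩ : U)
    simp only at e
    simp [e]

/-- The partial derivative `∂/∂x^μ` on `C^∞(U)`. -/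
def partialX {d : ℕ} (U : TopologicalSpace.Opens (Fin d → ℝ)) (μ : Fin d) :
    smoothFn U →ₗ[ℝ] smoothFn U where
  toFun f := ⟨fun x => fderiv ℝ (Function.extend Subtype.val f.1 0) x.1 (Pi.single μ 1), by
    have h : ContDiffOn ℝ ∞ (fderiv ℝ (Function.extend Subtype.val f.1 0))
        (U : Set (Fin d → ℝ)) := ContDiffOn.fderiv_of_isOpen f.2 U.isOpen le_rfl
    refine (ContDiffOn.clm_apply h (contDiffOn_const (c := Pi.single μ 1))).congr ?_
    intro x hx
    exact Subtype.val_injective.extend_apply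
      (fun y : U => fderiv ℝ (Function.extend Subtype.val f.1 0) y.1 (Pi.single μ 1)) 0 ⟨x, hx⟩⟩
  map_add' f g := by
    ext x
    have hU : (U : Set (Fin d → ℝ)) ∈ nhds x.1 := U.isOpen.mem_nhds x.2
    have hd : ∀ k : smoothFn U,
        DifferentiableAt ℝ (Function.extend Subtype.val k.1 0) x.1 := fun k =>
      (ContDiffOn.contDiffAt k.2 hU).differentiableAt (by simp)
    have e : Function.extend Subtype.val (f + g).1 0
        = Function.extend Subtype.val f.1 0 + Function.extend Subtype.val g.1 0 := by
      rw [← Function.extend_add]; simp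
    change fderiv ℝ (Function.extend Subtype.val (f + g).1 0) x.1 (Pi.single μ 1) = _
    rw [e, fderiv_add (hd f) (hd g)]
    rfl
  map_smul' r f := by
    ext x
    have hU : (U : Set (Fin d → ℝ)) ∈ nhds x.1 := U.isOpen.mem_nhds x.2
    have hd : DifferentiableAt ℝ (Function.extend Subtype.val f.1 0) x.1 :=
      (ContDiffOn.contDiffAt f.2 hU).differentiableAt (by simp)
    have e : Function.extend Subtype.val (r • f).1 0
        = r • Function.extend Subtype.val f.1 0 := by
      rw [← Function.extend_smul]; simp
    change fderiv ℝ (Function.extend Subtype.val (r • f).1 0) x.1 (Pi.single μ 1) = _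
    rw [e, fderiv_const_smul hd]
    rfl

/-! ### The space of states -/

/-- The Grassmann odd variables: `c₀, c†, b†, ξ, μ, ν` and `θ^0, …, θ^{d-1}`, with a fixed order
in which Grassmann monomials are written. -/
abbrev Ghost (d : ℕ) : Type := Fin 6 ⊕ₗ Fin d

/-- The ghost `c₀`. -/
def gc0 {d : ℕ} : Ghost d := toLex (Sum.inl 0)
/-- The ghost `c†`. -/
def gcd {d : ℕ} : Ghost d := toLex (Sum.inl 1)
/-- The ghost `b†`. -/
def gbd {d : ℕ} : Ghost d := toLex (Sum.inl 2)
/-- The ghost `ξ`. -/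
def gxi {d : ℕ} : Ghost d := toLex (Sum.inl 3)
/-- The ghost `μ`. -/
def gmu {d : ℕ} : Ghost d := toLex (Sum.inl 4)
/-- The ghost `ν`. -/
def gnu {d : ℕ} : Ghost d := toLex (Sum.inl 5)
/-- The space-time ghost `θ^m`. -/
def gth {d : ℕ} (m : Fin d) : Ghost d := toLex (Sum.inr m)

/-- Ghost number of each ghost variable: `-1` for `b†`, `+1` for all others. The Grassmann parity
is the ghost number modulo two. -/
def gh {d : ℕ} (i : Ghost d) : ℤ := if i = gbd then -1 else 1

/-- Formal power series in `Y^0, …, Y^d` with coefficients in polynomials in `a†^0, …, a†^d`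
over `C`. -/
abbrev Coeffs (C : Type*) [CommRing C] (d : ℕ) : Type _ :=
  MvPowerSeries (Fin (d + 1)) (MvPolynomial (Fin (d + 1)) C)

/-- States: formal power series in the `Y^A` with coefficients in polynomials in the `a†^A` and
all ghosts, over `C`. The element `φ` stands for
`∑_{S = {i₁ < … < i_k}} η_{i₁} ⋯ η_{i_k} φ(S)`, with `η_i` the ghost variables.
For `C = ℝ` this is the fibre; for `C = C^∞(U)` it is the space of sections over `U`. -/
abbrev States (C : Type*) [CommRing C] (d : ℕ) : Type _ := Finset (Ghost d) → Coeffs C d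

section Operators

variable (C : Type*) [CommRing C] [Algebra ℝ C] (d : ℕ)

/-- Linear operators on the space of states; the product is composition. -/
abbrev Op : Type _ := Module.End ℝ (States C d)

variable {C d}

/-- The sign produced by moving `η_i` through the `η_j` with `j ∈ S`, `j < i`. -/
def ghostSign (i : Ghost d) (S : Finset (Ghost d)) : ℤ := (-1) ^ (S.filter (· < i)).card

variable (C) in
/-- Left multiplication by the ghost `η_i`. -/
def ghostMul (i : Ghost d) : Op C d where
  toFun φ := fun S => if i ∈ S then ghostSign i (S.erase i) • φ (S.erase i) else 0
  map_add' φ ψ := by ext1 S; by_cases h : i ∈ S <;> simp [h]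
  map_smul' r φ := by
    ext1 S
    by_cases h : i ∈ S
    · simp [h, smul_comm]
    · simp [h]

variable (C) in
/-- Left derivative `∂/∂η_i`. -/
def ghostDer (i : Ghost d) : Op C d where
  toFun φ := fun S => if i ∈ S then 0 else ghostSign i S • φ (insert i S)
  map_add' φ ψ := by ext1 S; by_cases h : i ∈ S <;> simp [h]
  map_smul' r φ := by
    ext1 S
    by_cases h : i ∈ S
    · simp [h]
    · simp [h, smul_comm]

/-- Extension of an (even) operator on coefficients to states, commuting with the ghosts. -/
def onCoeffs (f : Module.End ℝ (Coeffs C d)) : Op C d := LinearMap.compLeft f (Finset (Ghost d))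

/-- Apply a linear map to the coefficient of each `Y`-monomial. -/
def mapY (f : Module.End ℝ (MvPolynomial (Fin (d + 1)) C)) : Module.End ℝ (Coeffs C d) where
  toFun p := fun m => f (MvPowerSeries.coeff m p)
  map_add' p q := by ext1 m; exact (congrArg f (map_add _ p q)).trans (map_add f _ _)
  map_smul' r p := by ext1 m; exact map_smul f r (MvPowerSeries.coeff m p)

/-- Apply a linear map to each coefficient of a polynomial in `a†`. -/
def mapA (f : Module.End ℝ C) : Module.End ℝ (MvPolynomial (Fin (d + 1)) C) where
  toFun p := AddMonoidAlgebra.map f.toAddMonoidHom p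
  map_add' p q := by
    refine MvPolynomial.ext _ _ fun m => ?_
    rw [MvPolynomial.coeff_add]
    exact map_add f (MvPolynomial.coeff m p) (MvPolynomial.coeff m q)
  map_smul' r p := by
    refine MvPolynomial.ext _ _ fun m => ?_
    rw [RingHom.id_apply, MvPolynomial.coeff_smul]
    exact (congrArg f (MvPolynomial.coeff_smul m r p)).trans
      (map_smul f r (MvPolynomial.coeff m p))

/-- Apply a linear map to all coefficients in `C`. -/
def onBase (f : Module.End ℝ C) : Op C d := onCoeffs (mapY (mapA f))

/-- Multiplication by an element of `C`. -/
def mulC (f : C) : Op C d := onBase (LinearMap.mulLeft ℝ f)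

variable (C)

/-- The formal partial derivative `∂/∂Y^A` of power series. -/
def pderivY (A : Fin (d + 1)) : Module.End ℝ (Coeffs C d) where
  toFun p := MvPowerSeries.pderivFun A p
  map_add' p q := MvPowerSeries.pderivFun_add p q
  map_smul' r p := by
    ext1 m
    rw [MvPowerSeries.coeff_pderivFun]
    exact (smul_mul_assoc r _ _).trans
      (congrArg (r • ·) (MvPowerSeries.coeff_pderivFun p m).symm)

/-- `∂/∂Y^A`. -/
def dY (A : Fin (d + 1)) : Op C d :=
  onCoeffs (pderivY C A)

/-- Multiplication by `Y^A`. -/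
def mulY (A : Fin (d + 1)) : Op C d := onCoeffs (LinearMap.mulLeft ℝ (MvPowerSeries.X A))

/-- `∂/∂a†^A`. -/
def dA (A : Fin (d + 1)) : Op C d :=
  onCoeffs (mapY ((MvPolynomial.pderiv A).toLinearMap.restrictScalars ℝ))

/-- Multiplication by `a†^A`. -/
def mulA (A : Fin (d + 1)) : Op C d := onCoeffs (mapY (LinearMap.mulLeft ℝ (MvPolynomial.X A)))

/-- The diagonal entries of the metric `η = diag(-1, 1, …, 1, -1)` in dimension `d + 1`. -/
def eta (A : Fin (d + 1)) : ℝ := if A = 0 ∨ A = Fin.last d then -1 else 1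

variable (d)

/-- `□ = η^{AB} ∂/∂Y^A ∂/∂Y^B`. -/
def box : Op C d := ∑ A, eta A • (dY C A * dY C A)

/-- `S = η^{AB} ∂/∂a†^A ∂/∂Y^B`. -/
def opS : Op C d := ∑ A, eta A • (dA C A * dY C A)

/-- `T = η^{AB} ∂/∂a†^A ∂/∂a†^B`. -/
def opT : Op C d := ∑ A, eta A • (dA C A * dA C A)

/-- `S† = a†^A ∂/∂Y^A`. -/
def opSd : Op C d := ∑ A, mulA C A * dY C A

/-- `Ω_trace = c₀ □ + c† S + ξ T`. -/
def omegaTrace : Op C d :=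
  ghostMul C gc0 * box C d + ghostMul C gcd * opS C d + ghostMul C gxi * opT C d

variable {C d}

/-- `S̄† = (Y^A + V^A) ∂/∂a†^A`. -/
def opSbd (V : Fin (d + 1) → C) : Op C d := ∑ A, (mulY C A + mulC (V A)) * dA C A

/-- `h = a†^A ∂/∂a†^A - (Y^A + V^A) ∂/∂Y^A`. -/
def opH (V : Fin (d + 1) → C) : Op C d :=
  ∑ A, mulA C A * dA C A - ∑ A, (mulY C A + mulC (V A)) * dY C A

/-- The part `Ω̄` of the parent BRST operator without space-time ghosts. -/
def omegaBar (V : Fin (d + 1) → C) : Op C d :=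
  let m := fun i : Ghost d => ghostMul C i
  let D := fun i : Ghost d => ghostDer C i
  m gc0 * box C d + m gcd * opS C d + opSd C d * D gbd + m gxi * opT C d
    + m gmu * (opH V - 2) + m gnu * opSbd V
    - m gcd * D gbd * D gc0 - (2 : ℝ) • (m gxi * D gbd * D gcd)
    - (2 : ℝ) • (m gmu * m gc0 * D gc0) + (2 : ℝ) • (m gmu * m gbd * D gbd)
    + (2 : ℝ) • (m gmu * m gxi * D gxi) + (2 : ℝ) • (m gnu * m gc0 * D gcd)
    + (2 : ℝ) • (m gmu * m gnu * D gnu) + m gnu * m gcd * D gxi + m gnu * D gbd * D gmu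

/-- The `sl(2)` operator
`Ω̃ = S† ∂_{b†} + μ(h - 2) + ν S̄† + 2 μ b† ∂_{b†} + 2 μ ν ∂_ν + ν ∂_{b†} ∂_μ`. -/
def omegaTilde (V : Fin (d + 1) → C) : Op C d :=
  let m := fun i : Ghost d => ghostMul C i
  let D := fun i : Ghost d => ghostDer C i
  opSd C d * D gbd + m gmu * (opH V - 2) + m gnu * opSbd V
    + (2 : ℝ) • (m gmu * m gbd * D gbd) + (2 : ℝ) • (m gmu * m gnu * D gnu)
    + m gnu * D gbd * D gmu

end Operators

/-! ### Gradings, traceless states, cohomology of `Ω_trace` -/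

section Cohomology

variable (C : Type*) [CommRing C] [Algebra ℝ C] (d : ℕ)

/-- `φ` is homogeneous of ghost number `k`. -/
def HasGhostNumber {C : Type*} [CommRing C] {d : ℕ} (k : ℤ) (φ : States C d) : Prop :=
  ∀ S, φ S ≠ 0 → ∑ i ∈ S, gh i = k

/-- States of degree `n`, the degree being minus the homogeneity in `c₀, c†, ξ`. -/
def traceDeg (n : ℤ) : Submodule ℝ (States C d) where
  carrier := {φ | ∀ S, φ S ≠ 0 → -((S ∩ {gc0, gcd, gxi}).card : ℤ) = n}
  add_mem' := by
    intro φ ψ hφ hψ S hS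
    by_cases h : φ S = 0
    · exact hψ S fun h' => hS (by simp [h, h'])
    · exact hφ S h
  zero_mem' := by intro S hS; simp at hS
  smul_mem' := by
    intro r φ hφ S hS
    exact hφ S fun h => hS (by simp [h])

/-- `Ẽ`: totally traceless states independent of `c₀, c†, ξ`. With `C = C^∞(U)` these are the
sections over `U` with values in `Ẽ`. -/
def traceless : Submodule ℝ (States C d) :=
  LinearMap.ker (box C d) ⊓ LinearMap.ker (opS C d) ⊓ LinearMap.ker (opT C d) ⊓ traceDeg C d 0

/-- Cocycles of `Ω_trace` in degree `n`. -/
def traceCocycles (n : ℤ) : Submodule ℝ (States C d) :=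
  LinearMap.ker (omegaTrace C d) ⊓ traceDeg C d n

/-- Coboundaries of `Ω_trace` in degree `n`; the operator `Ω_trace` has degree `-1`. -/
def traceCoboundaries (n : ℤ) : Submodule ℝ (States C d) :=
  (traceDeg C d (n + 1)).map (omegaTrace C d)

/-- The cohomology `H^n(Ω_trace)`. -/
abbrev traceCohomology (n : ℤ) : Type _ :=
  traceCocycles C d n ⧸ (traceCoboundaries C d n).submoduleOf (traceCocycles C d n)

/-- The cohomology class of a cocycle. -/
def traceClass (n : ℤ) : traceCocycles C d n →ₗ[ℝ] traceCohomology C d n :=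
  ((traceCoboundaries C d n).submoduleOf (traceCocycles C d n)).mkQ

end Cohomology

/-! ### BRST systems and consistent reductions -/

section Reduction

variable {C : Type*} [CommRing C] [Algebra ℝ C] {d : ℕ}

/-- Order at most `k` in the sense of Grothendieck: all `(k+1)`-fold commutators with
multiplications by functions vanish. -/
def HasOrderLE : ℕ → Op C d → Prop
  | 0, O => ∀ f : C, O * mulC f - mulC f * O = 0
  | k + 1, O => ∀ f : C, HasOrderLE k (O * mulC f - mulC f * O)

/-- Continuity for the `Y`-adic topology: each coefficient of the output is determined by finitely
many orders in `Y` of the input. -/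
def IsYContinuous (O : Op C d) : Prop :=
  ∀ N : ℕ, ∃ M : ℕ, ∀ φ : States C d,
    (∀ S m, Finsupp.degree m < M → MvPowerSeries.coeff m (φ S) = 0) →
      ∀ S m, Finsupp.degree m < N → MvPowerSeries.coeff m (O φ S) = 0

/-- Differential operators of order at most `k` on sections. -/
structure IsDiffOp (k : ℕ) (O : Op C d) : Prop where
  order : HasOrderLE k O
  continuous : IsYContinuous O

/-- `(Ω, Γ)` is a BRST first-quantized system: `Ω` is a differential operator of finite order that
acts on `Γ`, has ghost number one and is nilpotent there. -/
structure IsBRSTSystem (Γ : Submodule ℝ (States C d)) (Ω : Op C d) : Prop where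
  diffOp : ∃ k, IsDiffOp k Ω
  mapsTo : ∀ φ ∈ Γ, Ω φ ∈ Γ
  ghost : ∀ φ ∈ Γ, ∀ k, HasGhostNumber k φ → HasGhostNumber (k + 1) (Ω φ)
  nilpotent : ∀ φ ∈ Γ, Ω (Ω φ) = 0

variable (C d) in
/-- A decomposition `H = E ⊕ G ⊕ F` into graded vector subbundles, given by its projectors; they
are linear over functions (differential operators of order zero) and preserve the ghost number.
The sections of a subbundle are the range of its projector. -/
structure BundleDecomposition where
  PE : Op C d
  PG : Op C d
  PF : Op C d
  diffE : IsDiffOp 0 PE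
  diffG : IsDiffOp 0 PG
  diffF : IsDiffOp 0 PF
  idemE : PE * PE = PE
  idemG : PG * PG = PG
  idemF : PF * PF = PF
  disjEG : PE * PG = 0
  disjGE : PG * PE = 0
  disjEF : PE * PF = 0
  disjFE : PF * PE = 0
  disjGF : PG * PF = 0
  disjFG : PF * PG = 0
  total : PE + PG + PF = 1
  ghostE : ∀ k φ, HasGhostNumber k φ → HasGhostNumber k (PE φ)
  ghostG : ∀ k φ, HasGhostNumber k φ → HasGhostNumber k (PG φ)
  ghostF : ∀ k φ, HasGhostNumber k φ → HasGhostNumber k (PF φ)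

/-- The system with BRST operator `Ω` is consistently reduced to `(Ωr, ΓE)` by the decomposition
`H = E ⊕ G ⊕ F`: the sections of `E` are `ΓE`, the block `Ω^{GF} = P_G Ω P_F` is algebraically
invertible, i.e. has an inverse `K : Γ(G) → Γ(F)` among differential operators of finite order, and
`Ωr = Ω^{EE} - Ω^{EF} (Ω^{GF})⁻¹ Ω^{GE}` on `ΓE`. -/
def IsConsistentReduction (Ω : Op C d) (D : BundleDecomposition C d)
    (ΓE : Submodule ℝ (States C d)) (Ωr : Op C d) : Prop :=
  LinearMap.range D.PE = ΓE ∧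
    ∃ K : Op C d, (∃ k, IsDiffOp k K) ∧ D.PF * K * D.PG = K ∧
      K * (D.PG * Ω * D.PF) = D.PF ∧ (D.PG * Ω * D.PF) * K = D.PG ∧
      ∀ φ ∈ ΓE, Ωr φ =
        (D.PE * Ω * D.PE - (D.PE * Ω * D.PF) * K * (D.PG * Ω * D.PE)) φ

end Reduction

/-! ### The parent system on AdS -/

/-- Geometry of anti-de Sitter space of radius `l` in a coordinate patch `U` and an arbitrary local
frame of the bundle with fibre the embedding space `ℝ^{d+1}`: a flat metric connection
`ω^A_B = θ^m ω^A_{m B}`, a section `V^A` with `V^A V_A = -l²`, and the nondegenerate vielbein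
`e = dV + ω V`. Here `conn m A B` is `ω^A_{m B}` and `e m A` is `e^A_m`. -/
structure Background (d : ℕ) (U : TopologicalSpace.Opens (Fin d → ℝ)) (l : ℝ) where
  conn : Fin d → Fin (d + 1) → Fin (d + 1) → smoothFn U
  e : Fin d → Fin (d + 1) → smoothFn U
  V : Fin (d + 1) → smoothFn U
  metric : ∀ m A B, eta A • conn m A B + eta B • conn m B A = 0
  flat : ∀ m n A B, partialX U m (conn n A B) - partialX U n (conn m A B)
    + ∑ K, (conn m A K * conn n K B - conn n A K * conn m K B) = 0
  torsion : ∀ m n A, partialX U m (e n A) - partialX U n (e m A)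
    + ∑ B, (conn m A B * e n B - conn n A B * e m B) = 0
  vielbein : ∀ m A, partialX U m (V A) + ∑ B, conn m A B * V B = e m A
  norm : ∑ A, eta A • (V A * V A) + algebraMap ℝ (smoothFn U) (l ^ 2) = 0
  nondegenerate : ∀ x : U, LinearIndependent ℝ fun m : Fin d => fun A => (e m A).1 x

namespace Background

variable {d : ℕ} {U : TopologicalSpace.Opens (Fin d → ℝ)} {l : ℝ} (B : Background d U l)

/-- `∇ = θ^m ∂/∂x^m - θ^m ω^K_{m A} Y^A ∂/∂Y^K - θ^m ω^K_{m A} a†^A ∂/∂a†^K`. -/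
def nabla : Op (smoothFn U) d :=
  ∑ m, ghostMul (smoothFn U) (gth m) * (onBase (partialX U m)
    - ∑ K, ∑ A, mulC (B.conn m K A) * mulY (smoothFn U) A * dY (smoothFn U) K
    - ∑ K, ∑ A, mulC (B.conn m K A) * mulA (smoothFn U) A * dA (smoothFn U) K)

/-- `σ = -θ^m e^A_m ∂/∂Y^A`. -/
def sigma : Op (smoothFn U) d :=
  -∑ m, ∑ A, ghostMul (smoothFn U) (gth m) * mulC (B.e m A) * dY (smoothFn U) A

/-- The parent BRST operator `Ω^T = ∇ + σ + Ω̄`. -/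
def parentOp : Op (smoothFn U) d := B.nabla + B.sigma + omegaBar B.V

/-- The reduced BRST operator `Ω̃^T = ∇ + σ + Ω̃`. -/
def reducedOp : Op (smoothFn U) d := B.nabla + B.sigma + omegaTilde B.V

end Background

end

end HSParent

/-! The operators □, S, T commute, so D = `omegaTrace` is a Koszul differential. Everything rests on
a contracting homotopy for it away from degree zero (`exists_homotopy`). In dimension at least
three, choose distinct indices A₀, A₁, A₂ and single out the second Y-derivative along A₁ in □, the
mixed derivative along A₂ in S, and the second a†-derivative along A₀ in T. These involve disjoint
sets of variables, so multiplication by the adjoint monomials, combined with ghost derivatives,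
gives a homotopy `leadHomotopy` whose anticommutator with `leadTrace` is diagonal on monomials, with
positive eigenvalues as soon as one of c₀, c†, ξ is present (`leadTrace_leadHomotopy`,
`leadEigen_pos`).

The other terms of D strictly raise the weight `leadWeight`. D preserves the degrees in Y and in a†,
suitably extended to the ghosts, and these degrees bound the weight. Hence the full anticommutator,
completed by the identity in degree zero, is an invertible diagonal operator times 1 − X, where X is
nilpotent on each Y-homogeneous component of each state. Geometric series on these components glue
to an inverse (`isUnit_one_sub`), and composing with it yields an exact homotopy s
(`homotopy_of_unit`). The argument is linear over an arbitrary commutative real algebra of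
coefficients, so it covers both the fibre and the sections.

Then Ds, sD and 1 − sD − Ds are complementary projectors onto G = Im D, F and Ẽ. The parent operator
Ω differs from D by an operator of degree zero. Its GF block is thus D plus a perturbation, and the
relevant geometric series terminates because each step raises the degree by one while degrees lie
between −3 and 0 (`IsHomotopy.block_inverse`). Comparing degrees in Ω² = 0 shows that Ω preserves Ẽ
(`Background.parentOp_mem`), so the GE block vanishes on Ẽ and the reduced operator is the
restriction of Ω, where all terms containing derivatives in c₀, c†, ξ drop out.

For Ω² = 0, write the fibre part as D plus the BRST operator of sl(2) generators dressed by ghost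
bilinears (`omegaBar_eq`). The dressed generators still form sl(2) and commute with D, because (□,
S, T) is an sl(2) triplet contracted with ghosts in the dual representation (`dressed_sl2`). Finally
∇ + σ is a sum of θ^m times covariant derivatives. In terms of Y + V the relation e = dV + ωV turns
these into a flat metric connection, so they commute with one another and with every invariant
contraction in the fibre part (`Background.commute_covariant`,
`Background.commute_covariant_omegaBar`). -/

namespace HSParent
noncomputable section

set_option linter.unusedSectionVars false
set_option linter.unusedSimpArgs false

/-! ### Monomial coefficients of states and of the elementary operators -/

section Coefficients

variable {C : Type*} [CommRing C] [Algebra ℝ C] {d : ℕ}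

/-- The coefficient in `C` of the monomial with ghosts `S`, `Y`-exponent `m`, `a†`-exponent `n`. -/
def cf (φ : States C d) (S : Finset (Ghost d)) (m n : Fin (d + 1) →₀ ℕ) : C :=
  MvPolynomial.coeff n (MvPowerSeries.coeff m (φ S))

theorem states_ext {φ ψ : States C d} (h : ∀ S m n, cf φ S m n = cf ψ S m n) : φ = ψ := by
  funext S
  exact MvPowerSeries.ext fun m => MvPolynomial.ext _ _ fun n => h S m n

theorem op_ext {O P : Op C d} (h : ∀ φ S m n, cf (O φ) S m n = cf (P φ) S m n) : O = P :=
  LinearMap.ext fun φ => states_ext (h φ)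

variable (φ ψ : States C d) (S : Finset (Ghost d)) (m n : Fin (d + 1) →₀ ℕ)

@[simp] theorem cf_zero : cf (0 : States C d) S m n = 0 := by simp [cf]

@[simp] theorem cf_add : cf (φ + ψ) S m n = cf φ S m n + cf ψ S m n := by simp [cf]

@[simp] theorem cf_sub : cf (φ - ψ) S m n = cf φ S m n - cf ψ S m n := by simp [cf]

@[simp] theorem cf_neg : cf (-φ) S m n = -cf φ S m n := by simp [cf]

@[simp] theorem cf_smul (r : ℝ) : cf (r • φ) S m n = r • cf φ S m n := by
  exact MvPolynomial.coeff_smul n r _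

theorem cf_zsmul (k : ℤ) : cf (k • φ) S m n = k • cf φ S m n := by
  rw [← Int.cast_smul_eq_zsmul ℝ, cf_smul, Int.cast_smul_eq_zsmul ℝ]

theorem cf_ghostMul (i : Ghost d) : cf (ghostMul C i φ) S m n =
    if i ∈ S then ghostSign i (S.erase i) • cf φ (S.erase i) m n else 0 := by
  by_cases h : i ∈ S
  · rw [if_pos h, ← cf_zsmul]
    simp [cf, ghostMul, h]
  · simp [cf, ghostMul, h]

theorem cf_ghostDer (i : Ghost d) : cf (ghostDer C i φ) S m n =
    if i ∈ S then 0 else ghostSign i S • cf φ (insert i S) m n := by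
  by_cases h : i ∈ S
  · simp [cf, ghostDer, h]
  · rw [if_neg h, ← cf_zsmul]
    simp [cf, ghostDer, h]

theorem cf_dY (A : Fin (d + 1)) : cf (dY C A φ) S m n =
    ((m A : ℝ) + 1) • cf φ S (m + Finsupp.single A 1) n := by
  have h : MvPowerSeries.coeff m (dY C A φ S) =
      MvPowerSeries.coeff (m + Finsupp.single A 1) (φ S) * ((m A : MvPolynomial _ C) + 1) :=
    MvPowerSeries.coeff_pderivFun (φ S) m
  have h2 : ((m A : MvPolynomial (Fin (d + 1)) C) + 1) = MvPolynomial.C ((m A : C) + 1) := by simp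
  rw [cf, h, h2, mul_comm, MvPolynomial.coeff_C_mul, Algebra.smul_def]
  simp [cf]

theorem cf_mulY (A : Fin (d + 1)) : cf (mulY C A φ) S m n =
    if m A = 0 then 0 else cf φ S (m - Finsupp.single A 1) n := by
  have h : mulY C A φ S = MvPowerSeries.X A * φ S := rfl
  rw [cf, h, MvPowerSeries.X, MvPowerSeries.coeff_monomial_mul]
  by_cases h0 : m A = 0
  · rw [if_neg (by intro hle; have := hle A; simp [h0] at this), if_pos h0]; simp
  · rw [if_pos (by simpa [Finsupp.single_le_iff] using Nat.one_le_iff_ne_zero.2 h0), if_neg h0]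
    simp [cf]

theorem cf_dA (A : Fin (d + 1)) : cf (dA C A φ) S m n =
    ((n A : ℝ) + 1) • cf φ S m (n + Finsupp.single A 1) := by
  have h : MvPowerSeries.coeff m (dA C A φ S) =
    MvPolynomial.pderiv A (MvPowerSeries.coeff m (φ S)) := rfl
  rw [cf, h, MvPolynomial.coeff_pderiv, Algebra.smul_def, mul_comm]
  simp [cf]

theorem cf_mulA (A : Fin (d + 1)) : cf (mulA C A φ) S m n =
    if n A = 0 then 0 else cf φ S m (n - Finsupp.single A 1) := by
  have h : MvPowerSeries.coeff m (mulA C A φ S) =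
    MvPolynomial.X A * (MvPowerSeries.coeff m (φ S)) := rfl
  rw [cf, h, MvPolynomial.coeff_X_mul']
  by_cases h0 : n A = 0 <;> simp [h0, cf]

theorem cf_onBase (f : Module.End ℝ C) : cf (onBase f φ) S m n = f (cf φ S m n) := rfl

theorem cf_mulC (f : C) : cf (mulC f φ) S m n = f * cf φ S m n := rfl

/-- Multiplication of the coefficients of a polynomial in `a†` by real numbers. -/
def scaleA (g : (Fin (d + 1) →₀ ℕ) → ℝ) : Module.End ℝ (MvPolynomial (Fin (d + 1)) C) :=
  haveI key : ∀ (p : MvPolynomial (Fin (d + 1)) C) (n : Fin (d + 1) →₀ ℕ),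
      MvPolynomial.coeff n (∑ k ∈ p.support, MvPolynomial.monomial k (g k • p.coeff k))
        = g n • p.coeff n := by
    classical
    intro p n
    rw [MvPolynomial.coeff_sum]
    simp only [MvPolynomial.coeff_monomial, Finset.sum_ite_eq', MvPolynomial.mem_support_iff]
    split_ifs with h
    · rfl
    · rw [not_not.1 h, smul_zero]
  { toFun := fun p => ∑ n ∈ p.support, MvPolynomial.monomial n (g n • p.coeff n)
    map_add' := fun p q => MvPolynomial.ext _ _ fun n => by
      rw [MvPolynomial.coeff_add, key, key, key, MvPolynomial.coeff_add, smul_add]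
    map_smul' := fun r p => MvPolynomial.ext _ _ fun n => by
      rw [RingHom.id_apply, key, MvPolynomial.coeff_smul, MvPolynomial.coeff_smul, key,
        smul_comm] }

theorem coeff_scaleA (g : (Fin (d + 1) →₀ ℕ) → ℝ) (p : MvPolynomial (Fin (d + 1)) C) :
    MvPolynomial.coeff n (scaleA g p) = g n • p.coeff n := by
  classical
  change MvPolynomial.coeff n (∑ k ∈ p.support, MvPolynomial.monomial k (g k • p.coeff k)) = _
  rw [MvPolynomial.coeff_sum]
  simp only [MvPolynomial.coeff_monomial, Finset.sum_ite_eq', MvPolynomial.mem_support_iff]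
  split_ifs with h
  · rfl
  · rw [not_not.1 h, smul_zero]

/-- The operator multiplying each coefficient by a real number depending on the monomial. -/
def diag (g : Finset (Ghost d) → (Fin (d + 1) →₀ ℕ) → (Fin (d + 1) →₀ ℕ) → ℝ) : Op C d where
  toFun φ := fun S m => scaleA (g S m) (MvPowerSeries.coeff m (φ S))
  map_add' φ ψ := by
    ext1 S; ext1 m; exact (congrArg (scaleA (g S m)) (map_add _ _ _)).trans (map_add _ _ _)
  map_smul' r φ := by
    ext1 S; ext1 m; exact map_smul (scaleA (g S m)) r (MvPowerSeries.coeff m (φ S))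

theorem cf_diag (g : Finset (Ghost d) → (Fin (d + 1) →₀ ℕ) → (Fin (d + 1) →₀ ℕ) → ℝ) :
    cf (diag g φ) S m n = g S m n • cf φ S m n := coeff_scaleA n (g S m) _

theorem diag_mul (g g' : Finset (Ghost d) → (Fin (d + 1) →₀ ℕ) → (Fin (d + 1) →₀ ℕ) → ℝ) :
    (diag g * diag g' : Op C d) = diag (g * g') :=
  op_ext fun φ S m n => by simp [cf_diag, mul_smul]

theorem diag_add (g g' : Finset (Ghost d) → (Fin (d + 1) →₀ ℕ) → (Fin (d + 1) →₀ ℕ) → ℝ) :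
    (diag g + diag g' : Op C d) = diag (g + g') :=
  op_ext fun φ S m n => by simp [cf_diag, add_smul]

theorem diag_sub (g g' : Finset (Ghost d) → (Fin (d + 1) →₀ ℕ) → (Fin (d + 1) →₀ ℕ) → ℝ) :
    (diag g - diag g' : Op C d) = diag (g - g') :=
  op_ext fun φ S m n => by simp [cf_diag, sub_smul]

theorem diag_one : (diag 1 : Op C d) = 1 := op_ext fun φ S m n => by simp [cf_diag]

end Coefficients

/-! ### Anticommutation relations of the ghosts -/

section GhostAlgebra

variable {d : ℕ} (i j : Ghost d) (S : Finset (Ghost d))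

theorem ghostSign_mul_self : ghostSign i S * ghostSign i S = 1 := by
  unfold ghostSign
  rw [← mul_pow]; simp

theorem ghostSign_smul_smul {M : Type*} [AddCommGroup M] (x : M) :
    ghostSign i S • ghostSign i S • x = x := by
  rw [smul_smul, ghostSign_mul_self, one_smul]

theorem ghostSign_insert {S : Finset (Ghost d)} (h : j ∉ S) :
    ghostSign i (insert j S) = (if j < i then -1 else 1) * ghostSign i S := by
  unfold ghostSign
  rw [Finset.filter_insert]
  split_ifs with hj
  · rw [Finset.card_insert_of_notMem (by simp [h]), pow_succ]; ring
  · simp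

theorem ghostSign_erase {S : Finset (Ghost d)} (h : j ∈ S) :
    ghostSign i (S.erase j) = (if j < i then -1 else 1) * ghostSign i S := by
  conv_rhs => rw [← Finset.insert_erase h, ghostSign_insert i j (Finset.notMem_erase j S)]
  split_ifs <;> ring

/-- Exactly one of i < j and j < i holds. This is the source of the minus sign in all
anticommutation relations of distinct ghosts. -/
theorem ghostSign_swap {i j : Ghost d} (h : i ≠ j) :
    (if j < i then -1 else 1 : ℤ) = -(if i < j then -1 else 1) := by
  rcases lt_or_gt_of_ne h with h' | h'
  · simp [h', h'.not_gt]
  · simp [h', h'.not_gt]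

variable (C : Type*) [CommRing C] [Algebra ℝ C]

theorem ghostMul_mul_self : ghostMul C i * ghostMul C i = (0 : Op C d) :=
  op_ext fun φ S m n => by simp [cf_ghostMul]

theorem ghostDer_mul_self : ghostDer C i * ghostDer C i = (0 : Op C d) :=
  op_ext fun φ S m n => by simp [cf_ghostDer]

theorem ghostDer_mul_ghostMul_self :
    ghostDer C i * ghostMul C i = (diag fun S _ _ => if i ∈ S then 0 else 1 : Op C d) :=
  op_ext fun φ S m n => by
    by_cases h : i ∈ S
    · simp [cf_ghostDer, cf_diag, h]
    · simp [cf_ghostDer, cf_ghostMul, cf_diag, h, ghostSign_smul_smul,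
        -zsmul_eq_mul]

theorem ghostMul_mul_ghostDer_self :
    ghostMul C i * ghostDer C i = (diag fun S _ _ => if i ∈ S then 1 else 0 : Op C d) :=
  op_ext fun φ S m n => by
    by_cases h : i ∈ S
    · simp [cf_ghostDer, cf_ghostMul, cf_diag, h, ghostSign_smul_smul,
        -zsmul_eq_mul]
    · simp [cf_ghostMul, cf_diag, h]

theorem ghostDer_ghostMul_self :
    ghostDer C i * ghostMul C i = (1 - ghostMul C i * ghostDer C i : Op C d) := by
  rw [ghostDer_mul_ghostMul_self, ghostMul_mul_ghostDer_self, ← diag_one, diag_sub]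
  congr 1
  funext S m n
  by_cases h : i ∈ S <;> simp [h]

variable {i j}

theorem ghostMul_ghostMul (h : i ≠ j) :
    ghostMul C i * ghostMul C j = (-(ghostMul C j * ghostMul C i) : Op C d) :=
  op_ext fun φ S m n => by
    by_cases hi : i ∈ S <;> by_cases hj : j ∈ S <;>
      simp [cf_ghostMul, hi, hj, h, h.symm, Finset.erase_right_comm (a := i), smul_smul,
        -neg_smul, -zsmul_eq_mul]
    -- Only the case where both ghosts occur in S is left; it is a comparison of two products of
    -- signs.
    rw [← neg_smul]
    congr 1
    have hi' : i ∈ S.erase j := by simp [hi, h]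
    have hj' : j ∈ S.erase i := by simp [hj, h.symm]
    have e : ghostSign j ((S.erase j).erase i) = (if i < j then -1 else 1) * ghostSign j S := by
      rw [ghostSign_erase j i hi', ghostSign_erase j j hj]; simp
    have e' : ghostSign i ((S.erase j).erase i) = (if j < i then -1 else 1) * ghostSign i S := by
      rw [Finset.erase_right_comm, ghostSign_erase i j hj', ghostSign_erase i i hi]; simp
    rw [e, e', ghostSign_erase i i hi, ghostSign_erase j j hj, ghostSign_swap h,
      if_neg (lt_irrefl i), if_neg (lt_irrefl j)]
    ring

theorem ghostDer_ghostDer (h : i ≠ j) :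
    ghostDer C i * ghostDer C j = (-(ghostDer C j * ghostDer C i) : Op C d) :=
  op_ext fun φ S m n => by
    by_cases hi : i ∈ S <;> by_cases hj : j ∈ S <;>
      simp [cf_ghostDer, hi, hj, h, h.symm, smul_smul, -neg_smul, -zsmul_eq_mul]
    rw [← neg_smul, Finset.insert_comm]
    congr 1
    rw [ghostSign_insert j i hi, ghostSign_insert i j hj, ghostSign_swap h]
    ring

theorem ghostDer_ghostMul (h : i ≠ j) :
    ghostDer C i * ghostMul C j = (-(ghostMul C j * ghostDer C i) : Op C d) :=
  op_ext fun φ S m n => by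
    by_cases hi : i ∈ S <;> by_cases hj : j ∈ S <;>
      simp [cf_ghostDer, cf_ghostMul, hi, hj, h, h.symm, smul_smul, -neg_smul, -zsmul_eq_mul]
    rw [← neg_smul, Finset.erase_insert_of_ne h]
    congr 1
    have hi' : i ∉ S.erase j := by simp [hi]
    rw [ghostSign_insert j i hi', ghostSign_erase i j hj, ghostSign_swap h]
    ring

end GhostAlgebra

/-! ### Canonical commutation relations of Y, a† and their derivatives -/

section Commutation

variable (C : Type*) [CommRing C] [Algebra ℝ C] {d : ℕ}

variable {C} in
theorem commute_ghostMul_onCoeffs (i : Ghost d) (f : Module.End ℝ (Coeffs C d)) :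
    Commute (ghostMul C i) (onCoeffs f) := by
  refine LinearMap.ext fun φ => funext fun S => ?_
  change (if i ∈ S then ghostSign i (S.erase i) • f (φ (S.erase i)) else 0)
    = f (if i ∈ S then ghostSign i (S.erase i) • φ (S.erase i) else 0)
  split_ifs <;> simp [-zsmul_eq_mul]

variable {C} in
theorem commute_ghostDer_onCoeffs (i : Ghost d) (f : Module.End ℝ (Coeffs C d)) :
    Commute (ghostDer C i) (onCoeffs f) := by
  refine LinearMap.ext fun φ => funext fun S => ?_
  change (if i ∈ S then 0 else ghostSign i S • f (φ (insert i S)))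
    = f (if i ∈ S then 0 else ghostSign i S • φ (insert i S))
  split_ifs <;> simp [-zsmul_eq_mul]

variable (A B : Fin (d + 1))

theorem commute_dY_dY : Commute (dY C A) (dY C B : Op C d) :=
  op_ext fun φ S m n => by
    by_cases h : A = B
    · rw [h]
    · simp [cf_dY, smul_smul, add_right_comm m, Finsupp.single_apply, h, Ne.symm h, mul_comm]

theorem commute_dA_dA : Commute (dA C A) (dA C B : Op C d) :=
  op_ext fun φ S m n => by
    by_cases h : A = B
    · rw [h]
    · simp [cf_dA, smul_smul, add_right_comm n, Finsupp.single_apply, h, Ne.symm h, mul_comm]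

theorem commute_dA_dY : Commute (dA C A) (dY C B : Op C d) :=
  op_ext fun φ S m n => by
    simp only [Module.End.mul_apply, cf_dA, cf_dY]
    rw [smul_comm]

theorem commute_mulA_dY : Commute (mulA C A) (dY C B : Op C d) :=
  op_ext fun φ S m n => by by_cases h : n A = 0 <;> simp [cf_mulA, cf_dY, h]

theorem commute_dA_mulY : Commute (dA C A) (mulY C B : Op C d) :=
  op_ext fun φ S m n => by by_cases h : m B = 0 <;> simp [cf_dA, cf_mulY, h]

theorem commute_mulA_mulY : Commute (mulA C A) (mulY C B : Op C d) :=
  op_ext fun φ S m n => by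
    by_cases h : m B = 0 <;> by_cases h' : n A = 0 <;> simp [cf_mulA, cf_mulY, h, h']

theorem commute_mulY_mulY : Commute (mulY C A) (mulY C B : Op C d) :=
  op_ext fun φ S m n => by
    by_cases h : A = B
    · rw [h]
    · by_cases hA : m A = 0 <;> by_cases hB : m B = 0 <;>
        simp [cf_mulY, hA, hB, h, Ne.symm h, Finsupp.single_apply, tsub_right_comm (a := m)]

theorem commute_mulA_mulA : Commute (mulA C A) (mulA C B : Op C d) :=
  op_ext fun φ S m n => by
    by_cases h : A = B
    · rw [h]
    · by_cases hA : n A = 0 <;> by_cases hB : n B = 0 <;>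
        simp [cf_mulA, hA, hB, h, Ne.symm h, Finsupp.single_apply, tsub_right_comm (a := n)]

variable {A B} in
theorem commute_dY_mulY (h : A ≠ B) : Commute (dY C A) (mulY C B : Op C d) :=
  op_ext fun φ S m n => by
    by_cases hB : m B = 0
    · simp [cf_dY, cf_mulY, hB, h.symm, Finsupp.single_apply, h]
    · have : m - Finsupp.single B 1 + Finsupp.single A 1
          = m + Finsupp.single A 1 - Finsupp.single B 1 := by
        refine tsub_add_eq_add_tsub ?_
        simpa [Finsupp.single_le_iff] using Nat.one_le_iff_ne_zero.2 hB
      simp [cf_dY, cf_mulY, hB, h.symm, Finsupp.single_apply, h, this]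

variable {A B} in
theorem commute_dA_mulA (h : A ≠ B) : Commute (dA C A) (mulA C B : Op C d) :=
  op_ext fun φ S m n => by
    by_cases hB : n B = 0
    · simp [cf_dA, cf_mulA, hB, h.symm, Finsupp.single_apply, h]
    · have : n - Finsupp.single B 1 + Finsupp.single A 1
          = n + Finsupp.single A 1 - Finsupp.single B 1 := by
        refine tsub_add_eq_add_tsub ?_
        simpa [Finsupp.single_le_iff] using Nat.one_le_iff_ne_zero.2 hB
      simp [cf_dA, cf_mulA, hB, h.symm, Finsupp.single_apply, h, this]

/-- Both orders of the product are diagonal on monomials with eigenvalues differing by one, which is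
the canonical commutator in a form that also feeds the eigenvalue computation. -/
theorem dY_mul_mulY : dY C A * mulY C A = (diag fun _ m _ => (m A : ℝ) + 1 : Op C d) :=
  op_ext fun φ S m n => by simp [cf_dY, cf_mulY, cf_diag]

theorem mulY_mul_dY : mulY C A * dY C A = (diag fun _ m _ => (m A : ℝ) : Op C d) :=
  op_ext fun φ S m n => by
    by_cases h : m A = 0
    · simp [cf_mulY, cf_diag, h]
    · have h1 : 1 ≤ m A := Nat.one_le_iff_ne_zero.2 h
      have : m - Finsupp.single A 1 + Finsupp.single A 1 = m :=
        tsub_add_cancel_of_le (by simpa [Finsupp.single_le_iff] using h1)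
      simp [cf_mulY, cf_dY, cf_diag, h, this, Nat.cast_sub h1]

theorem dA_mul_mulA : dA C A * mulA C A = (diag fun _ _ n => (n A : ℝ) + 1 : Op C d) :=
  op_ext fun φ S m n => by simp [cf_dA, cf_mulA, cf_diag]

theorem mulA_mul_dA : mulA C A * dA C A = (diag fun _ _ n => (n A : ℝ) : Op C d) :=
  op_ext fun φ S m n => by
    by_cases h : n A = 0
    · simp [cf_mulA, cf_diag, h]
    · have h1 : 1 ≤ n A := Nat.one_le_iff_ne_zero.2 h
      have : n - Finsupp.single A 1 + Finsupp.single A 1 = n :=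
        tsub_add_cancel_of_le (by simpa [Finsupp.single_le_iff] using h1)
      simp [cf_mulA, cf_dA, cf_diag, h, this, Nat.cast_sub h1]

theorem dY_mulY_self : dY C A * mulY C A = (mulY C A * dY C A + 1 : Op C d) := by
  rw [dY_mul_mulY, mulY_mul_dY, ← diag_one, diag_add]; rfl

theorem dA_mulA_self : dA C A * mulA C A = (mulA C A * dA C A + 1 : Op C d) := by
  rw [dA_mul_mulA, mulA_mul_dA, ← diag_one, diag_add]; rfl

theorem dY_mulY : dY C A * mulY C B = (mulY C B * dY C A + if A = B then 1 else 0 : Op C d) := by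
  split_ifs with h
  · rw [h, dY_mulY_self]
  · rw [(commute_dY_mulY C h).eq, add_zero]

theorem dA_mulA : dA C A * mulA C B = (mulA C B * dA C A + if A = B then 1 else 0 : Op C d) := by
  split_ifs with h
  · rw [h, dA_mulA_self]
  · rw [(commute_dA_mulA C h).eq, add_zero]

variable {C} (f : Module.End ℝ C)

theorem commute_onBase_dY : Commute (onBase f) (dY C A) :=
  op_ext fun φ S m n => by simp [cf_onBase, cf_dY]

theorem commute_onBase_dA : Commute (onBase f) (dA C A) :=
  op_ext fun φ S m n => by simp [cf_onBase, cf_dA]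

theorem commute_onBase_mulY : Commute (onBase f) (mulY C A) :=
  op_ext fun φ S m n => by by_cases h : m A = 0 <;> simp [cf_onBase, cf_mulY, h]

theorem commute_onBase_mulA : Commute (onBase f) (mulA C A) :=
  op_ext fun φ S m n => by by_cases h : n A = 0 <;> simp [cf_onBase, cf_mulA, h]

theorem commute_onBase_diag
    (g : Finset (Ghost d) → (Fin (d + 1) →₀ ℕ) → (Fin (d + 1) →₀ ℕ) → ℝ) :
    Commute (onBase f) (diag g) :=
  op_ext fun φ S m n => by simp [cf_onBase, cf_diag]

theorem commute_mulC_mulC (f g : C) : Commute (mulC f) (mulC g : Op C d) :=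
  op_ext fun φ S m n => by simp [cf_mulC, mul_left_comm]

end Commutation

/-! ### Weight filtrations and operators that shift them -/

section Filtration

/-- An integer weight for each ghost, each `Y^A` and each `a†^A`. -/
@[ext] structure Weight (d : ℕ) where
  g : Ghost d → ℤ
  y : Fin (d + 1) → ℤ
  a : Fin (d + 1) → ℤ

variable {C : Type*} [CommRing C] [Algebra ℝ C] {d : ℕ}

/-- The weight of a monomial. -/
def Weight.val (w : Weight d) (S : Finset (Ghost d)) (m n : Fin (d + 1) →₀ ℕ) : ℤ :=
  ∑ i ∈ S, w.g i + ∑ A, (m A : ℤ) * w.y A + ∑ A, (n A : ℤ) * w.a A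

instance : Neg (Weight d) := ⟨fun w => ⟨-w.g, -w.y, -w.a⟩⟩

theorem Weight.val_neg (w : Weight d) (S : Finset (Ghost d)) (m n : Fin (d + 1) →₀ ℕ) :
    (-w).val S m n = -w.val S m n := by
  have h1 : (-w).g = -w.g := rfl
  have h2 : (-w).y = -w.y := rfl
  have h3 : (-w).a = -w.a := rfl
  simp only [Weight.val, h1, h2, h3, Pi.neg_apply, Finset.sum_neg_distrib, mul_neg]
  ring

theorem sum_add_single_mul (m : Fin (d + 1) →₀ ℕ) (A : Fin (d + 1)) (y : Fin (d + 1) → ℤ) :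
    ∑ B, ((m + Finsupp.single A 1 : Fin (d + 1) →₀ ℕ) B : ℤ) * y B = ∑ B, (m B : ℤ) * y B + y A := by
  simp [add_mul, Finset.sum_add_distrib, Finsupp.single_apply]

theorem sum_sub_single_mul {m : Fin (d + 1) →₀ ℕ} {A : Fin (d + 1)} (h : m A ≠ 0)
    (y : Fin (d + 1) → ℤ) :
    ∑ B, ((m - Finsupp.single A 1 : Fin (d + 1) →₀ ℕ) B : ℤ) * y B = ∑ B, (m B : ℤ) * y B - y A := by
  have e : m - Finsupp.single A 1 + Finsupp.single A 1 = m :=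
    tsub_add_cancel_of_le (by simpa [Finsupp.single_le_iff] using Nat.one_le_iff_ne_zero.2 h)
  conv_rhs => rw [← e, sum_add_single_mul]
  ring

variable (C) in
/-- States supported on monomials of weight at least `k`. -/
def filt (w : Weight d) (k : ℤ) : Submodule ℝ (States C d) where
  carrier := {φ | ∀ S m n, cf φ S m n ≠ 0 → k ≤ w.val S m n}
  add_mem' {φ ψ} hφ hψ S m n h := by
    by_cases h' : cf φ S m n = 0
    · exact hψ S m n (by simpa [h'] using h)
    · exact hφ S m n h'
  zero_mem' S m n h := by simp at h
  smul_mem' r φ hφ S m n h := hφ S m n fun h' => h (by simp [h'])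

theorem mem_filt {w : Weight d} {k : ℤ} {φ : States C d} :
    φ ∈ filt C w k ↔ ∀ S m n, cf φ S m n ≠ 0 → k ≤ w.val S m n := Iff.rfl

theorem filt_mono {w : Weight d} {k l : ℤ} (h : k ≤ l) : filt C w l ≤ filt C w k :=
  fun _ hφ S m n h' => h.trans (hφ S m n h')

/-- Upper bounds on a weight are lower bounds on its negative, so `Shift` for w and for −w together
express homogeneity of an operator. -/
theorem mem_filt_neg {w : Weight d} {k : ℤ} {φ : States C d} :
    φ ∈ filt C (-w) (-k) ↔ ∀ S m n, cf φ S m n ≠ 0 → w.val S m n ≤ k := by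
  simp only [mem_filt, Weight.val_neg, neg_le_neg_iff]

/-- `O` raises the weight of states by at least `k`. -/
def Shift (w : Weight d) (k : ℤ) (O : Op C d) : Prop :=
  ∀ l φ, φ ∈ filt C w l → O φ ∈ filt C w (l + k)

variable {w : Weight d} {k l : ℤ} {O P : Op C d}

theorem Shift.mono (h : Shift w k O) (hl : l ≤ k) : Shift w l O :=
  fun j φ hφ => filt_mono (by lia) (h j φ hφ)

theorem Shift.mul (hO : Shift w k O) (hP : Shift w l P) : Shift w (k + l) (O * P) :=
  fun j φ hφ => filt_mono (by lia) (hO _ _ (hP j φ hφ))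

theorem Shift.add (hO : Shift w k O) (hP : Shift w k P) : Shift w k (O + P) :=
  fun j φ hφ => Submodule.add_mem _ (hO j φ hφ) (hP j φ hφ)

theorem Shift.neg (hO : Shift w k O) : Shift w k (-O) :=
  fun j φ hφ => Submodule.neg_mem _ (hO j φ hφ)

theorem Shift.sub (hO : Shift w k O) (hP : Shift w k P) : Shift w k (O - P) :=
  fun j φ hφ => Submodule.sub_mem _ (hO j φ hφ) (hP j φ hφ)

theorem Shift.smul (r : ℝ) (hO : Shift w k O) : Shift w k (r • O) :=
  fun j φ hφ => Submodule.smul_mem _ r (hO j φ hφ)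

theorem shift_zero : Shift w k (0 : Op C d) := fun _ _ _ => Submodule.zero_mem _

theorem Shift.sum {ι : Type*} {s : Finset ι} {f : ι → Op C d} (h : ∀ i ∈ s, Shift w k (f i)) :
    Shift w k (∑ i ∈ s, f i) := by
  classical
  induction s using Finset.induction_on with
  | empty => simpa using shift_zero
  | insert a s ha ih =>
    rw [Finset.sum_insert ha]
    exact (h a (by simp)).add (ih fun i hi => h i (by simp [hi]))

theorem shift_diag (g : Finset (Ghost d) → (Fin (d + 1) →₀ ℕ) → (Fin (d + 1) →₀ ℕ) → ℝ) :
    Shift w 0 (diag g : Op C d) := fun j φ hφ S m n h => by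
  rw [add_zero]
  exact hφ S m n fun h' => h (by rw [cf_diag, h', smul_zero])

theorem shift_one : Shift w 0 (1 : Op C d) := diag_one (C := C) (d := d) ▸ shift_diag 1

theorem shift_onBase (f : Module.End ℝ C) : Shift w 0 (onBase f : Op C d) := fun j φ hφ S m n h => by
  rw [add_zero]
  exact hφ S m n fun h' => h (by rw [cf_onBase, h', map_zero])

theorem shift_mulC (f : C) : Shift w 0 (mulC f : Op C d) := shift_onBase _

theorem shift_ghostMul (i : Ghost d) : Shift w (w.g i) (ghostMul C i) := fun j φ hφ S m n h => by
  rw [cf_ghostMul] at h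
  split_ifs at h with hi
  · have := hφ (S.erase i) m n fun h' => h (by rw [h', smul_zero])
    unfold Weight.val at this ⊢
    rw [← Finset.add_sum_erase S _ hi]
    lia
  · exact absurd rfl h

theorem shift_ghostDer (i : Ghost d) : Shift w (-w.g i) (ghostDer C i) := fun j φ hφ S m n h => by
  rw [cf_ghostDer] at h
  split_ifs at h with hi
  · exact absurd rfl h
  · have := hφ (insert i S) m n fun h' => h (by rw [h', smul_zero])
    unfold Weight.val at this ⊢
    rw [Finset.sum_insert hi] at this
    lia

theorem shift_dY (A : Fin (d + 1)) : Shift w (-w.y A) (dY C A) := fun j φ hφ S m n h => by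
  rw [cf_dY] at h
  have := hφ _ _ _ fun h' => h (by rw [h', smul_zero])
  unfold Weight.val at this ⊢
  rw [sum_add_single_mul] at this
  lia

theorem shift_dA (A : Fin (d + 1)) : Shift w (-w.a A) (dA C A) := fun j φ hφ S m n h => by
  rw [cf_dA] at h
  have := hφ _ _ _ fun h' => h (by rw [h', smul_zero])
  unfold Weight.val at this ⊢
  rw [sum_add_single_mul] at this
  lia

theorem shift_mulY (A : Fin (d + 1)) : Shift w (w.y A) (mulY C A) := fun j φ hφ S m n h => by
  rw [cf_mulY] at h
  split_ifs at h with h0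
  · exact absurd rfl h
  · have := hφ _ _ _ h
    unfold Weight.val at this ⊢
    rw [sum_sub_single_mul h0] at this
    lia

theorem shift_mulA (A : Fin (d + 1)) : Shift w (w.a A) (mulA C A) := fun j φ hφ S m n h => by
  rw [cf_mulA] at h
  split_ifs at h with h0
  · exact absurd rfl h
  · have := hφ _ _ _ h
    unfold Weight.val at this ⊢
    rw [sum_sub_single_mul h0] at this
    lia

/-- The projection to the monomials satisfying a predicate. -/
def trunc (P : Finset (Ghost d) → (Fin (d + 1) →₀ ℕ) → (Fin (d + 1) →₀ ℕ) → Prop) : Op C d :=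
  haveI := Classical.dec
  diag fun S m n => if P S m n then 1 else 0

open Classical in
theorem cf_trunc (P : Finset (Ghost d) → (Fin (d + 1) →₀ ℕ) → (Fin (d + 1) →₀ ℕ) → Prop)
    (φ : States C d) (S : Finset (Ghost d)) (m n : Fin (d + 1) →₀ ℕ) :
    cf (trunc P φ) S m n = if P S m n then cf φ S m n else 0 := by
  rw [trunc, cf_diag]
  split_ifs <;> simp

theorem eq_zero_of_mem_filt {φ : States C d} (h : φ ∈ filt C w k) (h' : φ ∈ filt C (-w) l)
    (hkl : 0 < k + l) : φ = 0 := states_ext fun S m n => by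
  by_contra h0
  rw [cf_zero] at h0
  have h1 := h S m n h0
  have h2 := h' S m n h0
  rw [Weight.val_neg] at h2
  lia

/-- An operator preserving the weight commutes with the projections to fixed weight. -/
theorem commute_trunc_eq (h : Shift w 0 O) (h' : Shift (-w) 0 O) (k : ℤ) :
    Commute O (trunc fun S m n => w.val S m n = k) := by
  classical
  refine LinearMap.ext fun φ => ?_
  set p : Op C d := trunc fun S m n => w.val S m n = k
  set p1 : Op C d := trunc fun S m n => k < w.val S m n
  set p2 : Op C d := trunc fun S m n => w.val S m n < k
  -- Split by weight equal to, above and below k. The projections act coefficientwise, so no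
  -- convergence question arises for power series.
  have hdec : φ = p φ + p1 φ + p2 φ := states_ext fun S m n => by
    simp only [cf_add, p, p1, p2, cf_trunc]
    rcases lt_trichotomy (w.val S m n) k with h | h | h
    · simp [h, h.ne, h.not_gt]
    · simp [h]
    · simp [h, h.ne', h.not_gt]
  have hp : ∀ {ψ}, ψ ∈ filt C w k → ψ ∈ filt C (-w) (-k) → p ψ = ψ := by
    intro ψ h1 h2
    refine states_ext fun S m n => ?_
    rw [cf_trunc]
    split_ifs with h0
    · rfl
    · by_contra h3
      exact h0 (le_antisymm (mem_filt_neg.1 h2 S m n (Ne.symm h3)) (h1 S m n (Ne.symm h3)))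
  have hp1 : p (O (p1 φ)) = 0 := by
    have : p1 φ ∈ filt C w (k + 1) := fun S m n h0 => by
      rw [cf_trunc] at h0
      split_ifs at h0 with h1
      · lia
      · exact absurd rfl h0
    refine states_ext fun S m n => ?_
    rw [cf_trunc, cf_zero]
    split_ifs with h0
    · by_contra h3
      have := h _ _ this S m n h3
      lia
    · rfl
  have hp2 : p (O (p2 φ)) = 0 := by
    have : p2 φ ∈ filt C (-w) (-(k - 1)) := by
      rw [mem_filt_neg]
      intro S m n h0
      rw [cf_trunc] at h0
      split_ifs at h0 with h1
      · lia
      · exact absurd rfl h0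
    refine states_ext fun S m n => ?_
    rw [cf_trunc, cf_zero]
    split_ifs with h0
    · by_contra h3
      have := h' _ _ this S m n h3
      rw [Weight.val_neg] at this
      lia
    · rfl
  have hpp : p (O (p φ)) = O (p φ) := by
    have h1 : p φ ∈ filt C w k := fun S m n h0 => by
      rw [cf_trunc] at h0
      split_ifs at h0 with h1
      · lia
      · exact absurd rfl h0
    have h2 : p φ ∈ filt C (-w) (-k) := by
      rw [mem_filt_neg]
      intro S m n h0
      rw [cf_trunc] at h0
      split_ifs at h0 with h1
      · lia
      · exact absurd rfl h0
    exact hp (by simpa using h _ _ h1) (by simpa using h' _ _ h2)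
  change O (p φ) = p (O φ)
  conv_rhs => rw [hdec]
  rw [map_add, map_add, map_add, map_add, hp1, hp2, hpp, add_zero, add_zero]

/-- The inverse of a weight-preserving invertible operator does not lower the weight. -/
theorem shift_of_mul_eq_one (h' : Shift (-w) 0 O) (h : Shift w 0 O) (hPO : P * O = 1)
    (hOP : O * P = 1) : Shift w 0 P := fun k φ hφ => by
  classical
  rw [add_zero]
  set ψ := P φ
  have hψ : O ψ = φ := LinearMap.congr_fun hOP φ
  set p1 : Op C d := trunc fun S m n => k ≤ w.val S m n
  set p2 : Op C d := trunc fun S m n => w.val S m n < k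
  have hdec : ψ = p1 ψ + p2 ψ := states_ext fun S m n => by
    simp only [cf_add, p1, p2, cf_trunc]
    rcases lt_or_ge (w.val S m n) k with h | h
    · simp [h, h.not_ge]
    · simp [h, h.not_gt]
  have m1 : p1 ψ ∈ filt C w k := fun S m n h0 => by
    rw [cf_trunc] at h0
    split_ifs at h0 with h1
    · exact h1
    · exact absurd rfl h0
  have m2 : p2 ψ ∈ filt C (-w) (-(k - 1)) := by
    rw [mem_filt_neg]
    intro S m n h0
    rw [cf_trunc] at h0
    split_ifs at h0 with h1
    · lia
    · exact absurd rfl h0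
  have m1' : O (p1 ψ) ∈ filt C w k := by simpa using h _ _ m1
  have m2' : O (p2 ψ) ∈ filt C (-w) (-(k - 1)) := by simpa using h' _ _ m2
  have e : O (p2 ψ) = φ - O (p1 ψ) := by
    rw [eq_sub_iff_add_eq, ← hψ]
    conv_rhs => rw [hdec, map_add, add_comm]
  -- The image of the low part has weight at most k − 1, yet as a difference of states of weight at
  -- least k it also has weight at least k.
  have e0 : O (p2 ψ) = 0 :=
    eq_zero_of_mem_filt (w := w) (e ▸ Submodule.sub_mem _ hφ m1') m2' (by lia)
  have e1 : p2 ψ = 0 := by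
    have := LinearMap.congr_fun hPO (p2 ψ)
    rw [Module.End.mul_apply, e0, map_zero] at this
    exact this.symm
  rw [hdec, e1, add_zero]
  exact m1

end Filtration

/-! ### Operators not involving ghosts; ghost number and trace degree as weights -/

section CoefficientOperators

variable {C : Type*} [CommRing C] [Algebra ℝ C] {d : ℕ} {O P : Op C d}

/-- Operators acting on the coefficients of the ghost monomials. -/
def IsCoeffOp (O : Op C d) : Prop := ∃ f, O = onCoeffs f

theorem IsCoeffOp.mul : IsCoeffOp O → IsCoeffOp P → IsCoeffOp (O * P) := by
  rintro ⟨f, rfl⟩ ⟨g, rfl⟩; exact ⟨f * g, rfl⟩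

theorem IsCoeffOp.add : IsCoeffOp O → IsCoeffOp P → IsCoeffOp (O + P) := by
  rintro ⟨f, rfl⟩ ⟨g, rfl⟩; exact ⟨f + g, rfl⟩

theorem IsCoeffOp.sub : IsCoeffOp O → IsCoeffOp P → IsCoeffOp (O - P) := by
  rintro ⟨f, rfl⟩ ⟨g, rfl⟩; exact ⟨f - g, rfl⟩

theorem IsCoeffOp.smul (r : ℝ) : IsCoeffOp O → IsCoeffOp (r • O) := by
  rintro ⟨f, rfl⟩; exact ⟨r • f, rfl⟩

theorem IsCoeffOp.sum {ι : Type*} {s : Finset ι} {f : ι → Op C d} (h : ∀ i, IsCoeffOp (f i)) :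
    IsCoeffOp (∑ i ∈ s, f i) := by
  choose g hg using h
  refine ⟨∑ i ∈ s, g i, ?_⟩
  refine LinearMap.ext fun φ => funext fun S => ?_
  rw [Finset.sum_congr rfl fun i _ => hg i]
  have : (onCoeffs (∑ i ∈ s, g i) φ) S = (∑ i ∈ s, g i) (φ S) := rfl
  rw [this, LinearMap.sum_apply, LinearMap.sum_apply, Finset.sum_apply]
  rfl

theorem isCoeffOp_onBase (f : Module.End ℝ C) : IsCoeffOp (onBase f : Op C d) := ⟨_, rfl⟩
theorem isCoeffOp_mulC (f : C) : IsCoeffOp (mulC f : Op C d) := ⟨_, rfl⟩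
theorem isCoeffOp_dY (A : Fin (d + 1)) : IsCoeffOp (dY C A) := ⟨_, rfl⟩
theorem isCoeffOp_dA (A : Fin (d + 1)) : IsCoeffOp (dA C A) := ⟨_, rfl⟩
theorem isCoeffOp_mulY (A : Fin (d + 1)) : IsCoeffOp (mulY C A) := ⟨_, rfl⟩
theorem isCoeffOp_mulA (A : Fin (d + 1)) : IsCoeffOp (mulA C A) := ⟨_, rfl⟩

theorem isCoeffOp_box : IsCoeffOp (box C d) :=
  .sum fun A => .smul _ ((isCoeffOp_dY A).mul (isCoeffOp_dY A))

theorem isCoeffOp_opS : IsCoeffOp (opS C d) :=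
  .sum fun A => .smul _ ((isCoeffOp_dA A).mul (isCoeffOp_dY A))

theorem isCoeffOp_opT : IsCoeffOp (opT C d) :=
  .sum fun A => .smul _ ((isCoeffOp_dA A).mul (isCoeffOp_dA A))

theorem isCoeffOp_opSd : IsCoeffOp (opSd C d) :=
  .sum fun A => (isCoeffOp_mulA A).mul (isCoeffOp_dY A)

theorem isCoeffOp_opSbd (V : Fin (d + 1) → C) : IsCoeffOp (opSbd V) :=
  .sum fun A => ((isCoeffOp_mulY A).add (isCoeffOp_mulC _)).mul (isCoeffOp_dA A)

theorem isCoeffOp_opH (V : Fin (d + 1) → C) : IsCoeffOp (opH V) :=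
  .sub (.sum fun A => (isCoeffOp_mulA A).mul (isCoeffOp_dA A))
    (.sum fun A => ((isCoeffOp_mulY A).add (isCoeffOp_mulC _)).mul (isCoeffOp_dY A))

theorem IsCoeffOp.commute_ghostMul (h : IsCoeffOp O) (i : Ghost d) : Commute (ghostMul C i) O := by
  obtain ⟨f, rfl⟩ := h; exact commute_ghostMul_onCoeffs i f

theorem IsCoeffOp.commute_ghostDer (h : IsCoeffOp O) (i : Ghost d) : Commute (ghostDer C i) O := by
  obtain ⟨f, rfl⟩ := h; exact commute_ghostDer_onCoeffs i f

/-- A weight counting ghosts only. -/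
def ghostWeight (g : Ghost d → ℤ) : Weight d := ⟨g, 0, 0⟩

theorem neg_ghostWeight (g : Ghost d → ℤ) : -ghostWeight g = ghostWeight (-g) := by
  ext i
  · rfl
  · exact neg_zero (G := ℤ)
  · exact neg_zero (G := ℤ)

theorem val_ghostWeight (g : Ghost d → ℤ) (S : Finset (Ghost d)) (m n : Fin (d + 1) →₀ ℕ) :
    (ghostWeight g).val S m n = ∑ i ∈ S, g i := by simp [Weight.val, ghostWeight]

theorem mem_filt_ghostWeight {g : Ghost d → ℤ} {k : ℤ} {φ : States C d} :
    φ ∈ filt C (ghostWeight g) k ↔ ∀ S, φ S ≠ 0 → k ≤ ∑ i ∈ S, g i := by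
  simp only [mem_filt, val_ghostWeight]
  constructor
  · intro h S hS
    by_contra hk
    exact hS (MvPowerSeries.ext fun m => MvPolynomial.ext _ _ fun n => by
      by_contra h0
      exact hk (h S m n (by simpa [cf] using h0)))
  · intro h S m n h0
    exact h S fun hS => h0 (by simp [cf, hS])

theorem IsCoeffOp.shift (h : IsCoeffOp O) (g : Ghost d → ℤ) : Shift (ghostWeight g) 0 O := by
  obtain ⟨f, rfl⟩ := h
  intro k φ hφ
  rw [mem_filt_ghostWeight] at hφ ⊢
  intro S hS
  rw [add_zero]
  exact hφ S fun h0 => hS (by change f (φ S) = 0; rw [h0, map_zero])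

theorem hasGhostNumber_iff {k : ℤ} {φ : States C d} : HasGhostNumber k φ ↔
    φ ∈ filt C (ghostWeight gh) k ∧ φ ∈ filt C (ghostWeight (-gh)) (-k) := by
  simp only [mem_filt_ghostWeight, HasGhostNumber, Pi.neg_apply, Finset.sum_neg_distrib,
    neg_le_neg_iff]
  exact ⟨fun h => ⟨fun S hS => (h S hS).ge, fun S hS => (h S hS).le⟩,
    fun h S hS => le_antisymm (h.2 S hS) (h.1 S hS)⟩

/-- The degree of a ghost: `-1` for `c₀, c†, ξ`. -/
def tdeg (i : Ghost d) : ℤ := if i = gc0 ∨ i = gcd ∨ i = gxi then -1 else 0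

theorem sum_tdeg (S : Finset (Ghost d)) :
    ∑ i ∈ S, tdeg i = -((S ∩ {gc0, gcd, gxi}).card : ℤ) := by
  simp only [tdeg]
  rw [← Finset.sum_filter, Finset.sum_const, smul_neg, nsmul_one]
  congr 3
  ext i
  simp

/-- There are only three trace ghosts. This bound is what makes the geometric series in the
reduction terminate. -/
theorem sum_tdeg_mem_Icc (S : Finset (Ghost d)) : -3 ≤ ∑ i ∈ S, tdeg i ∧ ∑ i ∈ S, tdeg i ≤ 0 := by
  rw [sum_tdeg]
  have h1 := Finset.card_le_card (Finset.inter_subset_right (s₁ := S) (s₂ := {gc0, gcd, gxi}))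
  have h2 := Finset.card_le_three (a := (gc0 : Ghost d)) (b := gcd) (c := gxi)
  lia

theorem mem_traceDeg_iff {k : ℤ} {φ : States C d} : φ ∈ traceDeg C d k ↔
    φ ∈ filt C (ghostWeight tdeg) k ∧ φ ∈ filt C (ghostWeight (-tdeg)) (-k) := by
  simp only [mem_filt_ghostWeight, Pi.neg_apply, Finset.sum_neg_distrib, neg_le_neg_iff, sum_tdeg]
  exact ⟨fun h => ⟨fun S hS => (h S hS).ge, fun S hS => (h S hS).le⟩,
    fun h S hS => le_antisymm (h.2 S hS) (h.1 S hS)⟩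

end CoefficientOperators

/-! ### Invertibility of 1 − X for locally nilpotent X -/

section LocallyNilpotent

variable {C : Type*} [CommRing C] [Algebra ℝ C] {d : ℕ}

/-- The total degree in `Y` that makes `Ω_trace` homogeneous of degree zero. -/
def yDeg (d : ℕ) : Weight d :=
  ⟨fun i => (if i = gc0 then 2 else 0) + (if i = gcd then 1 else 0), fun _ => 1, fun _ => 0⟩

/-- The total degree in `a†` that makes `Ω_trace` homogeneous of degree zero. -/
def aDeg (d : ℕ) : Weight d :=
  ⟨fun i => (if i = gcd then 1 else 0) + (if i = gxi then 2 else 0), fun _ => 0, fun _ => 1⟩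

theorem val_yDeg (S : Finset (Ghost d)) (m n : Fin (d + 1) →₀ ℕ) : (yDeg d).val S m n =
    (if gc0 ∈ S then 2 else 0) + (if gcd ∈ S then 1 else 0) + m.degree := by
  simp [Weight.val, yDeg, Finset.sum_add_distrib, Finsupp.degree_eq_sum]

/-- A state may have unbounded a†-degree overall. But a fixed `yDeg` allows only finitely many pairs
of ghost set and Y-exponent, and each such pair carries a polynomial in a†. -/
theorem exists_aDeg_bound (φ : States C d) (p : ℤ) : ∃ q : ℤ,
    trunc (fun S m n => (yDeg d).val S m n = p) φ ∈ filt C (-aDeg d) (-q) := by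
  have h1 : ∀ (S : Finset (Ghost d)) (m : Fin (d + 1) →₀ ℕ), ∃ q : ℤ, ∀ n, cf φ S m n ≠ 0 →
      (aDeg d).val S m n ≤ q := by
    intro S m
    obtain ⟨q, hq⟩ := ((MvPowerSeries.coeff m (φ S)).support.finite_toSet.image
      fun n => (aDeg d).val S m n).bddAbove
    exact ⟨q, fun n hn => hq ⟨n, by simpa [cf] using hn, rfl⟩⟩
  choose q hq using h1
  obtain ⟨Q, hQ⟩ := (((Set.finite_univ (α := Finset (Ghost d))).prod
    (Finsupp.finite_of_degree_le (σ := Fin (d + 1)) p.toNat)).image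
      fun x => q x.1 x.2).bddAbove
  refine ⟨Q, mem_filt_neg.2 fun S m n h => ?_⟩
  classical
  rw [cf_trunc] at h
  split_ifs at h with hp
  · refine (hq S m n h).trans (hQ ⟨(S, m), ⟨Set.mem_univ _, ?_⟩, rfl⟩)
    rw [val_yDeg] at hp
    change m.degree ≤ p.toNat
    split_ifs at hp <;> lia
  · exact absurd rfl h

variable {w : Weight d} {X : Op C d}

/-- On the component of `yDeg` p, with `aDeg` at most Q, the weight lies between −c(p + Q) and p +
Q. Powers of X respect these upper bounds on the degrees while each factor raises the weight, so the
available interval is exhausted. -/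
theorem exists_pow_trunc_eq_zero (hup : ∀ S m n, w.val S m n ≤ (yDeg d).val S m n + (aDeg d).val S m n)
    (c : ℤ) (hc : 0 ≤ c)
    (hlo : ∀ S m n, -(c * ((yDeg d).val S m n + (aDeg d).val S m n)) ≤ w.val S m n)
    (hw : Shift w 1 X) (hp : Shift (-yDeg d) 0 X) (hq : Shift (-aDeg d) 0 X)
    (φ : States C d) (p : ℤ) :
    ∃ K : ℕ, (X ^ K) (trunc (fun S m n => (yDeg d).val S m n = p) φ) = 0 := by
  obtain ⟨Q, hQ⟩ := exists_aDeg_bound φ p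
  set ψ := trunc (fun S m n => (yDeg d).val S m n = p) φ
  have hψp : ψ ∈ filt C (-yDeg d) (-p) := mem_filt_neg.2 fun S m n h => by
    classical
    rw [cf_trunc] at h
    split_ifs at h with hp
    · exact hp.le
    · exact absurd rfl h
  have hψw : ψ ∈ filt C w (-(c * (p + Q))) := fun S m n h => by
    have h1 := mem_filt_neg.1 hψp S m n h
    have h2 := mem_filt_neg.1 hQ S m n h
    have := hlo S m n
    have : c * ((yDeg d).val S m n + (aDeg d).val S m n) ≤ c * (p + Q) :=
      mul_le_mul_of_nonneg_left (by lia) hc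
    lia
  have key : ∀ k : ℕ, (X ^ k) ψ ∈ filt C w (-(c * (p + Q)) + k) ∧
      (X ^ k) ψ ∈ filt C (-yDeg d) (-p) ∧ (X ^ k) ψ ∈ filt C (-aDeg d) (-Q) := by
    intro k
    induction k with
    | zero => simpa using ⟨hψw, hψp, hQ⟩
    | succ k ih =>
      rw [pow_succ', Module.End.mul_apply]
      refine ⟨?_, by simpa using hp _ _ ih.2.1, by simpa using hq _ _ ih.2.2⟩
      have := hw _ _ ih.1
      push_cast
      rwa [← add_assoc]
  -- This counts the integers from −c(p + Q) to p + Q.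
  refine ⟨(p + Q + c * (p + Q) + 1).toNat, states_ext fun S m n => ?_⟩
  rw [cf_zero]
  by_contra h
  obtain ⟨k1, k2, k3⟩ := key (p + Q + c * (p + Q) + 1).toNat
  have := k1 S m n h
  have := mem_filt_neg.1 k2 S m n h
  have := mem_filt_neg.1 k3 S m n h
  have := hup S m n
  have := Int.self_le_toNat (p + Q + c * (p + Q) + 1)
  lia

/-- An operator that preserves the degrees in `Y` and `a†` and raises a weight bounded by them
differs from the identity by a quasinilpotent operator. -/
theorem isUnit_one_sub (hup : ∀ S m n, w.val S m n ≤ (yDeg d).val S m n + (aDeg d).val S m n)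
    (c : ℤ) (hc : 0 ≤ c)
    (hlo : ∀ S m n, -(c * ((yDeg d).val S m n + (aDeg d).val S m n)) ≤ w.val S m n)
    (hw : Shift w 1 X) (hp' : Shift (yDeg d) 0 X) (hp : Shift (-yDeg d) 0 X)
    (hq : Shift (-aDeg d) 0 X) : IsUnit (1 - X) := by
  classical
  set π : ℤ → Op C d := fun p => trunc fun S m n => (yDeg d).val S m n = p with hπ
  have hcomm : ∀ p, Commute X (π p) := fun p => commute_trunc_eq hp' hp p
  have hnil : ∀ φ p, ∃ K : ℕ, (X ^ K) (π p φ) = 0 :=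
    exists_pow_trunc_eq_zero hup c hc hlo hw hp hq
  have hext : ∀ {φ ψ : States C d}, (∀ p, π p φ = π p ψ) → φ = ψ := fun h =>
    states_ext fun S m n => by
      have := congrArg (fun x => cf x S m n) (h ((yDeg d).val S m n))
      simpa [hπ, cf_trunc] using this
  have hππ : ∀ p, π p * π p = π p := fun p => op_ext fun φ S m n => by
    rw [Module.End.mul_apply, hπ, cf_trunc, cf_trunc]
    split_ifs <;> rfl
  rw [Module.End.isUnit_iff]
  constructor
  · rw [injective_iff_map_eq_zero]
    intro ψ hψ
    have hX : X ψ = ψ := by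
      rw [LinearMap.sub_apply, Module.End.one_apply, sub_eq_zero] at hψ
      exact hψ.symm
    refine hext fun p => ?_
    obtain ⟨K, hK⟩ := hnil ψ p
    -- A fixed point of X is fixed by all its powers, while a power of X kills its component of
    -- degree p.
    have hXK : (X ^ K) ψ = ψ := by
      clear hK
      induction K with
      | zero => rfl
      | succ K ih => rw [pow_succ, Module.End.mul_apply, hX, ih]
    have := LinearMap.congr_fun ((hcomm p).pow_left K).eq ψ
    rw [Module.End.mul_apply, Module.End.mul_apply, hXK, hK] at this
    rw [← this, map_zero]
  · intro φ
    choose K hK using hnil φ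
    set ψ : ℤ → States C d := fun p => (∑ k ∈ Finset.range (K p), X ^ k) (π p φ) with hψ
    have h1 : ∀ p, (1 - X) (ψ p) = π p φ := fun p => by
      rw [hψ]
      change ((1 - X) * ∑ k ∈ Finset.range (K p), X ^ k) (π p φ) = _
      rw [mul_neg_geom_sum, LinearMap.sub_apply, hK, sub_zero, Module.End.one_apply]
    have h2 : ∀ p, π p (ψ p) = ψ p := fun p => by
      have : Commute (∑ k ∈ Finset.range (K p), X ^ k) (π p) :=
        Commute.sum_left _ _ _ fun k _ => (hcomm p).pow_left k
      have h := LinearMap.congr_fun this.eq (π p φ)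
      rw [Module.End.mul_apply, ← Module.End.mul_apply (π p) (π p), hππ] at h
      exact h.symm
    -- Glue the solutions found in the separate degrees. `yDeg` ignores the a†-exponent, so it may
    -- be evaluated at 0, and the whole a†-polynomial at (S, m) comes from a single component.
    set Ψ : States C d := fun S m => MvPowerSeries.coeff m (ψ ((yDeg d).val S m 0) S) with hΨ
    have h3 : ∀ p, π p Ψ = ψ p := fun p => states_ext fun S m n => by
      have e : cf Ψ S m n = cf (ψ ((yDeg d).val S m 0)) S m n := rfl
      have e2 : (yDeg d).val S m 0 = (yDeg d).val S m n := by rw [val_yDeg, val_yDeg]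
      rw [← h2, hπ, cf_trunc, cf_trunc, e, e2]
      split_ifs with hp
      · rw [hp]
      · rfl
    refine ⟨Ψ, hext fun p => ?_⟩
    have : Commute (1 - X) (π p) := (Commute.one_left _).sub_left (hcomm p)
    have h := LinearMap.congr_fun this.eq Ψ
    rw [Module.End.mul_apply, Module.End.mul_apply, h3, h1] at h
    exact h.symm

end LocallyNilpotent

/-! ### Order and Y-adic continuity of the operators -/

section DifferentialOperators

variable {C : Type*} [CommRing C] [Algebra ℝ C] {d : ℕ} {O P : Op C d}

theorem mul_mul_sub_mul_mul {R : Type*} [Ring R] (a b c : R) :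
    a * b * c - c * (a * b) = a * (b * c - c * b) + (a * c - c * a) * b := by
  noncomm_ring

theorem hasOrderLE_zero (k : ℕ) : HasOrderLE k (0 : Op C d) := by
  induction k with
  | zero => intro f; simp
  | succ k ih => intro f; simpa using ih

theorem HasOrderLE.succ : ∀ {k : ℕ} {O : Op C d}, HasOrderLE k O → HasOrderLE (k + 1) O
  | 0, O, h => fun f => by rw [h f]; exact hasOrderLE_zero 0
  | k + 1, O, h => fun f => (h f).succ

theorem HasOrderLE.mono {k l : ℕ} (hkl : k ≤ l) (h : HasOrderLE k O) : HasOrderLE l O := by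
  induction l, hkl using Nat.le_induction with
  | base => exact h
  | succ l _ ih => exact ih.succ

theorem HasOrderLE.add : ∀ {k : ℕ} {O P : Op C d}, HasOrderLE k O → HasOrderLE k P →
    HasOrderLE k (O + P)
  | 0, O, P, h, h' => fun f => by
    have : (O + P) * mulC f - mulC f * (O + P)
      = (O * mulC f - mulC f * O) + (P * mulC f - mulC f * P) := by noncomm_ring
    rw [this, h f, h' f, add_zero]
  | k + 1, O, P, h, h' => fun f => by
    have : (O + P) * mulC f - mulC f * (O + P)
      = (O * mulC f - mulC f * O) + (P * mulC f - mulC f * P) := by noncomm_ring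
    rw [this]
    exact (h f).add (h' f)

theorem HasOrderLE.commute_mulC (h : HasOrderLE 0 O) (f : C) : Commute O (mulC f) :=
  sub_eq_zero.1 (h f)

theorem HasOrderLE.smul (r : ℝ) : ∀ {k : ℕ} {O : Op C d}, HasOrderLE k O → HasOrderLE k (r • O)
  | 0, O, h => fun f => by
    rw [smul_mul_assoc, mul_smul_comm, h.commute_mulC f]
    exact sub_self _
  | k + 1, O, h => fun f => by
    rw [smul_mul_assoc, mul_smul_comm]
    exact (smul_sub r (O * mulC f) (mulC f * O)) ▸ (h f).smul r

theorem HasOrderLE.mul : ∀ {j k : ℕ} {O P : Op C d}, HasOrderLE j O → HasOrderLE k P →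
    HasOrderLE (j + k) (O * P) := by
  -- Induction on the total order: by the Leibniz rule, the commutator of a product with a function
  -- is a sum of products in which one factor has lost an order.
  have main : ∀ (N j k : ℕ), j + k = N → ∀ O P : Op C d, HasOrderLE j O → HasOrderLE k P →
      HasOrderLE N (O * P) := by
    intro N
    induction N with
    | zero =>
      intro j k h O P hO hP f
      obtain ⟨rfl, rfl⟩ : j = 0 ∧ k = 0 := by lia
      rw [mul_mul_sub_mul_mul, hO f, hP f, mul_zero, zero_mul, add_zero]
    | succ N ih =>
      intro j k h O P hO hP f
      rw [mul_mul_sub_mul_mul]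
      refine HasOrderLE.add ?_ ?_
      · cases k with
        | zero => rw [hP f, mul_zero]; exact hasOrderLE_zero _
        | succ k => exact ih j k (by lia) _ _ hO (hP f)
      · cases j with
        | zero => rw [hO f, zero_mul]; exact hasOrderLE_zero _
        | succ j => exact ih j k (by lia) _ _ (hO f) hP
  intro j k O P hO hP
  exact main _ j k rfl O P hO hP

theorem hasOrderLE_zero_of_commute (h : ∀ f, Commute O (mulC f)) : HasOrderLE 0 O :=
  fun f => sub_eq_zero.2 (h f)

theorem isYContinuous_of_shift {k : ℤ} (h : Shift (yDeg d) k O) : IsYContinuous O := by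
  intro N
  -- The ghosts contribute between 0 and 3 to `yDeg`; the margin 3 absorbs the gap between `yDeg`
  -- and the actual degree in Y.
  refine ⟨(N + 3 - k).toNat, fun φ hφ S m hm => MvPolynomial.ext _ _ fun n => ?_⟩
  have h1 : φ ∈ filt C (yDeg d) (N + 3 - k) := fun S m n h0 => by
    by_contra h2
    refine h0 ?_
    have : Finsupp.degree m < (N + 3 - k).toNat := by
      rw [val_yDeg] at h2
      split_ifs at h2 <;> lia
    simp [cf, hφ S m this]
  by_contra h0
  have := h _ _ h1 S m n h0
  rw [val_yDeg] at this
  split_ifs at this <;> lia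

/-- Differential operators of order at most `k` that are homogeneous enough to be continuous. -/
structure TameOp (k : ℕ) (O : Op C d) : Prop where
  order : HasOrderLE k O
  shift : ∃ l, Shift (yDeg d) l O

variable {j k : ℕ}

theorem TameOp.isDiffOp (h : TameOp k O) : IsDiffOp k O :=
  ⟨h.order, isYContinuous_of_shift h.shift.choose_spec⟩

theorem TameOp.mono (hjk : j ≤ k) (h : TameOp j O) : TameOp k O := ⟨h.order.mono hjk, h.shift⟩

theorem TameOp.add (hO : TameOp k O) (hP : TameOp k P) : TameOp k (O + P) := by
  obtain ⟨l, hl⟩ := hO.shift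
  obtain ⟨l', hl'⟩ := hP.shift
  exact ⟨hO.order.add hP.order, min l l', (hl.mono (min_le_left _ _)).add
    (hl'.mono (min_le_right _ _))⟩

theorem TameOp.smul (r : ℝ) (hO : TameOp k O) : TameOp k (r • O) :=
  ⟨hO.order.smul r, hO.shift.imp fun _ h => h.smul r⟩

theorem TameOp.neg (hO : TameOp k O) : TameOp k (-O) :=
  neg_one_smul ℝ O ▸ hO.smul (-1)

theorem TameOp.sub (hO : TameOp k O) (hP : TameOp k P) : TameOp k (O - P) := by
  rw [sub_eq_add_neg]; exact hO.add hP.neg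

theorem TameOp.mul (hO : TameOp j O) (hP : TameOp k P) : TameOp (j + k) (O * P) := by
  obtain ⟨l, hl⟩ := hO.shift
  obtain ⟨l', hl'⟩ := hP.shift
  exact ⟨hO.order.mul hP.order, l + l', hl.mul hl'⟩

theorem TameOp.zero_mul (hO : TameOp 0 O) (hP : TameOp k P) : TameOp k (O * P) := by
  simpa using hO.mul hP

theorem TameOp.mul_zero (hO : TameOp k O) (hP : TameOp 0 P) : TameOp k (O * P) := by
  simpa using hO.mul hP

theorem tameOp_zero : TameOp k (0 : Op C d) := ⟨hasOrderLE_zero k, 0, shift_zero⟩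

theorem TameOp.sum {ι : Type*} {s : Finset ι} {f : ι → Op C d} (h : ∀ i, TameOp k (f i)) :
    TameOp k (∑ i ∈ s, f i) := by
  classical
  induction s using Finset.induction_on with
  | empty => simpa using tameOp_zero
  | insert a s ha ih =>
    rw [Finset.sum_insert ha]
    exact (h a).add ih

theorem tameOp_diag (g : Finset (Ghost d) → (Fin (d + 1) →₀ ℕ) → (Fin (d + 1) →₀ ℕ) → ℝ) :
    TameOp 0 (diag g : Op C d) :=
  ⟨hasOrderLE_zero_of_commute fun _ => (commute_onBase_diag _ g).symm, 0, shift_diag g⟩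

theorem tameOp_one : TameOp 0 (1 : Op C d) := diag_one (C := C) (d := d) ▸ tameOp_diag 1

theorem tameOp_ghostMul (i : Ghost d) : TameOp 0 (ghostMul C i) :=
  ⟨hasOrderLE_zero_of_commute fun f => (isCoeffOp_mulC f).commute_ghostMul i, _, shift_ghostMul i⟩

theorem tameOp_ghostDer (i : Ghost d) : TameOp 0 (ghostDer C i) :=
  ⟨hasOrderLE_zero_of_commute fun f => (isCoeffOp_mulC f).commute_ghostDer i, _, shift_ghostDer i⟩

theorem tameOp_dY (A : Fin (d + 1)) : TameOp 0 (dY C A) :=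
  ⟨hasOrderLE_zero_of_commute fun _ => (commute_onBase_dY _ _).symm, _, shift_dY A⟩

theorem tameOp_mulY (A : Fin (d + 1)) : TameOp 0 (mulY C A) :=
  ⟨hasOrderLE_zero_of_commute fun _ => (commute_onBase_mulY _ _).symm, _, shift_mulY A⟩

theorem tameOp_dA (A : Fin (d + 1)) : TameOp 0 (dA C A) :=
  ⟨hasOrderLE_zero_of_commute fun _ => (commute_onBase_dA _ _).symm, _, shift_dA A⟩

theorem tameOp_mulA (A : Fin (d + 1)) : TameOp 0 (mulA C A) :=
  ⟨hasOrderLE_zero_of_commute fun _ => (commute_onBase_mulA _ _).symm, _, shift_mulA A⟩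

theorem tameOp_mulC (f : C) : TameOp 0 (mulC f : Op C d) :=
  ⟨hasOrderLE_zero_of_commute fun g => commute_mulC_mulC f g, _, shift_mulC f⟩

theorem tameOp_box : TameOp 0 (box C d) :=
  .sum fun A => .smul _ ((tameOp_dY A).mul (tameOp_dY A))

theorem tameOp_opS : TameOp 0 (opS C d) :=
  .sum fun A => .smul _ ((tameOp_dA A).mul (tameOp_dY A))

theorem tameOp_opT : TameOp 0 (opT C d) :=
  .sum fun A => .smul _ ((tameOp_dA A).mul (tameOp_dA A))

theorem tameOp_opSd : TameOp 0 (opSd C d) :=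
  .sum fun A => (tameOp_mulA A).mul (tameOp_dY A)

theorem tameOp_opSbd (V : Fin (d + 1) → C) : TameOp 0 (opSbd V) :=
  .sum fun A => ((tameOp_mulY A).add (tameOp_mulC _)).mul (tameOp_dA A)

theorem tameOp_opH (V : Fin (d + 1) → C) : TameOp 0 (opH V) :=
  .sub (.sum fun A => (tameOp_mulA A).mul (tameOp_dA A))
    (.sum fun A => ((tameOp_mulY A).add (tameOp_mulC _)).mul (tameOp_dY A))

theorem tameOp_omegaTrace : TameOp 0 (omegaTrace C d) :=
  (((tameOp_ghostMul _).mul tameOp_box).add ((tameOp_ghostMul _).mul tameOp_opS)).add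
    ((tameOp_ghostMul _).mul tameOp_opT)

theorem tameOp_two : TameOp 0 (2 : Op C d) := by
  rw [← one_add_one_eq_two]; exact tameOp_one.add tameOp_one

theorem tameOp_omegaTilde (V : Fin (d + 1) → C) : TameOp 0 (omegaTilde V) := by
  unfold omegaTilde
  have m := tameOp_ghostMul (C := C) (d := d)
  have D := tameOp_ghostDer (C := C) (d := d)
  refine .add (.add (.add (.add (.add ?_ ?_) ?_) ?_) ?_) ?_
  · exact tameOp_opSd.mul (D _)
  · exact (m _).mul ((tameOp_opH V).sub tameOp_two)
  · exact (m _).mul (tameOp_opSbd V)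
  · exact (((m _).mul (m _)).mul (D _)).smul _
  · exact (((m _).mul (m _)).mul (D _)).smul _
  · exact ((m _).mul (D _)).mul (D _)

end DifferentialOperators

/-! ### Distinctness of the ghost variables -/

section GhostDistinct

variable {d : ℕ}

theorem gc0_ne_gcd : (gc0 : Ghost d) ≠ gcd := by simp [gc0, gcd]
theorem gc0_ne_gbd : (gc0 : Ghost d) ≠ gbd := by simp [gc0, gbd]
theorem gc0_ne_gxi : (gc0 : Ghost d) ≠ gxi := by simp [gc0, gxi]
theorem gc0_ne_gmu : (gc0 : Ghost d) ≠ gmu := by simp [gc0, gmu]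
theorem gc0_ne_gnu : (gc0 : Ghost d) ≠ gnu := by simp [gc0, gnu]
theorem gcd_ne_gbd : (gcd : Ghost d) ≠ gbd := by simp [gcd, gbd]
theorem gcd_ne_gxi : (gcd : Ghost d) ≠ gxi := by simp [gcd, gxi]
theorem gcd_ne_gmu : (gcd : Ghost d) ≠ gmu := by simp [gcd, gmu]
theorem gcd_ne_gnu : (gcd : Ghost d) ≠ gnu := by simp [gcd, gnu]
theorem gbd_ne_gxi : (gbd : Ghost d) ≠ gxi := by simp [gbd, gxi]
theorem gbd_ne_gmu : (gbd : Ghost d) ≠ gmu := by simp [gbd, gmu]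
theorem gbd_ne_gnu : (gbd : Ghost d) ≠ gnu := by simp [gbd, gnu]
theorem gxi_ne_gmu : (gxi : Ghost d) ≠ gmu := by simp [gxi, gmu]
theorem gxi_ne_gnu : (gxi : Ghost d) ≠ gnu := by simp [gxi, gnu]
theorem gmu_ne_gnu : (gmu : Ghost d) ≠ gnu := by simp [gmu, gnu]
theorem gth_ne_gc0 (m : Fin d) : gth m ≠ gc0 := by simp [gth, gc0]
theorem gth_ne_gcd (m : Fin d) : gth m ≠ gcd := by simp [gth, gcd]
theorem gth_ne_gbd (m : Fin d) : gth m ≠ gbd := by simp [gth, gbd]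
theorem gth_ne_gxi (m : Fin d) : gth m ≠ gxi := by simp [gth, gxi]
theorem gth_ne_gmu (m : Fin d) : gth m ≠ gmu := by simp [gth, gmu]
theorem gth_ne_gnu (m : Fin d) : gth m ≠ gnu := by simp [gth, gnu]

end GhostDistinct

/-! ### Ring identities for odd operators and homotopies -/

section RingIdentities

variable {R : Type*} [Ring R]

/-- The ghost factors anticommute and their partners commute; this removes the cross terms in
squares and anticommutators of sums of such products. -/
theorem mul_anticomm {c b P M : R} (hcb : b * c = -(c * b)) (hPM : Commute P M)
    (hcM : Commute c M) (hbP : Commute b P) :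
    c * P * (b * M) + b * M * (c * P) = 0 := by
  have e1 : c * P * (b * M) = c * b * (P * M) := by
    rw [mul_assoc, ← mul_assoc P, ← hbP.eq]; simp only [mul_assoc]
  have e2 : b * M * (c * P) = b * c * (M * P) := by
    rw [mul_assoc, ← mul_assoc M, ← hcM.eq]; simp only [mul_assoc]
  rw [e1, e2, hcb, hPM.eq, neg_mul, add_neg_cancel]

theorem mul_add_mul_eq {c b P M : R} (hcM : Commute c M) (hbP : Commute b P) :
    c * P * (b * M) + b * M * (c * P) = c * b * (P * M) + b * c * (M * P) := by
  have e1 : c * P * (b * M) = c * b * (P * M) := by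
    rw [mul_assoc, ← mul_assoc P, ← hbP.eq]; simp only [mul_assoc]
  have e2 : b * M * (c * P) = b * c * (M * P) := by
    rw [mul_assoc, ← mul_assoc M, ← hcM.eq]; simp only [mul_assoc]
  rw [e1, e2]

theorem mul_self_eq_zero_of_commute {c P : R} (hc : c * c = 0) (hcP : Commute c P) :
    c * P * (c * P) = 0 := by
  rw [hcP.symm.mul_mul_mul_comm, hc, zero_mul]

/-- Since D² = 0 and eD = 0, the operator L commutes with D(1 − e), hence so does its inverse.
Multiplying the homotopy by this inverse therefore normalises the anticommutator to the identity off
the image of e. -/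
theorem homotopy_of_unit {D s e L Li : R} (hD : D * D = 0) (he : e * e = e) (heD : e * D = 0)
    (hL : L = (D * s + s * D) * (1 - e) + e) (hLe : Commute L e) (h1 : L * Li = 1)
    (h2 : Li * L = 1) :
    (D * (s * Li * (1 - e)) + s * Li * (1 - e) * D) * (1 - e) = 1 - e := by
  have hLie : Li * e = e * Li := by
    calc Li * e = Li * (e * L) * Li := by rw [mul_assoc, mul_assoc e, h1, mul_one]
      _ = e * Li := by rw [← hLe.eq, ← mul_assoc, h2, one_mul]
  have hf : (1 - e) * (1 - e) = 1 - e := by rw [mul_sub, sub_mul, sub_mul, he]; simp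
  have hfD : (1 - e) * D = D := by rw [sub_mul, heD, one_mul, sub_zero]
  have hLif : Li * (1 - e) = (1 - e) * Li := by rw [mul_sub, sub_mul, hLie]; simp
  have hLf : L * (1 - e) = (1 - e) * L := by rw [mul_sub, sub_mul, hLe.eq]; simp
  have hef : e * (1 - e) = 0 := by rw [mul_sub, he]; simp
  have k1 : L * (D * (1 - e)) = D * (1 - e) * L := by
    rw [mul_assoc, ← hLf, hL]
    simp only [add_mul, mul_add, mul_assoc, hf, hef, add_zero]
    rw [← mul_assoc (1 - e) D, hfD, ← mul_assoc D D, hD, zero_mul, ← mul_assoc e D, heD]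
    simp only [zero_mul, add_zero, zero_add]
    rw [← mul_assoc D D, hD, zero_mul, mul_zero, add_zero, zero_add]
  have k2 : D * (1 - e) * Li = Li * (D * (1 - e)) := by
    calc D * (1 - e) * Li = Li * (L * (D * (1 - e))) * Li := by rw [← mul_assoc, h2, one_mul]
      _ = Li * (D * (1 - e)) * (L * Li) := by rw [k1]; simp only [mul_assoc]
      _ = _ := by rw [h1, mul_one]
  have k3 : (D * s + s * D) * (1 - e) = L - e := by rw [hL, add_sub_cancel_right]
  calc (D * (s * Li * (1 - e)) + s * Li * (1 - e) * D) * (1 - e)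
      = D * s * (Li * ((1 - e) * (1 - e))) + s * (Li * ((1 - e) * D * (1 - e))) := by
        simp only [add_mul, mul_assoc]
    _ = (D * s + s * D) * ((1 - e) * Li) := by
        rw [hf, hfD, ← k2, hLif, add_mul]; simp only [mul_assoc]
    _ = (L - e) * Li * ((1 - e) * 1) := by
        rw [← mul_assoc, k3, mul_one, ← k3, mul_assoc _ (1 - e), mul_assoc, mul_assoc (1 - e),
          hLif, ← mul_assoc (1 - e), hf]
    _ = 1 - e := by
        rw [mul_one, sub_mul, h1, sub_mul, one_mul, mul_assoc, hLif, ← mul_assoc, hef, zero_mul,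
          sub_zero]

end RingIdentities

/-! ### The Koszul differential `omegaTrace` and its degree -/

section TraceOperator

variable (C : Type*) [CommRing C] [Algebra ℝ C] (d : ℕ)

theorem commute_box_opS : Commute (box C d) (opS C d) :=
  .sum_left _ _ _ fun A _ => .sum_right _ _ _ fun B _ => .smul_left (.smul_right
    (.mul_left (.mul_right (commute_dA_dY C B A).symm (commute_dY_dY C A B))
      (.mul_right (commute_dA_dY C B A).symm (commute_dY_dY C A B))) _) _

theorem commute_box_opT : Commute (box C d) (opT C d) :=
  .sum_left _ _ _ fun A _ => .sum_right _ _ _ fun B _ => .smul_left (.smul_right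
    (.mul_left (.mul_right (commute_dA_dY C B A).symm (commute_dA_dY C B A).symm)
      (.mul_right (commute_dA_dY C B A).symm (commute_dA_dY C B A).symm)) _) _

theorem commute_opS_opT : Commute (opS C d) (opT C d) :=
  .sum_left _ _ _ fun A _ => .sum_right _ _ _ fun B _ => .smul_left (.smul_right
    (.mul_left (.mul_right (commute_dA_dA C A B) (commute_dA_dA C A B))
      (.mul_right (commute_dA_dY C B A).symm (commute_dA_dY C B A).symm)) _) _

theorem omegaTrace_mul_self : omegaTrace C d * omegaTrace C d = 0 := by
  have z1 := mul_self_eq_zero_of_commute (ghostMul_mul_self gc0 C)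
    (isCoeffOp_box.commute_ghostMul (d := d) (C := C) gc0)
  have z2 := mul_self_eq_zero_of_commute (ghostMul_mul_self gcd C)
    (isCoeffOp_opS.commute_ghostMul (d := d) (C := C) gcd)
  have z3 := mul_self_eq_zero_of_commute (ghostMul_mul_self gxi C)
    (isCoeffOp_opT.commute_ghostMul (d := d) (C := C) gxi)
  have z12 := mul_anticomm (ghostMul_ghostMul C gc0_ne_gcd.symm) (commute_box_opS C d)
    (isCoeffOp_opS.commute_ghostMul gc0) (isCoeffOp_box.commute_ghostMul gcd)
  have z13 := mul_anticomm (ghostMul_ghostMul C gc0_ne_gxi.symm) (commute_box_opT C d)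
    (isCoeffOp_opT.commute_ghostMul gc0) (isCoeffOp_box.commute_ghostMul gxi)
  have z23 := mul_anticomm (ghostMul_ghostMul C gcd_ne_gxi.symm) (commute_opS_opT C d)
    (isCoeffOp_opT.commute_ghostMul gcd) (isCoeffOp_opS.commute_ghostMul gxi)
  unfold omegaTrace
  set x := ghostMul C gc0 * box C d
  set y := ghostMul C gcd * opS C d
  set z := ghostMul C gxi * opT C d
  calc (x + y + z) * (x + y + z) = x * x + y * y + z * z + (x * y + y * x) + (x * z + z * x)
        + (y * z + z * y) := by simp only [add_mul, mul_add]; abel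
    _ = 0 := by rw [z1, z2, z3, z12, z13, z23]; simp

/-- The projection to degree zero. -/
def degZero : Op C d := trunc fun S m n => (ghostWeight tdeg).val S m n = 0

variable {C d}

theorem val_tdeg_eq_zero_iff {S : Finset (Ghost d)} {m n : Fin (d + 1) →₀ ℕ} :
    (ghostWeight tdeg).val S m n = 0 ↔ gc0 ∉ S ∧ gcd ∉ S ∧ gxi ∉ S := by
  rw [val_ghostWeight, sum_tdeg]
  simp only [Int.neg_eq_zero, Nat.cast_eq_zero, Finset.card_eq_zero]
  rw [← Finset.disjoint_iff_inter_eq_empty, Finset.disjoint_insert_right,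
    Finset.disjoint_insert_right, Finset.disjoint_singleton_right]

theorem degZero_mul_self : degZero C d * degZero C d = degZero C d := op_ext fun φ S m n => by
  rw [Module.End.mul_apply, degZero, cf_trunc, cf_trunc]
  split_ifs <;> rfl

theorem tameOp_degZero : TameOp 0 (degZero C d) := tameOp_diag _

theorem shift_degZero {w : Weight d} : Shift w 0 (degZero C d) := shift_diag _

theorem mem_traceDeg_zero_iff {φ : States C d} : φ ∈ traceDeg C d 0 ↔ degZero C d φ = φ := by
  classical
  constructor
  · intro h
    refine states_ext fun S m n => ?_
    rw [degZero, cf_trunc, val_ghostWeight, sum_tdeg]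
    split_ifs with h0
    · rfl
    · by_contra h1
      exact h0 (h S fun h2 => h1 (by simp [cf, h2]))
  · intro h S hS
    by_contra h0
    refine hS (MvPowerSeries.ext fun m => MvPolynomial.ext _ _ fun n => ?_)
    have := congrArg (fun x => cf x S m n) h
    simp only [degZero, cf_trunc, val_ghostWeight, sum_tdeg, if_neg h0] at this
    simpa [cf] using this.symm

variable {g : Ghost d → ℤ}

theorem shift_omegaTrace_ghostWeight {k : ℤ} (h0 : k ≤ g gc0) (h1 : k ≤ g gcd) (h2 : k ≤ g gxi) :
    Shift (ghostWeight g) k (omegaTrace C d) :=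
  .add (.add (((shift_ghostMul gc0).mul (isCoeffOp_box.shift g)).mono (by simpa [ghostWeight]))
    (((shift_ghostMul gcd).mul (isCoeffOp_opS.shift g)).mono (by simpa [ghostWeight])))
    (((shift_ghostMul gxi).mul (isCoeffOp_opT.shift g)).mono (by simpa [ghostWeight]))

theorem shift_omegaTrace_tdeg : Shift (ghostWeight tdeg) (-1) (omegaTrace C d) :=
  shift_omegaTrace_ghostWeight (by simp [tdeg]) (by simp [tdeg]) (by simp [tdeg])

theorem shift_omegaTrace_neg_tdeg : Shift (ghostWeight (-tdeg)) 1 (omegaTrace C d) :=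
  shift_omegaTrace_ghostWeight (by simp [tdeg]) (by simp [tdeg]) (by simp [tdeg])

theorem mem_filt_tdeg (φ : States C d) : φ ∈ filt C (ghostWeight tdeg) (-3) :=
  mem_filt_ghostWeight.2 fun S _ => (sum_tdeg_mem_Icc S).1

theorem mem_filt_neg_tdeg (φ : States C d) : φ ∈ filt C (ghostWeight (-tdeg)) 0 :=
  mem_filt_ghostWeight.2 fun S _ => by
    simpa [Finset.sum_neg_distrib] using (sum_tdeg_mem_Icc S).2

/-- Zero is the highest degree, so an operator that lowers the degree has no output there. -/
theorem degZero_mul_eq_zero {O : Op C d} (h : Shift (ghostWeight (-tdeg)) 1 O) :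
    degZero C d * O = 0 := op_ext fun φ S m n => by
  rw [Module.End.mul_apply, degZero, cf_trunc]
  split_ifs with h0
  · rw [LinearMap.zero_apply, cf_zero]
    by_contra h1
    have := h _ _ (mem_filt_neg_tdeg φ) S m n h1
    rw [← neg_ghostWeight, Weight.val_neg, h0] at this
    lia
  · rfl

end TraceOperator

/-! ### The contracting homotopy of `omegaTrace` -/

section Homotopy

variable {C : Type*} [CommRing C] [Algebra ℝ C] {d : ℕ}

theorem anticomm_sum_three {R : Type*} [Ring R] {x₁ x₂ x₃ y₁ y₂ y₃ : R}
    (h12 : x₁ * y₂ + y₂ * x₁ = 0) (h13 : x₁ * y₃ + y₃ * x₁ = 0) (h21 : x₂ * y₁ + y₁ * x₂ = 0)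
    (h23 : x₂ * y₃ + y₃ * x₂ = 0) (h31 : x₃ * y₁ + y₁ * x₃ = 0) (h32 : x₃ * y₂ + y₂ * x₃ = 0) :
    (x₁ + x₂ + x₃) * (y₁ + y₂ + y₃) + (y₁ + y₂ + y₃) * (x₁ + x₂ + x₃)
      = (x₁ * y₁ + y₁ * x₁) + (x₂ * y₂ + y₂ * x₂) + (x₃ * y₃ + y₃ * x₃) := by
  calc _ = (x₁ * y₁ + y₁ * x₁) + (x₂ * y₂ + y₂ * x₂) + (x₃ * y₃ + y₃ * x₃)
        + (x₁ * y₂ + y₂ * x₁) + (x₁ * y₃ + y₃ * x₁) + (x₂ * y₁ + y₁ * x₂)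
        + (x₂ * y₃ + y₃ * x₂) + (x₃ * y₁ + y₁ * x₃) + (x₃ * y₂ + y₂ * x₃) := by
        simp only [add_mul, mul_add]; abel
    _ = _ := by rw [h12, h13, h21, h23, h31, h32]; simp only [add_zero]

theorem commute_of_inverse {R : Type*} [Ring R] {L Li f : R} (h : Commute L f) (h1 : L * Li = 1)
    (h2 : Li * L = 1) : Commute Li f := by
  calc Li * f = Li * (f * L) * Li := by rw [mul_assoc, mul_assoc f, h1, mul_one]
    _ = f * Li := by rw [← h.eq, ← mul_assoc, h2, one_mul]

theorem neg_def (w : Weight d) : -w = ⟨-w.g, -w.y, -w.a⟩ := rfl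

theorem eta_mul_self (A : Fin (d + 1)) : eta A * eta A = 1 := by
  unfold eta; split_ifs <;> norm_num

variable (A₀ A₁ A₂ : Fin (d + 1))

/-- A weight for which `c₀ ∂²/∂Y¹∂Y¹`, `c† ∂²/∂a²∂Y²` and `ξ ∂²/∂a⁰∂a⁰` have weight zero and all
other terms of `Ω_trace` have positive weight. -/
def leadWeight : Weight d where
  g i := (if i = gc0 then 2 else 0) + (if i = gxi then 2 else 0)
  -- Weight 1 for Y along A₁ and for a† along A₀ balances the ghost weight 2 in the leading terms of
  -- □ and T. The value −10 for their partners gives the terms of S along A₀ and A₁ positive weight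
  -- 9; it also fixes the constant 10 in `le_leadWeight`.
  y A := if A = A₀ then -10 else if A = A₁ then 1 else if A = A₂ then 0 else -1
  a A := if A = A₀ then 1 else if A = A₁ then -10 else if A = A₂ then 0 else -1

theorem leadWeight_le (S : Finset (Ghost d)) (m n : Fin (d + 1) →₀ ℕ) :
    (leadWeight A₀ A₁ A₂).val S m n ≤ (yDeg d).val S m n + (aDeg d).val S m n := by
  have h1 : ∑ i ∈ S, (leadWeight A₀ A₁ A₂).g i
      ≤ ∑ i ∈ S, (yDeg d).g i + ∑ i ∈ S, (aDeg d).g i := by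
    rw [← Finset.sum_add_distrib]
    refine Finset.sum_le_sum fun i _ => ?_
    simp only [leadWeight, yDeg, aDeg]
    split_ifs <;> simp
  have h2 : ∑ A, (m A : ℤ) * (leadWeight A₀ A₁ A₂).y A ≤ ∑ A, (m A : ℤ) * (yDeg d).y A := by
    refine Finset.sum_le_sum fun A _ => mul_le_mul_of_nonneg_left ?_ (by positivity)
    simp only [leadWeight, yDeg]
    split_ifs <;> simp
  have h3 : ∑ A, (n A : ℤ) * (leadWeight A₀ A₁ A₂).a A ≤ ∑ A, (n A : ℤ) * (aDeg d).a A := by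
    refine Finset.sum_le_sum fun A _ => mul_le_mul_of_nonneg_left ?_ (by positivity)
    simp only [leadWeight, aDeg]
    split_ifs <;> simp
  have h4 : ∑ A, (m A : ℤ) * (aDeg d).y A = 0 := by simp [aDeg]
  have h5 : ∑ A, (n A : ℤ) * (yDeg d).a A = 0 := by simp [yDeg]
  unfold Weight.val
  lia

theorem le_leadWeight (S : Finset (Ghost d)) (m n : Fin (d + 1) →₀ ℕ) :
    -(10 * ((yDeg d).val S m n + (aDeg d).val S m n)) ≤ (leadWeight A₀ A₁ A₂).val S m n := by
  have h1 : -10 * (∑ i ∈ S, (yDeg d).g i + ∑ i ∈ S, (aDeg d).g i)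
      ≤ ∑ i ∈ S, (leadWeight A₀ A₁ A₂).g i := by
    rw [← Finset.sum_add_distrib, Finset.mul_sum]
    refine Finset.sum_le_sum fun i _ => ?_
    simp only [leadWeight, yDeg, aDeg]
    split_ifs <;> simp
  have h2 : -10 * ∑ A, (m A : ℤ) * (yDeg d).y A ≤ ∑ A, (m A : ℤ) * (leadWeight A₀ A₁ A₂).y A := by
    rw [Finset.mul_sum]
    refine Finset.sum_le_sum fun A _ => ?_
    rw [mul_left_comm]
    refine mul_le_mul_of_nonneg_left ?_ (by positivity)
    simp only [leadWeight, yDeg]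
    split_ifs <;> simp
  have h3 : -10 * ∑ A, (n A : ℤ) * (aDeg d).a A ≤ ∑ A, (n A : ℤ) * (leadWeight A₀ A₁ A₂).a A := by
    rw [Finset.mul_sum]
    refine Finset.sum_le_sum fun A _ => ?_
    rw [mul_left_comm]
    refine mul_le_mul_of_nonneg_left ?_ (by positivity)
    simp only [leadWeight, aDeg]
    split_ifs <;> simp
  have h4 : ∑ A, (m A : ℤ) * (aDeg d).y A = 0 := by simp [aDeg]
  have h5 : ∑ A, (n A : ℤ) * (yDeg d).a A = 0 := by simp [yDeg]
  unfold Weight.val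
  lia

variable (C)

/-- The leading part of `Ω_trace`. -/
def leadTrace : Op C d :=
  ghostMul C gc0 * (eta A₁ • (dY C A₁ * dY C A₁)) + ghostMul C gcd * (eta A₂ • (dA C A₂ * dY C A₂))
    + ghostMul C gxi * (eta A₀ • (dA C A₀ * dA C A₀))

/-- The homotopy built from the multiplication operators adjoint to the leading part. -/
def leadHomotopy : Op C d :=
  ghostDer C gc0 * (eta A₁ • (mulY C A₁ * mulY C A₁))
    + ghostDer C gcd * (eta A₂ • (mulA C A₂ * mulY C A₂))
    + ghostDer C gxi * (eta A₀ • (mulA C A₀ * mulA C A₀))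

/-- The eigenvalues of the anticommutator of `leadTrace` and `leadHomotopy`. -/
def leadEigen (S : Finset (Ghost d)) (m n : Fin (d + 1) →₀ ℕ) : ℝ :=
  (if gc0 ∈ S then ((m A₁ : ℝ) + 1) * ((m A₁ : ℝ) + 1) + ((m A₁ : ℝ) + 1)
    else (m A₁ : ℝ) * m A₁ - m A₁)
  + (if gcd ∈ S then ((n A₂ : ℝ) + 1) * ((m A₂ : ℝ) + 1) else (n A₂ : ℝ) * m A₂)
  + (if gxi ∈ S then ((n A₀ : ℝ) + 1) * ((n A₀ : ℝ) + 1) + ((n A₀ : ℝ) + 1)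
    else (n A₀ : ℝ) * n A₀ - n A₀)

/-- Every summand is nonnegative because k² − k ≥ 0 for natural k, and each trace ghost that is
present makes its own summand strictly positive. -/
theorem leadEigen_pos {S : Finset (Ghost d)} (m n : Fin (d + 1) →₀ ℕ)
    (h : ¬(gc0 ∉ S ∧ gcd ∉ S ∧ gxi ∉ S)) : 0 < leadEigen A₀ A₁ A₂ S m n := by
  have key : ∀ k : ℕ, (0 : ℝ) ≤ (k : ℝ) * k - k := fun k => by
    rcases Nat.eq_zero_or_pos k with rfl | hk
    · simp
    · have : (1 : ℝ) ≤ k := by exact_mod_cast hk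
      nlinarith
  have k1 := key (m A₁)
  have k0 := key (n A₀)
  have p1 : (0 : ℝ) < ((m A₁ : ℝ) + 1) * ((m A₁ : ℝ) + 1) + ((m A₁ : ℝ) + 1) := by positivity
  have p0 : (0 : ℝ) < ((n A₀ : ℝ) + 1) * ((n A₀ : ℝ) + 1) + ((n A₀ : ℝ) + 1) := by positivity
  have p2 : (0 : ℝ) < ((n A₂ : ℝ) + 1) * ((m A₂ : ℝ) + 1) := by positivity
  have k2 : (0 : ℝ) ≤ (n A₂ : ℝ) * m A₂ := by positivity
  unfold leadEigen
  by_cases h0 : gc0 ∈ S <;> by_cases h1 : gcd ∈ S <;> by_cases h2 : gxi ∈ S <;>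
    simp only [h0, h1, h2, if_true, if_false] <;>
    first
    | positivity
    | exact absurd ⟨h0, h1, h2⟩ h

theorem dY_sq_mul_mulY_sq (A : Fin (d + 1)) : dY C A * dY C A * (mulY C A * mulY C A)
    = diag fun _ m _ => ((m A : ℝ) + 1) * ((m A : ℝ) + 1) + ((m A : ℝ) + 1) := by
  have : dY C A * dY C A * (mulY C A * mulY C A)
      = dY C A * mulY C A * (dY C A * mulY C A) + dY C A * mulY C A := by
    rw [mul_assoc, ← mul_assoc (dY C A) (mulY C A) (mulY C A)]
    conv_lhs => rw [dY_mulY_self, add_mul, one_mul, mul_add]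
    simp only [mul_assoc]
  rw [this, dY_mul_mulY, diag_mul, diag_add]
  rfl

theorem mulY_sq_mul_dY_sq (A : Fin (d + 1)) : mulY C A * mulY C A * (dY C A * dY C A)
    = diag fun _ m _ => (m A : ℝ) * m A - m A := by
  have : mulY C A * mulY C A * (dY C A * dY C A)
      = mulY C A * dY C A * (mulY C A * dY C A) - mulY C A * dY C A := by
    have h : mulY C A * dY C A = (dY C A * mulY C A - 1 : Op C d) := by
      rw [dY_mulY_self, add_sub_cancel_right]
    rw [mul_assoc, ← mul_assoc (mulY C A) (dY C A) (dY C A)]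
    conv_lhs => rw [h, sub_mul, one_mul, mul_sub]
    simp only [mul_assoc]
  rw [this, mulY_mul_dY, diag_mul, diag_sub]
  rfl

theorem dA_sq_mul_mulA_sq (A : Fin (d + 1)) : dA C A * dA C A * (mulA C A * mulA C A)
    = diag fun _ _ n => ((n A : ℝ) + 1) * ((n A : ℝ) + 1) + ((n A : ℝ) + 1) := by
  have : dA C A * dA C A * (mulA C A * mulA C A)
      = dA C A * mulA C A * (dA C A * mulA C A) + dA C A * mulA C A := by
    rw [mul_assoc, ← mul_assoc (dA C A) (mulA C A) (mulA C A)]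
    conv_lhs => rw [dA_mulA_self, add_mul, one_mul, mul_add]
    simp only [mul_assoc]
  rw [this, dA_mul_mulA, diag_mul, diag_add]
  rfl

theorem mulA_sq_mul_dA_sq (A : Fin (d + 1)) : mulA C A * mulA C A * (dA C A * dA C A)
    = diag fun _ _ n => (n A : ℝ) * n A - n A := by
  have : mulA C A * mulA C A * (dA C A * dA C A)
      = mulA C A * dA C A * (mulA C A * dA C A) - mulA C A * dA C A := by
    have h : mulA C A * dA C A = (dA C A * mulA C A - 1 : Op C d) := by
      rw [dA_mulA_self, add_sub_cancel_right]
    rw [mul_assoc, ← mul_assoc (mulA C A) (dA C A) (dA C A)]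
    conv_lhs => rw [h, sub_mul, one_mul, mul_sub]
    simp only [mul_assoc]
  rw [this, mulA_mul_dA, diag_mul, diag_sub]
  rfl

theorem dA_dY_mul_mulA_mulY (A : Fin (d + 1)) : dA C A * dY C A * (mulA C A * mulY C A)
    = diag fun _ m n => ((n A : ℝ) + 1) * ((m A : ℝ) + 1) := by
  rw [(commute_mulA_dY C A A).symm.mul_mul_mul_comm, dA_mul_mulA, dY_mul_mulY, diag_mul]
  rfl

theorem mulA_mulY_mul_dA_dY (A : Fin (d + 1)) : mulA C A * mulY C A * (dA C A * dY C A)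
    = diag fun _ m n => (n A : ℝ) * m A := by
  rw [(commute_dA_mulY C A A).symm.mul_mul_mul_comm, mulA_mul_dA, mulY_mul_dY, diag_mul]
  rfl

theorem smul_eta_mul_smul_eta (A : Fin (d + 1)) (O P : Op C d) :
    (eta A • O) * (eta A • P) = O * P := by
  rw [smul_mul_assoc, mul_smul_comm, smul_smul, eta_mul_self, one_smul]

/-- The two orders of a ghost and its derivative are the complementary projectors onto monomials
with and without that ghost, so each case sees only one order of O and P. -/
theorem ghost_mul_add_mul (i : Ghost d) {O P : Op C d} (hO : IsCoeffOp O) (hP : IsCoeffOp P)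
    {f g : Finset (Ghost d) → (Fin (d + 1) →₀ ℕ) → (Fin (d + 1) →₀ ℕ) → ℝ}
    (hf : O * P = diag f) (hg : P * O = diag g) :
    ghostMul C i * O * (ghostDer C i * P) + ghostDer C i * P * (ghostMul C i * O)
      = diag fun S m n => if i ∈ S then f S m n else g S m n := by
  rw [mul_add_mul_eq (hP.commute_ghostMul i) (hO.commute_ghostDer i), hf, hg,
    ghostMul_mul_ghostDer_self, ghostDer_mul_ghostMul_self, diag_mul, diag_mul, diag_add]
  congr 1
  funext S m n
  by_cases h : i ∈ S <;> simp [h]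

variable {A₀ A₁ A₂}

/-- Cross terms vanish because the three leading operators act on disjoint variables: Y along A₁,
the pair along A₂, and a† along A₀. The indices A₀ and A₁ may coincide here, since one refers to a†
and the other to Y. -/
theorem leadTrace_leadHomotopy (h02 : A₀ ≠ A₂) (h12 : A₁ ≠ A₂) :
    leadTrace C A₀ A₁ A₂ * leadHomotopy C A₀ A₁ A₂ + leadHomotopy C A₀ A₁ A₂ * leadTrace C A₀ A₁ A₂
      = diag (leadEigen A₀ A₁ A₂) := by
  have cY := isCoeffOp_dY (C := C) (d := d)
  have cA := isCoeffOp_dA (C := C) (d := d)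
  have mY := isCoeffOp_mulY (C := C) (d := d)
  have mA := isCoeffOp_mulA (C := C) (d := d)
  have cP1 : IsCoeffOp (eta A₁ • (dY C A₁ * dY C A₁)) := .smul _ ((cY _).mul (cY _))
  have cP2 : IsCoeffOp (eta A₂ • (dA C A₂ * dY C A₂)) := .smul _ ((cA _).mul (cY _))
  have cP0 : IsCoeffOp (eta A₀ • (dA C A₀ * dA C A₀)) := .smul _ ((cA _).mul (cA _))
  have cM1 : IsCoeffOp (eta A₁ • (mulY C A₁ * mulY C A₁)) := .smul _ ((mY _).mul (mY _))
  have cM2 : IsCoeffOp (eta A₂ • (mulA C A₂ * mulY C A₂)) := .smul _ ((mA _).mul (mY _))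
  have cM0 : IsCoeffOp (eta A₀ • (mulA C A₀ * mulA C A₀)) := .smul _ ((mA _).mul (mA _))
  have e1 := ghost_mul_add_mul C gc0 cP1 cM1
    ((smul_eta_mul_smul_eta C _ _ _).trans (dY_sq_mul_mulY_sq C A₁))
    ((smul_eta_mul_smul_eta C _ _ _).trans (mulY_sq_mul_dY_sq C A₁))
  have e2 := ghost_mul_add_mul C gcd cP2 cM2
    ((smul_eta_mul_smul_eta C _ _ _).trans (dA_dY_mul_mulA_mulY C A₂))
    ((smul_eta_mul_smul_eta C _ _ _).trans (mulA_mulY_mul_dA_dY C A₂))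
  have e0 := ghost_mul_add_mul C gxi cP0 cM0
    ((smul_eta_mul_smul_eta C _ _ _).trans (dA_sq_mul_mulA_sq C A₀))
    ((smul_eta_mul_smul_eta C _ _ _).trans (mulA_sq_mul_dA_sq C A₀))
  have yy := fun {A B : Fin (d + 1)} (h : A ≠ B) => commute_dY_mulY C h
  have aa := fun {A B : Fin (d + 1)} (h : A ≠ B) => commute_dA_mulA C h
  have ay := fun A B : Fin (d + 1) => commute_dA_mulY C A B
  have ya := fun A B : Fin (d + 1) => (commute_mulA_dY C B A).symm
  have smul2 : ∀ {O P : Op C d} (r s : ℝ), Commute O P → Commute (r • O) (s • P) :=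
    fun r s h => (h.smul_left r).smul_right s
  have x12 := mul_anticomm (ghostDer_ghostMul C gc0_ne_gcd.symm) (smul2 (eta A₁) (eta A₂)
    (((ya A₁ A₂).mul_right (yy h12)).mul_left ((ya A₁ A₂).mul_right (yy h12))))
    (cM2.commute_ghostMul gc0) (cP1.commute_ghostDer gcd)
  have x10 := mul_anticomm (ghostDer_ghostMul C gc0_ne_gxi.symm) (smul2 (eta A₁) (eta A₀)
    (((ya A₁ A₀).mul_right (ya A₁ A₀)).mul_left ((ya A₁ A₀).mul_right (ya A₁ A₀))))
    (cM0.commute_ghostMul gc0) (cP1.commute_ghostDer gxi)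
  have x21 := mul_anticomm (ghostDer_ghostMul C gc0_ne_gcd) (smul2 (eta A₂) (eta A₁)
    (((ay A₂ A₁).mul_right (ay A₂ A₁)).mul_left ((yy h12.symm).mul_right (yy h12.symm))))
    (cM1.commute_ghostMul gcd) (cP2.commute_ghostDer gc0)
  have x20 := mul_anticomm (ghostDer_ghostMul C gcd_ne_gxi.symm) (smul2 (eta A₂) (eta A₀)
    (((aa h02.symm).mul_right (aa h02.symm)).mul_left ((ya A₂ A₀).mul_right (ya A₂ A₀))))
    (cM0.commute_ghostMul gcd) (cP2.commute_ghostDer gxi)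
  have x01 := mul_anticomm (ghostDer_ghostMul C gc0_ne_gxi) (smul2 (eta A₀) (eta A₁)
    (((ay A₀ A₁).mul_right (ay A₀ A₁)).mul_left ((ay A₀ A₁).mul_right (ay A₀ A₁))))
    (cM1.commute_ghostMul gxi) (cP0.commute_ghostDer gc0)
  have x02 := mul_anticomm (ghostDer_ghostMul C gcd_ne_gxi) (smul2 (eta A₀) (eta A₂)
    (((aa h02).mul_right (ay A₀ A₂)).mul_left ((aa h02).mul_right (ay A₀ A₂))))
    (cM2.commute_ghostMul gxi) (cP0.commute_ghostDer gcd)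
  unfold leadTrace leadHomotopy
  rw [anticomm_sum_three x12 x10 x21 x20 x01 x02, e1, e2, e0, diag_add, diag_add]
  rfl

theorem shift_leadHomotopy {w : Weight d} {k : ℤ} (h1 : k ≤ -w.g gc0 + (w.y A₁ + w.y A₁))
    (h2 : k ≤ -w.g gcd + (w.a A₂ + w.y A₂)) (h0 : k ≤ -w.g gxi + (w.a A₀ + w.a A₀)) :
    Shift w k (leadHomotopy C A₀ A₁ A₂) :=
  .add (.add (((shift_ghostDer gc0).mul (.smul _ ((shift_mulY A₁).mul (shift_mulY A₁)))).mono h1)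
    (((shift_ghostDer gcd).mul (.smul _ ((shift_mulA A₂).mul (shift_mulY A₂)))).mono h2))
    (((shift_ghostDer gxi).mul (.smul _ ((shift_mulA A₀).mul (shift_mulA A₀)))).mono h0)

theorem shift_leadTrace {w : Weight d} {k : ℤ} (h1 : k ≤ w.g gc0 + (-w.y A₁ + -w.y A₁))
    (h2 : k ≤ w.g gcd + (-w.a A₂ + -w.y A₂)) (h0 : k ≤ w.g gxi + (-w.a A₀ + -w.a A₀)) :
    Shift w k (leadTrace C A₀ A₁ A₂) :=
  .add (.add (((shift_ghostMul gc0).mul (.smul _ ((shift_dY A₁).mul (shift_dY A₁)))).mono h1)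
    (((shift_ghostMul gcd).mul (.smul _ ((shift_dA A₂).mul (shift_dY A₂)))).mono h2))
    (((shift_ghostMul gxi).mul (.smul _ ((shift_dA A₀).mul (shift_dA A₀)))).mono h0)

variable {C}

theorem shift_sum_dY_dY {w : Weight d} {k : ℤ} {s : Finset (Fin (d + 1))}
    (h : ∀ A ∈ s, k ≤ -w.y A + -w.y A) :
    Shift w k (∑ A ∈ s, eta A • (dY C A * dY C A)) :=
  .sum fun A hA => .smul _ (((shift_dY A).mul (shift_dY A)).mono (h A hA))

theorem shift_sum_dA_dY {w : Weight d} {k : ℤ} {s : Finset (Fin (d + 1))}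
    (h : ∀ A ∈ s, k ≤ -w.a A + -w.y A) :
    Shift w k (∑ A ∈ s, eta A • (dA C A * dY C A)) :=
  .sum fun A hA => .smul _ (((shift_dA A).mul (shift_dY A)).mono (h A hA))

theorem shift_sum_dA_dA {w : Weight d} {k : ℤ} {s : Finset (Fin (d + 1))}
    (h : ∀ A ∈ s, k ≤ -w.a A + -w.a A) :
    Shift w k (∑ A ∈ s, eta A • (dA C A * dA C A)) :=
  .sum fun A hA => .smul _ (((shift_dA A).mul (shift_dA A)).mono (h A hA))

theorem shift_omegaTrace {w : Weight d} {k p q r : ℤ} (h1 : ∀ A, p ≤ -w.y A + -w.y A)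
    (h2 : ∀ A, q ≤ -w.a A + -w.y A) (h3 : ∀ A, r ≤ -w.a A + -w.a A) (hp : k ≤ w.g gc0 + p)
    (hq : k ≤ w.g gcd + q) (hr : k ≤ w.g gxi + r) : Shift w k (omegaTrace C d) :=
  .add (.add (((shift_ghostMul gc0).mul (shift_sum_dY_dY fun A _ => h1 A)).mono hp)
    (((shift_ghostMul gcd).mul (shift_sum_dA_dY fun A _ => h2 A)).mono hq))
    (((shift_ghostMul gxi).mul (shift_sum_dA_dA fun A _ => h3 A)).mono hr)

/-- With the leading index removed, the derivatives shift the weight by at least −1, 1, −1, and the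
ghosts c₀, c†, ξ add 2, 0, 2, leaving at least 1 in each case. -/
theorem shift_omegaTrace_sub_leadTrace :
    Shift (leadWeight A₀ A₁ A₂) 1 (omegaTrace C d - leadTrace C A₀ A₁ A₂) := by
  have e : omegaTrace C d - leadTrace C A₀ A₁ A₂
      = ghostMul C gc0 * (∑ A ∈ Finset.univ.erase A₁, eta A • (dY C A * dY C A))
        + ghostMul C gcd * (∑ A ∈ Finset.univ.erase A₂, eta A • (dA C A * dY C A))
        + ghostMul C gxi * (∑ A ∈ Finset.univ.erase A₀, eta A • (dA C A * dA C A)) := by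
    unfold omegaTrace leadTrace box opS opT
    rw [← Finset.add_sum_erase Finset.univ (fun A => eta A • (dY C A * dY C A)) (Finset.mem_univ A₁),
      ← Finset.add_sum_erase Finset.univ (fun A => eta A • (dA C A * dY C A)) (Finset.mem_univ A₂),
      ← Finset.add_sum_erase Finset.univ (fun A => eta A • (dA C A * dA C A)) (Finset.mem_univ A₀)]
    simp only [mul_add]
    abel
  rw [e]
  refine .add (.add ?_ ?_) ?_
  · refine ((shift_ghostMul gc0).mul (shift_sum_dY_dY (k := -1) fun A hA => ?_)).mono ?_
    · have hA := (Finset.mem_erase.1 hA).1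
      simp only [leadWeight, hA, if_false]
      split_ifs <;> simp
    · simp [leadWeight, gc0_ne_gxi]
  · refine ((shift_ghostMul gcd).mul (shift_sum_dA_dY (k := 1) fun A hA => ?_)).mono ?_
    · have hA := (Finset.mem_erase.1 hA).1
      simp only [leadWeight, hA, if_false]
      split_ifs <;> simp
    · simp [leadWeight, gc0_ne_gcd.symm, gcd_ne_gxi]
  · refine ((shift_ghostMul gxi).mul (shift_sum_dA_dA (k := -1) fun A hA => ?_)).mono ?_
    · have hA := (Finset.mem_erase.1 hA).1
      simp only [leadWeight, hA, if_false]
      split_ifs <;> simp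
    · simp [leadWeight, gc0_ne_gxi.symm]

theorem tameOp_leadHomotopy : TameOp 0 (leadHomotopy C A₀ A₁ A₂) :=
  .add (.add ((tameOp_ghostDer gc0).mul (.smul _ ((tameOp_mulY A₁).mul (tameOp_mulY A₁))))
    ((tameOp_ghostDer gcd).mul (.smul _ ((tameOp_mulA A₂).mul (tameOp_mulY A₂)))))
    ((tameOp_ghostDer gxi).mul (.smul _ ((tameOp_mulA A₀).mul (tameOp_mulA A₀))))

theorem shift_anticomm {w : Weight d} {O P : Op C d} {k l : ℤ} (hO : Shift w k O)
    (hP : Shift w l P) : Shift w (k + l) (O * P + P * O) :=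
  (hO.mul hP).add ((hP.mul hO).mono (by lia))

/-- In dimension at least three, `Ω_trace` has a contracting homotopy away from degree zero. -/
theorem exists_homotopy (C : Type*) [CommRing C] [Algebra ℝ C] (hd : 3 ≤ d + 1) :
    ∃ s : Op C d, TameOp 0 s ∧ s * degZero C d = 0 ∧
      Shift (ghostWeight tdeg) 1 s ∧ Shift (ghostWeight (-tdeg)) (-1) s ∧
      Shift (ghostWeight gh) (-1) s ∧ Shift (ghostWeight (-gh)) 1 s ∧
      (omegaTrace C d * s + s * omegaTrace C d) * (1 - degZero C d) = 1 - degZero C d := by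
  classical
  -- This is where dimension at least three enters.
  obtain ⟨A₀, A₁, A₂, h01, h02, h12⟩ : ∃ A₀ A₁ A₂ : Fin (d + 1), A₀ ≠ A₁ ∧ A₀ ≠ A₂ ∧ A₁ ≠ A₂ :=
    ⟨⟨0, by lia⟩, ⟨1, by lia⟩, ⟨2, by lia⟩, by simp, by simp, by simp⟩
  set D := omegaTrace C d with hDdef
  set e := degZero C d with he
  set s₁ := leadHomotopy C A₀ A₁ A₂ with hs₁
  set D₁ := D - leadTrace C A₀ A₁ A₂ with hD₁
  -- The summand e replaces the anticommutator by the identity in degree zero, where its leading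
  -- part may have zero eigenvalues.
  set L := (D * s₁ + s₁ * D) * (1 - e) + e with hL
  -- degrees
  have dec : ∀ {w : Weight d} {k : ℤ}, Shift w k D → Shift w (-k) s₁ → Shift w 0 L :=
    fun {w k} h h' => (((shift_anticomm h h').mul (shift_one.sub shift_degZero)).mono
      (by lia)).add shift_degZero
  have sY : Shift (yDeg d) 0 s₁ := shift_leadHomotopy C
    (by simp [yDeg, gc0_ne_gcd]) (by simp [yDeg, gc0_ne_gcd.symm])
    (by simp [yDeg, gc0_ne_gxi.symm, gcd_ne_gxi.symm])
  have sY' : Shift (-yDeg d) 0 s₁ := shift_leadHomotopy C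
    (by simp [neg_def, yDeg, gc0_ne_gcd]) (by simp [neg_def, yDeg, gc0_ne_gcd.symm])
    (by simp [neg_def, yDeg, gc0_ne_gxi.symm, gcd_ne_gxi.symm])
  have sA' : Shift (-aDeg d) 0 s₁ := shift_leadHomotopy C
    (by simp [neg_def, aDeg, gc0_ne_gcd, gc0_ne_gxi])
    (by simp [neg_def, aDeg, gcd_ne_gxi]) (by simp [neg_def, aDeg, gcd_ne_gxi.symm])
  have dY : Shift (yDeg d) 0 D := shift_omegaTrace (p := -2) (q := -1) (r := 0)
    (by simp [yDeg]) (by simp [yDeg]) (by simp [yDeg])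
    (by simp [yDeg, gc0_ne_gcd]) (by simp [yDeg, gc0_ne_gcd.symm])
    (by simp [yDeg, gc0_ne_gxi.symm, gcd_ne_gxi.symm])
  have dY' : Shift (-yDeg d) 0 D := shift_omegaTrace (p := 2) (q := 1) (r := 0)
    (by simp [neg_def, yDeg]) (by simp [neg_def, yDeg]) (by simp [neg_def, yDeg])
    (by simp [neg_def, yDeg, gc0_ne_gcd]) (by simp [neg_def, yDeg, gc0_ne_gcd.symm])
    (by simp [neg_def, yDeg, gc0_ne_gxi.symm, gcd_ne_gxi.symm])
  have dA' : Shift (-aDeg d) 0 D := shift_omegaTrace (p := 0) (q := 1) (r := 2)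
    (by simp [neg_def, aDeg]) (by simp [neg_def, aDeg]) (by simp [neg_def, aDeg])
    (by simp [neg_def, aDeg, gc0_ne_gcd, gc0_ne_gxi])
    (by simp [neg_def, aDeg, gcd_ne_gxi]) (by simp [neg_def, aDeg, gcd_ne_gxi.symm])
  have st : Shift (ghostWeight tdeg) 1 s₁ := shift_leadHomotopy C
    (by simp [ghostWeight, tdeg]) (by simp [ghostWeight, tdeg]) (by simp [ghostWeight, tdeg])
  have st' : Shift (ghostWeight (-tdeg)) (-1) s₁ := shift_leadHomotopy C
    (by simp [ghostWeight, tdeg]) (by simp [ghostWeight, tdeg]) (by simp [ghostWeight, tdeg])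
  have sg : Shift (ghostWeight gh) (-1) s₁ := shift_leadHomotopy C
    (by simp [ghostWeight, gh, gc0_ne_gbd]) (by simp [ghostWeight, gh, gcd_ne_gbd])
    (by simp [ghostWeight, gh, gbd_ne_gxi.symm])
  have sg' : Shift (ghostWeight (-gh)) 1 s₁ := shift_leadHomotopy C
    (by simp [ghostWeight, gh, gc0_ne_gbd]) (by simp [ghostWeight, gh, gcd_ne_gbd])
    (by simp [ghostWeight, gh, gbd_ne_gxi.symm])
  have dg : Shift (ghostWeight gh) 1 D := shift_omegaTrace_ghostWeight
    (by simp [gh, gc0_ne_gbd]) (by simp [gh, gcd_ne_gbd]) (by simp [gh, gbd_ne_gxi.symm])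
  have dg' : Shift (ghostWeight (-gh)) (-1) D := shift_omegaTrace_ghostWeight
    (by simp [gh, gc0_ne_gbd]) (by simp [gh, gcd_ne_gbd]) (by simp [gh, gbd_ne_gxi.symm])
  have LY : Shift (yDeg d) 0 L := dec dY (by simpa using sY)
  have LY' : Shift (-yDeg d) 0 L := dec dY' (by simpa using sY')
  have Lt : Shift (ghostWeight tdeg) 0 L := dec shift_omegaTrace_tdeg (by simpa using st)
  have Lt' : Shift (ghostWeight (-tdeg)) 0 L := dec shift_omegaTrace_neg_tdeg (by simpa using st')
  have Lg : Shift (ghostWeight gh) 0 L := dec dg sg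
  have Lg' : Shift (ghostWeight (-gh)) 0 L := dec dg' (by simpa using sg')
  -- invertibility
  set ε : Finset (Ghost d) → (Fin (d + 1) →₀ ℕ) → (Fin (d + 1) →₀ ℕ) → ℝ :=
    fun S m n => if (ghostWeight tdeg).val S m n = 0 then 1 else 0 with hε
  have heε : e = diag ε := op_ext fun φ S m n => by
    by_cases h0 : (ghostWeight tdeg).val S m n = 0 <;>
      simp [he, degZero, cf_trunc, cf_diag, hε, h0]
  set lam : Finset (Ghost d) → (Fin (d + 1) →₀ ℕ) → (Fin (d + 1) →₀ ℕ) → ℝ :=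
    leadEigen A₀ A₁ A₂ * (1 - ε) + ε with hlam
  have hlam0 : ∀ S m n, lam S m n ≠ 0 := by
    intro S m n
    simp only [hlam, hε, Pi.add_apply, Pi.mul_apply, Pi.sub_apply, Pi.one_apply]
    split_ifs with h0
    · simp
    · have := leadEigen_pos A₀ A₁ A₂ m n (mt val_tdeg_eq_zero_iff.2 h0)
      simpa using this.ne'
  have hΛ : (diag lam : Op C d) = diag (leadEigen A₀ A₁ A₂) * (1 - e) + e := by
    rw [heε, ← diag_one, diag_sub, diag_mul, diag_add]
  have hΛ1 : (diag lam * diag (fun S m n => (lam S m n)⁻¹) : Op C d) = 1 := by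
    rw [diag_mul, ← diag_one]
    congr 1
    funext S m n
    simp [hlam0]
  -- X is the contribution of the nonleading terms divided by the eigenvalues, so that L is the
  -- diagonal operator times 1 − X.
  set X : Op C d := -(diag (fun S m n => (lam S m n)⁻¹) * ((D₁ * s₁ + s₁ * D₁) * (1 - e))) with hX
  have hLX : L = diag lam * (1 - X) := by
    have h1 : D = leadTrace C A₀ A₁ A₂ + D₁ := by rw [hD₁, add_sub_cancel]
    have h2 : D * s₁ + s₁ * D = diag (leadEigen A₀ A₁ A₂) + (D₁ * s₁ + s₁ * D₁) := by
      rw [← leadTrace_leadHomotopy C h02 h12, h1, add_mul, mul_add]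
      abel
    rw [hX, sub_neg_eq_add, mul_add, mul_one, ← mul_assoc, hΛ1, one_mul, hΛ, hL, h2, add_mul]
    abel
  have key : ∀ {w : Weight d} {k : ℤ}, Shift w k D₁ → Shift w 0 s₁ → Shift w k X :=
    fun {w k} h h' => (((shift_diag _).mul ((shift_anticomm h h').mul
      (shift_one.sub shift_degZero))).mono (by lia)).neg
  have hD₁' : ∀ {w : Weight d}, Shift w 0 s₁ → Shift w 0 D → Shift w 0 (leadTrace C A₀ A₁ A₂) →
      Shift w 0 X := fun h h' h'' => key (h'.sub h'') h
  have hXw : Shift (leadWeight A₀ A₁ A₂) 1 X :=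
    key shift_omegaTrace_sub_leadTrace (shift_leadHomotopy C
      (by simp [leadWeight, gc0_ne_gxi, h01.symm])
      (by simp [leadWeight, gc0_ne_gcd.symm, gcd_ne_gxi, h02.symm, h12.symm])
      (by simp [leadWeight, gc0_ne_gxi.symm]))
  have hXY : Shift (yDeg d) 0 X := hD₁' sY dY (shift_leadTrace C
    (by simp [yDeg, gc0_ne_gcd]) (by simp [yDeg, gc0_ne_gcd.symm])
    (by simp [yDeg, gc0_ne_gxi.symm, gcd_ne_gxi.symm]))
  have hXY' : Shift (-yDeg d) 0 X := hD₁' sY' dY' (shift_leadTrace C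
    (by simp [neg_def, yDeg, gc0_ne_gcd]) (by simp [neg_def, yDeg, gc0_ne_gcd.symm])
    (by simp [neg_def, yDeg, gc0_ne_gxi.symm, gcd_ne_gxi.symm]))
  have hXA' : Shift (-aDeg d) 0 X := hD₁' sA' dA' (shift_leadTrace C
    (by simp [neg_def, aDeg, gc0_ne_gcd, gc0_ne_gxi])
    (by simp [neg_def, aDeg, gcd_ne_gxi]) (by simp [neg_def, aDeg, gcd_ne_gxi.symm]))
  have hunit : IsUnit L := by
    rw [hLX]
    refine IsUnit.mul ?_ (isUnit_one_sub (leadWeight_le A₀ A₁ A₂) 10 (by norm_num)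
      (le_leadWeight A₀ A₁ A₂) hXw hXY hXY' hXA')
    refine ⟨⟨diag lam, diag fun S m n => (lam S m n)⁻¹, hΛ1, ?_⟩, rfl⟩
    rw [diag_mul, ← hΛ1, diag_mul, mul_comm]
  obtain ⟨Li, h1, h2⟩ : ∃ Li, L * Li = 1 ∧ Li * L = 1 :=
    ⟨_, hunit.mul_val_inv, hunit.val_inv_mul⟩
  have hLe : Commute L e := commute_trunc_eq Lt Lt' 0
  have heD : e * D = 0 := degZero_mul_eq_zero shift_omegaTrace_neg_tdeg
  have fin : ∀ {w : Weight d} {k : ℤ}, Shift w k s₁ → Shift w 0 Li →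
      Shift w k (s₁ * Li * (1 - e)) :=
    fun h h' => ((h.mul h').mul (shift_one.sub shift_degZero)).mono (by lia)
  refine ⟨s₁ * Li * (1 - e), ?_, ?_, ?_, ?_, ?_, ?_, homotopy_of_unit (omegaTrace_mul_self C d)
    degZero_mul_self heD hL hLe h1 h2⟩
  · have hLtame : TameOp 0 L :=
      .add (.mul (.add (tameOp_omegaTrace.mul tameOp_leadHomotopy)
        (tameOp_leadHomotopy.mul tameOp_omegaTrace)) (tameOp_one.sub tameOp_degZero)) tameOp_degZero
    -- The inverse inherits linearity over functions and preservation of `yDeg`, so the corrected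
    -- homotopy is still a continuous bundle map.
    have hLi : TameOp 0 Li := ⟨hasOrderLE_zero_of_commute fun f =>
      commute_of_inverse (hLtame.order.commute_mulC f) h1 h2, 0,
      shift_of_mul_eq_one LY' LY h2 h1⟩
    exact .mul (.mul tameOp_leadHomotopy hLi) (tameOp_one.sub tameOp_degZero)
  · rw [mul_assoc, sub_mul, one_mul, degZero_mul_self, sub_self, mul_zero]
  · exact fin st (shift_of_mul_eq_one (by rwa [neg_ghostWeight]) Lt h2 h1)
  · exact fin st' (shift_of_mul_eq_one (by rwa [neg_ghostWeight, neg_neg]) Lt' h2 h1)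
  · exact fin sg (shift_of_mul_eq_one (by rwa [neg_ghostWeight]) Lg h2 h1)
  · exact fin sg' (shift_of_mul_eq_one (by rwa [neg_ghostWeight, neg_neg]) Lg' h2 h1)

end Homotopy

/-! ### Projectors and block inverse obtained from a homotopy -/

section HomotopyAlgebra

/-- `s` is a contracting homotopy for `D` away from the image of the projector `e`, which plays the
role of degree zero, the highest degree. -/
structure IsHomotopy {R : Type*} [Ring R] (D s e : R) : Prop where
  sq : D * D = 0
  idem : e * e = e
  left : e * D = 0
  right : s * e = 0
  commDs : Commute (D * s) e
  commsD : Commute (s * D) e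
  contract : (D * s + s * D) * (1 - e) = 1 - e

namespace IsHomotopy

variable {R : Type*} [Ring R] {D s e : R} (h : IsHomotopy D s e)
include h

/-- Multiply the homotopy identity by D on the right: e kills the image of D, and D² = 0 removes the
second term. -/
theorem DsD : D * (s * D) = D := by
  have h1 : (1 - e) * D = D := by rw [sub_mul, h.left, one_mul, sub_zero]
  have h2 := congrArg (· * D) h.contract
  simp only [mul_assoc, h1, add_mul] at h2
  rwa [h.sq, mul_zero, add_zero] at h2

theorem DsD_mul (x : R) : D * (s * (D * x)) = D * x := by
  rw [← mul_assoc s, ← mul_assoc D, h.DsD]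

theorem sD_idem : s * D * (s * D) = s * D := by rw [mul_assoc, h.DsD]

theorem Ds_idem : D * s * (D * s) = D * s := by rw [mul_assoc, h.DsD_mul]

theorem sD_Ds : s * D * (D * s) = 0 := by
  rw [mul_assoc, ← mul_assoc D, h.sq, zero_mul, mul_zero]

/-- No assumption s² = 0 is needed. The homotopy identity gives sD = 1 − e − Ds + sDe, and Ds kills
e on the right, also after sD is moved past e. -/
theorem Ds_sD : D * s * (s * D) = 0 := by
  have h0 : D * s * e = 0 := by rw [mul_assoc, h.right, mul_zero]
  have h1 : s * D = 1 - e - D * s + s * D * e := by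
    have := h.contract
    rw [add_mul, mul_sub (D * s), h0, mul_sub (s * D), mul_one, mul_one, sub_zero] at this
    rw [← this]; abel
  rw [h1, mul_add, mul_sub, mul_sub, h0, h.Ds_idem, h.commsD.eq, ← mul_assoc, h0]
  simp

theorem proj_idem : (1 - s * D - D * s) * (1 - s * D - D * s) = 1 - s * D - D * s := by
  simp only [mul_sub, sub_mul, mul_one, one_mul, h.sD_idem, h.Ds_idem, h.sD_Ds, h.Ds_sD]
  abel

theorem proj_Ds : (1 - s * D - D * s) * (D * s) = 0 := by
  simp only [sub_mul, one_mul, h.Ds_idem, h.sD_Ds]; abel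

theorem Ds_proj : D * s * (1 - s * D - D * s) = 0 := by
  simp only [mul_sub, mul_one, h.Ds_idem, h.Ds_sD]; abel

theorem proj_sD : (1 - s * D - D * s) * (s * D) = 0 := by
  simp only [sub_mul, one_mul, h.sD_idem, h.Ds_sD]; abel

theorem sD_proj : s * D * (1 - s * D - D * s) = 0 := by
  simp only [mul_sub, mul_one, h.sD_idem, h.sD_Ds]; abel

theorem D_proj : D * (1 - s * D - D * s) = 0 := by
  simp only [mul_sub, mul_one, h.DsD, ← mul_assoc D D, h.sq, zero_mul]; abel

theorem e_proj : e * (1 - s * D - D * s) = 1 - s * D - D * s := by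
  have h1 : (1 - s * D - D * s) * (1 - e) = 0 := by
    have := h.contract
    rw [sub_sub, sub_mul, add_comm (s * D), this, one_mul, sub_self]
  have h2 : Commute (1 - s * D - D * s) e :=
    ((Commute.one_left e).sub_left h.commsD).sub_left h.commDs
  rw [← h2.eq]
  rw [mul_sub, mul_one, sub_eq_zero] at h1
  exact h1.symm

/-- The perturbed block `P_G Ω P_F` is inverted by a terminating geometric series. -/
theorem block_inverse {Ω Z Z' K : R} (hZ : Z = s * D * s * (Ω - D) * (s * D))
    (hZ' : Z' = D * s * (Ω - D) * (s * D * s)) (hZ4 : Z * Z * Z * Z = 0)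
    (hZ4' : Z' * Z' * Z' * Z' = 0) (hK : K = (1 - Z + Z * Z - Z * Z * Z) * (s * D * s)) :
    s * D * K * (D * s) = K ∧ K * (D * s * Ω * (s * D)) = s * D ∧
      D * s * Ω * (s * D) * K = D * s := by
  obtain ⟨W, rfl⟩ : ∃ W, Ω = D + W := ⟨Ω - D, (add_sub_cancel _ _).symm⟩
  rw [add_sub_cancel_left] at hZ hZ'
  have r1 := h.DsD
  have r2 := h.DsD_mul
  -- The GF block is D plus the perturbation, and sDs inverts the unperturbed part D between F and
  -- G.
  have hX : D * s * (D + W) * (s * D) = D + D * s * W * (s * D) := by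
    simp only [mul_add, add_mul, mul_assoc, r1, r2]
  set X := D * s * (D + W) * (s * D)
  have fZ : s * D * Z = Z := by rw [hZ]; simp only [mul_assoc, r1, r2]
  have Zf : Z * (s * D) = Z := by rw [hZ]; simp only [mul_assoc, r1, r2]
  have Z'g : Z' * (D * s) = Z' := by rw [hZ']; simp only [mul_assoc, r1, r2]
  have tX : s * D * s * X = s * D + Z := by
    rw [hX, hZ]; simp only [mul_add, mul_assoc, r1, r2]
  have Xt : X * (s * D * s) = D * s + Z' := by
    rw [hX, hZ']; simp only [add_mul, mul_assoc, r1, r2]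
  -- This intertwining turns the series in Z on F into the series in Z' on G, so the same K inverts
  -- the block from both sides.
  have XZ : X * Z = Z' * X := by
    rw [hX, hZ, hZ']; simp only [add_mul, mul_add, mul_assoc, r1, r2]
  have ft : s * D * (s * D * s) = s * D * s := by simp only [mul_assoc, r1, r2]
  have tg : s * D * s * (D * s) = s * D * s := by simp only [mul_assoc, r1, r2]
  refine ⟨?_, ?_, ?_⟩
  · have e : s * D * (1 - Z + Z * Z - Z * Z * Z) = s * D - Z + Z * Z - Z * Z * Z := by
      simp only [mul_sub, mul_add, mul_one, ← mul_assoc, fZ]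
    rw [hK, ← mul_assoc (s * D), e, mul_assoc, tg]
    simp only [sub_mul, add_mul, one_mul, ft]
  · rw [hK, mul_assoc, tX]
    have : (1 - Z + Z * Z - Z * Z * Z) * (s * D + Z) = s * D + (Z - Z * (s * D))
        + (Z * (Z * (s * D)) - Z * Z) + (Z * Z * Z - Z * Z * (Z * (s * D))) - Z * Z * Z * Z := by
      noncomm_ring
    rw [this, Zf, hZ4]; simp
  · have e : X * (1 - Z + Z * Z - Z * Z * Z) = (1 - Z' + Z' * Z' - Z' * Z' * Z') * X := by
      have e2 : X * (Z * Z) = Z' * Z' * X := by rw [← mul_assoc, XZ, mul_assoc, XZ, mul_assoc]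
      have e3 : X * (Z * Z * Z) = Z' * Z' * Z' * X := by
        rw [← mul_assoc, e2, mul_assoc, XZ, mul_assoc, mul_assoc, mul_assoc]
      rw [mul_sub, mul_add, mul_sub, sub_mul, add_mul, sub_mul, XZ, e2, e3, mul_one, one_mul]
    rw [hK, ← mul_assoc, e, mul_assoc, Xt]
    have : (1 - Z' + Z' * Z' - Z' * Z' * Z') * (D * s + Z') = D * s + (Z' - Z' * (D * s))
        + (Z' * (Z' * (D * s)) - Z' * Z') + (Z' * Z' * Z' - Z' * Z' * (Z' * (D * s)))
        - Z' * Z' * Z' * Z' := by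
      noncomm_ring
    rw [this, Z'g, hZ4']; simp

end IsHomotopy

end HomotopyAlgebra

/-! ### Traceless states, the decomposition and the reduction -/

section Decomposition

variable {C : Type*} [CommRing C] [Algebra ℝ C] {d : ℕ}

theorem der_mul_sum_three {R : Type*} [Ring R] {b c₁ c₂ c₃ A₁ A₂ A₃ : R}
    (h1 : b * c₁ = 1 - c₁ * b) (h2 : b * c₂ = -(c₂ * b)) (h3 : b * c₃ = -(c₃ * b))
    (k1 : Commute b A₁) (k2 : Commute b A₂) (k3 : Commute b A₃) :
    b * (c₁ * A₁ + c₂ * A₂ + c₃ * A₃) = A₁ - (c₁ * A₁ + c₂ * A₂ + c₃ * A₃) * b := by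
  simp only [mul_add, add_mul, ← mul_assoc]
  rw [h1, h2, h3]
  simp only [mul_assoc, sub_mul, neg_mul, one_mul, k1.eq, k2.eq, k3.eq]
  abel

/-- The anticommutator of D with a ghost derivative recovers one trace operator. With its two
analogues this identifies the degree-zero cocycles with the traceless states. -/
theorem ghostDer_gc0_mul_omegaTrace :
    ghostDer C gc0 * omegaTrace C d = box C d - omegaTrace C d * ghostDer C gc0 :=
  der_mul_sum_three (ghostDer_ghostMul_self gc0 C) (ghostDer_ghostMul C gc0_ne_gcd)
    (ghostDer_ghostMul C gc0_ne_gxi) (isCoeffOp_box.commute_ghostDer gc0)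
    (isCoeffOp_opS.commute_ghostDer gc0) (isCoeffOp_opT.commute_ghostDer gc0)

theorem ghostDer_gcd_mul_omegaTrace :
    ghostDer C gcd * omegaTrace C d = opS C d - omegaTrace C d * ghostDer C gcd := by
  have := der_mul_sum_three (ghostDer_ghostMul_self gcd C) (ghostDer_ghostMul C gc0_ne_gcd.symm)
    (ghostDer_ghostMul C gcd_ne_gxi) (isCoeffOp_opS.commute_ghostDer (d := d) gcd)
    (isCoeffOp_box.commute_ghostDer gcd) (isCoeffOp_opT.commute_ghostDer gcd)
  rwa [add_comm (ghostMul C gcd * opS C d)] at this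

theorem ghostDer_gxi_mul_omegaTrace :
    ghostDer C gxi * omegaTrace C d = opT C d - omegaTrace C d * ghostDer C gxi := by
  have := der_mul_sum_three (ghostDer_ghostMul_self gxi C) (ghostDer_ghostMul C gc0_ne_gxi.symm)
    (ghostDer_ghostMul C gcd_ne_gxi.symm) (isCoeffOp_opT.commute_ghostDer (d := d) gxi)
    (isCoeffOp_box.commute_ghostDer gxi) (isCoeffOp_opS.commute_ghostDer gxi)
  rwa [add_assoc, add_comm (ghostMul C gxi * opT C d)] at this

theorem ghostDer_apply_eq_zero {φ : States C d} (h : degZero C d φ = φ) {i : Ghost d}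
    (hi : i = gc0 ∨ i = gcd ∨ i = gxi) : ghostDer C i φ = 0 := states_ext fun S m n => by
  classical
  rw [cf_ghostDer, cf_zero]
  split_ifs with h0
  · rfl
  · have : ¬(ghostWeight tdeg).val (insert i S) m n = 0 := by
      rw [val_tdeg_eq_zero_iff]
      rintro ⟨h1, h2, h3⟩
      rcases hi with rfl | rfl | rfl <;> simp_all
    rw [← h, degZero, cf_trunc, if_neg this, smul_zero]

theorem mem_traceless_iff {φ : States C d} :
    φ ∈ traceless C d ↔ degZero C d φ = φ ∧ omegaTrace C d φ = 0 := by
  simp only [traceless, Submodule.mem_inf, LinearMap.mem_ker, mem_traceDeg_zero_iff]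
  constructor
  · rintro ⟨⟨⟨h1, h2⟩, h3⟩, h4⟩
    refine ⟨h4, ?_⟩
    simp [omegaTrace, h1, h2, h3]
  · rintro ⟨h4, h⟩
    have key : ∀ {i : Ghost d} {A : Op C d}, (i = gc0 ∨ i = gcd ∨ i = gxi) →
        ghostDer C i * omegaTrace C d = A - omegaTrace C d * ghostDer C i → A φ = 0 := by
      intro i A hi hA
      have := LinearMap.congr_fun hA φ
      rw [LinearMap.sub_apply, Module.End.mul_apply, Module.End.mul_apply, h,
        ghostDer_apply_eq_zero h4 hi, map_zero, map_zero, sub_zero] at this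
      exact this.symm
    exact ⟨⟨⟨key (by simp) ghostDer_gc0_mul_omegaTrace, key (by simp) ghostDer_gcd_mul_omegaTrace⟩,
      key (by simp) ghostDer_gxi_mul_omegaTrace⟩, h4⟩

/-- The properties of a contracting homotopy of `Ω_trace` needed for the reduction. -/
structure TraceHomotopy (s : Op C d) : Prop where
  tame : TameOp 0 s
  shift_tdeg : Shift (ghostWeight tdeg) 1 s
  shift_neg_tdeg : Shift (ghostWeight (-tdeg)) (-1) s
  shift_gh : Shift (ghostWeight gh) (-1) s
  shift_neg_gh : Shift (ghostWeight (-gh)) 1 s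
  homotopy : IsHomotopy (omegaTrace C d) s (degZero C d)

theorem shift_omegaTrace_gh : Shift (ghostWeight gh) 1 (omegaTrace C d) :=
  shift_omegaTrace_ghostWeight (by simp [gh, gc0_ne_gbd]) (by simp [gh, gcd_ne_gbd])
    (by simp [gh, gbd_ne_gxi.symm])

theorem shift_omegaTrace_neg_gh : Shift (ghostWeight (-gh)) (-1) (omegaTrace C d) :=
  shift_omegaTrace_ghostWeight (by simp [gh, gc0_ne_gbd]) (by simp [gh, gcd_ne_gbd])
    (by simp [gh, gbd_ne_gxi.symm])

theorem exists_traceHomotopy (C : Type*) [CommRing C] [Algebra ℝ C] (hd : 3 ≤ d + 1) :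
    ∃ s : Op C d, TraceHomotopy s := by
  obtain ⟨s, h1, h2, h3, h4, h5, h6, h7⟩ := exists_homotopy C hd
  refine ⟨s, h1, h3, h4, h5, h6, omegaTrace_mul_self C d, degZero_mul_self,
    degZero_mul_eq_zero shift_omegaTrace_neg_tdeg, h2, ?_, ?_, h7⟩
  · refine commute_trunc_eq ?_ ?_ 0
    · simpa using shift_omegaTrace_tdeg.mul h3
    · rw [neg_ghostWeight]
      simpa using shift_omegaTrace_neg_tdeg.mul h4
  · refine commute_trunc_eq ?_ ?_ 0
    · simpa using h3.mul shift_omegaTrace_tdeg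
    · rw [neg_ghostWeight]
      simpa using h4.mul shift_omegaTrace_neg_tdeg

theorem hasGhostNumber_apply {O : Op C d} {k l : ℤ} (h : Shift (ghostWeight gh) l O)
    (h' : Shift (ghostWeight (-gh)) (-l) O) {φ : States C d} (hφ : HasGhostNumber k φ) :
    HasGhostNumber (k + l) (O φ) := by
  rw [hasGhostNumber_iff] at hφ ⊢
  refine ⟨h _ _ hφ.1, ?_⟩
  rw [neg_add]
  exact h' _ _ hφ.2

namespace TraceHomotopy

variable {s : Op C d} (h : TraceHomotopy s)
include h

theorem sD_gh : Shift (ghostWeight gh) 0 (s * omegaTrace C d) := by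
  simpa using h.shift_gh.mul shift_omegaTrace_gh

theorem sD_neg_gh : Shift (ghostWeight (-gh)) (-0) (s * omegaTrace C d) := by
  simpa using h.shift_neg_gh.mul shift_omegaTrace_neg_gh

theorem Ds_gh : Shift (ghostWeight gh) 0 (omegaTrace C d * s) := by
  simpa using shift_omegaTrace_gh.mul h.shift_gh

theorem Ds_neg_gh : Shift (ghostWeight (-gh)) (-0) (omegaTrace C d * s) := by
  simpa using shift_omegaTrace_neg_gh.mul h.shift_neg_gh

theorem tame_sD : TameOp 0 (s * omegaTrace C d) := h.tame.mul tameOp_omegaTrace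

theorem tame_Ds : TameOp 0 (omegaTrace C d * s) := tameOp_omegaTrace.mul h.tame

omit h in
/-- The decomposition `H = Ẽ ⊕ Im Ω_trace ⊕ F` defined by a contracting homotopy. -/
def decomposition (h : TraceHomotopy s) : BundleDecomposition C d where
  PE := 1 - s * omegaTrace C d - omegaTrace C d * s
  PG := omegaTrace C d * s
  PF := s * omegaTrace C d
  diffE := ((tameOp_one.sub h.tame_sD).sub h.tame_Ds).isDiffOp
  diffG := h.tame_Ds.isDiffOp
  diffF := h.tame_sD.isDiffOp
  idemE := h.homotopy.proj_idem
  idemG := h.homotopy.Ds_idem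
  idemF := h.homotopy.sD_idem
  disjEG := h.homotopy.proj_Ds
  disjGE := h.homotopy.Ds_proj
  disjEF := h.homotopy.proj_sD
  disjFE := h.homotopy.sD_proj
  disjGF := h.homotopy.Ds_sD
  disjFG := h.homotopy.sD_Ds
  total := by abel
  ghostE k φ hφ := by
    simpa using hasGhostNumber_apply ((shift_one.sub h.sD_gh).sub h.Ds_gh)
      (((shift_one.mono (by simp)).sub h.sD_neg_gh).sub h.Ds_neg_gh) hφ
  ghostG k φ hφ := by simpa using hasGhostNumber_apply h.Ds_gh h.Ds_neg_gh hφ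
  ghostF k φ hφ := by simpa using hasGhostNumber_apply h.sD_gh h.sD_neg_gh hφ

theorem proj_apply_of_mem {φ : States C d} (hφ : φ ∈ traceless C d) :
    (1 - s * omegaTrace C d - omegaTrace C d * s) φ = φ := by
  rw [mem_traceless_iff] at hφ
  have hs : s φ = 0 := by
    rw [← hφ.1]
    exact LinearMap.congr_fun h.homotopy.right φ
  simp [hφ.2, hs]

theorem range_PE : LinearMap.range h.decomposition.PE = traceless C d := by
  ext φ
  constructor
  · rintro ⟨ψ, rfl⟩
    rw [mem_traceless_iff]
    exact ⟨LinearMap.congr_fun h.homotopy.e_proj ψ, LinearMap.congr_fun h.homotopy.D_proj ψ⟩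
  · intro hφ
    exact ⟨φ, h.proj_apply_of_mem hφ⟩

theorem range_PG : LinearMap.range h.decomposition.PG = LinearMap.range (omegaTrace C d) := by
  ext φ
  constructor
  · rintro ⟨ψ, rfl⟩
    exact ⟨s ψ, rfl⟩
  · rintro ⟨ψ, rfl⟩
    exact ⟨omegaTrace C d ψ, LinearMap.congr_fun h.homotopy.DsD ψ⟩

theorem range_PE_sup_range_PG : LinearMap.range h.decomposition.PE ⊔
    LinearMap.range h.decomposition.PG = LinearMap.ker (omegaTrace C d) := by
  apply le_antisymm
  · refine sup_le ?_ ?_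
    · rw [h.range_PE]
      exact fun φ hφ => (mem_traceless_iff.1 hφ).2
    · rw [h.range_PG]
      rintro _ ⟨ψ, rfl⟩
      exact LinearMap.congr_fun (omegaTrace_mul_self C d) ψ
  · intro φ hφ
    have e : φ = h.decomposition.PE φ + h.decomposition.PG φ := by
      have hφ' : omegaTrace C d φ = 0 := hφ
      change φ = (1 - s * omegaTrace C d - omegaTrace C d * s) φ + (omegaTrace C d * s) φ
      simp [hφ']
    rw [e]
    exact Submodule.add_mem_sup ⟨φ, rfl⟩ ⟨φ, rfl⟩

/-- Because Ω maps Ẽ to itself, the GE block vanishes there and the reduced operator has no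
correction term; invertibility of the GF block needs only that Ω − D does not lower the degree. -/
theorem isConsistentReduction {Ω Ωr : Op C d} {k : ℕ} (hΩ : TameOp k Ω)
    (hdeg : Shift (ghostWeight tdeg) 0 (Ω - omegaTrace C d))
    (hr : ∀ φ ∈ traceless C d, Ωr φ = Ω φ) (hmap : ∀ φ ∈ traceless C d, Ω φ ∈ traceless C d) :
    IsConsistentReduction Ω h.decomposition (traceless C d) Ωr := by
  refine ⟨h.range_PE, ?_⟩
  set D := omegaTrace C d
  have hD : Shift (ghostWeight tdeg) (-1) D := shift_omegaTrace_tdeg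
  -- Degrees lie between −3 and 0, so four successive increases leave nothing.
  have nil : ∀ {O : Op C d}, Shift (ghostWeight tdeg) 1 O → O * O * O * O = 0 :=
    fun {O} hO => LinearMap.ext fun φ =>
      eq_zero_of_mem_filt (((hO.mul hO).mul hO).mul hO _ _ (mem_filt_tdeg φ))
        (by rw [neg_ghostWeight]; exact mem_filt_neg_tdeg _) (by norm_num)
  obtain ⟨k1, k2, k3⟩ := h.homotopy.block_inverse (Ω := Ω) rfl rfl
    (nil (((((h.shift_tdeg.mul hD).mul h.shift_tdeg).mul hdeg).mul (h.shift_tdeg.mul hD)).mono (by norm_num)))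
    (nil ((((hD.mul h.shift_tdeg).mul hdeg).mul ((h.shift_tdeg.mul hD).mul h.shift_tdeg)).mono (by norm_num))) rfl
  -- The inverse is cubic in Z, which has order at most k; the factors s and D are of order zero.
  refine ⟨_, ⟨k + k + k, TameOp.isDiffOp ?_⟩, k1, k2, k3, ?_⟩
  · have hZ : TameOp k (s * D * s * (Ω - D) * (s * D)) :=
      .mul_zero (.zero_mul (h.tame_sD.mul h.tame) (hΩ.sub (tameOp_omegaTrace.mono (by simp))))
        h.tame_sD
    exact .mul_zero (.sub (.add (.sub (tameOp_one.mono (by simp)) (hZ.mono (by lia)))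
      ((hZ.mul hZ).mono (by lia))) ((hZ.mul hZ).mul hZ)) (h.tame_sD.mul h.tame)
  · intro φ hφ
    have e1 : h.decomposition.PE φ = φ := h.proj_apply_of_mem hφ
    have e2 : h.decomposition.PE (Ω φ) = Ω φ := h.proj_apply_of_mem (hmap φ hφ)
    have e3 : h.decomposition.PG (Ω φ) = 0 := by
      rw [← e2]
      exact LinearMap.congr_fun h.decomposition.disjGE (Ω φ)
    simp only [LinearMap.sub_apply, Module.End.mul_apply, e1, e2, e3, map_zero, sub_zero]
    exact hr φ hφ

/-- A cocycle outside degree zero is killed by the degree-zero projector and by D, so the homotopy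
identity reads φ = D(sφ). -/
theorem subsingleton_traceCohomology {n : ℤ} (hn : n ≠ 0) :
    Subsingleton (traceCohomology C d n) := by
  rw [Submodule.Quotient.subsingleton_iff, Submodule.submoduleOf, Submodule.comap_subtype_eq_top]
  rintro φ ⟨hφ, hdeg⟩
  have hφ' : omegaTrace C d φ = 0 := hφ
  have he : degZero C d φ = 0 := by
    classical
    refine states_ext fun S m k => ?_
    rw [degZero, cf_trunc, cf_zero]
    split_ifs with h0
    · by_contra h1
      refine hn ?_
      rw [← hdeg S fun h2 => h1 (by simp [cf, h2]), ← sum_tdeg, ← h0, val_ghostWeight]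
    · rfl
  have hc := LinearMap.congr_fun h.homotopy.contract φ
  have hs : omegaTrace C d (s φ) = φ := by
    simpa [he, hφ'] using hc
  refine ⟨s φ, ?_, hs⟩
  have hdeg' := mem_traceDeg_iff.1 hdeg
  refine mem_traceDeg_iff.2 ⟨h.shift_tdeg _ _ hdeg'.1, ?_⟩
  rw [neg_add]
  exact h.shift_neg_tdeg _ _ hdeg'.2

omit h in
theorem traceCocycles_zero : traceCocycles C d 0 = traceless C d := by
  ext φ
  rw [mem_traceless_iff, traceCocycles, Submodule.mem_inf, mem_traceDeg_zero_iff, and_comm]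
  rfl

omit h in
-- There are no states of positive degree, hence nothing to divide out.
theorem traceCoboundaries_zero : traceCoboundaries C d 0 = ⊥ := by
  have : traceDeg C d (0 + 1) = ⊥ := by
    rw [eq_bot_iff]
    intro φ hφ
    have := mem_traceDeg_iff.1 hφ
    exact eq_zero_of_mem_filt this.1 (by rw [neg_ghostWeight]; exact mem_filt_neg_tdeg φ)
      (by norm_num)
  rw [traceCoboundaries, this, Submodule.map_bot]

end TraceHomotopy

theorem exists_traceless_equiv (C : Type*) [CommRing C] [Algebra ℝ C] (d : ℕ) :
    ∃ ι : traceless C d ≃ₗ[ℝ] traceCohomology C d 0,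
      ∀ φ : traceless C d, ∃ h : φ.1 ∈ traceCocycles C d 0, ι φ = traceClass C d 0 ⟨φ.1, h⟩ := by
  have hbot : (traceCoboundaries C d 0).submoduleOf (traceCocycles C d 0) = ⊥ := by
    rw [TraceHomotopy.traceCoboundaries_zero (C := C), Submodule.submoduleOf, Submodule.comap_bot,
      Submodule.ker_subtype]
  exact ⟨(LinearEquiv.ofEq _ _ (TraceHomotopy.traceCocycles_zero (C := C) (d := d)).symm).trans
    (Submodule.quotEquivOfEqBot _ hbot).symm,
    fun φ => ⟨(TraceHomotopy.traceCocycles_zero (C := C) (d := d)).symm ▸ φ.2, rfl⟩⟩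

end Decomposition

/-! ### BRST operators of sl(2) and sums of odd operators -/

section GhostIdentities

variable {R : Type*} [Ring R]

/-- All words are brought to a normal order, ghosts to the left and then E, Q, H; in that order the
terms cancel. The dimension-independent shift by −2 is compatible with nilpotency. -/
theorem brst_sl2_sq {b b' m m' n n' Q H E : R}
    (b'b' : b' * b' = 0) (b'b : b' * b = 1 - b * b')
    (mm : m * m = 0) (m'm : m' * m = 1 - m * m')
    (nn : n * n = 0) (n'n : n' * n = 1 - n * n')
    (mb : m * b = -(b * m)) (mb' : m * b' = -(b' * m)) (m'b : m' * b = -(b * m'))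
    (m'b' : m' * b' = -(b' * m')) (nb : n * b = -(b * n)) (nb' : n * b' = -(b' * n))
    (n'b : n' * b = -(b * n')) (n'b' : n' * b' = -(b' * n')) (nm : n * m = -(m * n))
    (nm' : n * m' = -(m' * n)) (n'm : n' * m = -(m * n')) (n'm' : n' * m' = -(m' * n'))
    (Qb : Q * b = b * Q) (Qb' : Q * b' = b' * Q) (Qm : Q * m = m * Q) (Qm' : Q * m' = m' * Q)
    (Qn : Q * n = n * Q) (Qn' : Q * n' = n' * Q)
    (Hb : H * b = b * H) (Hb' : H * b' = b' * H) (Hm : H * m = m * H) (Hm' : H * m' = m' * H)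
    (Hn : H * n = n * H) (Hn' : H * n' = n' * H)
    (Eb : E * b = b * E) (Eb' : E * b' = b' * E) (Em : E * m = m * E) (Em' : E * m' = m' * E)
    (En : E * n = n * E) (En' : E * n' = n' * E)
    (QE : Q * E = E * Q + H) (HQ : H * Q = Q * H + (Q + Q)) (HE : H * E = E * H - (E + E)) :
    (b' * Q + (m * H - m - m) + n * E + (m * b * b' + m * b * b') + (m * n * n' + m * n * n')
      + n * b' * m') * (b' * Q + (m * H - m - m) + n * E + (m * b * b' + m * b * b')
      + (m * n * n' + m * n * n') + n * b' * m') = 0 := by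
  -- Each relation is also needed in front of a tail, since products are associated to the right.
  have r : ∀ {x y z : R}, x * y = z → ∀ t, x * (y * t) = z * t := fun h t => by
    rw [← mul_assoc, h]
  simp only [mul_add, add_mul, mul_sub, sub_mul, mul_assoc, neg_mul, mul_neg, zero_mul, mul_zero,
    one_mul, mul_one, neg_neg, neg_zero, sub_zero, add_zero, zero_add,
    b'b', r b'b', b'b, r b'b, mm, r mm, m'm, r m'm, nn, r nn, n'n, r n'n,
    mb, r mb, mb', r mb', m'b, r m'b, m'b', r m'b', nb, r nb, nb', r nb', n'b, r n'b, n'b', r n'b',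
    nm, r nm, nm', r nm', n'm, r n'm, n'm', r n'm', Qb, r Qb, Qb', r Qb', Qm, r Qm, Qm', r Qm',
    Qn, r Qn, Qn', r Qn', Hb, r Hb, Hb', r Hb', Hm, r Hm, Hm', r Hm', Hn, r Hn, Hn', r Hn',
    Eb, r Eb, Eb', r Eb', Em, r Em, Em', r Em', En, r En, En', r En', QE, r QE, HQ, r HQ, HE, r HE]
  abel

/-- B, S, T span a triplet under X, h, Y, and the added ghost bilinears act on c₀, c₁, c₂ in the
dual representation. The contraction D is therefore invariant, and sums of two commuting
representations again satisfy the sl(2) relations. -/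
theorem dressed_sl2 {c0 d0 c1 d1 c2 d2 Y X h B S T D Q E H : R}
    (c0c0 : c0 * c0 = 0) (d0d0 : d0 * d0 = 0) (c1c1 : c1 * c1 = 0) (d1d1 : d1 * d1 = 0)
    (c2c2 : c2 * c2 = 0) (d2d2 : d2 * d2 = 0) (d0c0 : d0 * c0 = 1 - c0 * d0)
    (c1c0 : c1 * c0 = -(c0 * c1)) (c1d0 : c1 * d0 = -(d0 * c1)) (d1c0 : d1 * c0 = -(c0 * d1))
    (d1d0 : d1 * d0 = -(d0 * d1)) (d1c1 : d1 * c1 = 1 - c1 * d1) (c2c0 : c2 * c0 = -(c0 * c2))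
    (c2d0 : c2 * d0 = -(d0 * c2)) (c2c1 : c2 * c1 = -(c1 * c2)) (c2d1 : c2 * d1 = -(d1 * c2))
    (d2c0 : d2 * c0 = -(c0 * d2)) (d2d0 : d2 * d0 = -(d0 * d2)) (d2c1 : d2 * c1 = -(c1 * d2))
    (d2d1 : d2 * d1 = -(d1 * d2)) (d2c2 : d2 * c2 = 1 - c2 * d2) (Yc0 : Y * c0 = c0 * Y)
    (Yd0 : Y * d0 = d0 * Y) (Yc1 : Y * c1 = c1 * Y) (Yd1 : Y * d1 = d1 * Y)
    (Yc2 : Y * c2 = c2 * Y) (Yd2 : Y * d2 = d2 * Y) (Xc0 : X * c0 = c0 * X)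
    (Xd0 : X * d0 = d0 * X) (Xc1 : X * c1 = c1 * X) (Xd1 : X * d1 = d1 * X)
    (Xc2 : X * c2 = c2 * X) (Xd2 : X * d2 = d2 * X) (hc0 : h * c0 = c0 * h)
    (hd0 : h * d0 = d0 * h) (hc1 : h * c1 = c1 * h) (hd1 : h * d1 = d1 * h)
    (hc2 : h * c2 = c2 * h) (hd2 : h * d2 = d2 * h) (Bc0 : B * c0 = c0 * B)
    (Bd0 : B * d0 = d0 * B) (Bc1 : B * c1 = c1 * B) (Bd1 : B * d1 = d1 * B)
    (Bc2 : B * c2 = c2 * B) (Bd2 : B * d2 = d2 * B) (Sc0 : S * c0 = c0 * S)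
    (Sd0 : S * d0 = d0 * S) (Sc1 : S * c1 = c1 * S) (Sd1 : S * d1 = d1 * S)
    (Sc2 : S * c2 = c2 * S) (Sd2 : S * d2 = d2 * S) (Tc0 : T * c0 = c0 * T)
    (Td0 : T * d0 = d0 * T) (Tc1 : T * c1 = c1 * T) (Td1 : T * d1 = d1 * T)
    (Tc2 : T * c2 = c2 * T) (Td2 : T * d2 = d2 * T) (XY : X * Y = Y * X + h)
    (hX : h * X = X * h + (X + X)) (hY : h * Y = Y * h - (Y + Y)) (BX : B * X = X * B)
    (SX : S * X = X * S + B) (TX : T * X = X * T + (S + S)) (BY : B * Y = Y * B + (S + S))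
    (SY : S * Y = Y * S + T) (TY : T * Y = Y * T) (Bh : B * h = h * B - (B + B))
    (Sh : S * h = h * S) (Th : T * h = h * T + (T + T))
    (hD : D = c0 * B + c1 * S + c2 * T) (hQ : Q = X + c1 * d0 + (c2 * d1 + c2 * d1))
    (hE : E = Y + (c0 * d1 + c0 * d1) + c1 * d2)
    (hH : H = h - (c0 * d0 + c0 * d0) + (c2 * d2 + c2 * d2)) :
    (Commute D Q ∧ Commute D E ∧ Commute D H) ∧
      Q * E = E * Q + H ∧ H * Q = Q * H + (Q + Q) ∧ H * E = E * H - (E + E) := by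
  have r : ∀ {x y z : R}, x * y = z → ∀ t, x * (y * t) = z * t := fun h t => by
    rw [← mul_assoc, h]
  subst hD hQ hE hH
  simp only [commute_iff_eq]
  simp only [
    mul_add, add_mul, mul_sub, sub_mul, mul_assoc, neg_mul, mul_neg, zero_mul, mul_zero, one_mul,
    mul_one, neg_neg, neg_zero, sub_zero, add_zero, zero_add, c0c0, r c0c0, d0d0, r d0d0, c1c1, r
    c1c1, d1d1, r d1d1, c2c2, r c2c2, d2d2, r d2d2, d0c0, r d0c0, c1c0, r c1c0, c1d0, r c1d0,
    d1c0, r d1c0, d1d0, r d1d0, d1c1, r d1c1, c2c0, r c2c0, c2d0, r c2d0, c2c1, r c2c1, c2d1, r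
    c2d1, d2c0, r d2c0, d2d0, r d2d0, d2c1, r d2c1, d2d1, r d2d1, d2c2, r d2c2, Yc0, r Yc0, Yd0,
    r Yd0, Yc1, r Yc1, Yd1, r Yd1, Yc2, r Yc2, Yd2, r Yd2, Xc0, r Xc0, Xd0, r Xd0, Xc1, r Xc1,
    Xd1, r Xd1, Xc2, r Xc2, Xd2, r Xd2, hc0, r hc0, hd0, r hd0, hc1, r hc1, hd1, r hd1, hc2, r
    hc2, hd2, r hd2, Bc0, r Bc0, Bd0, r Bd0, Bc1, r Bc1, Bd1, r Bd1, Bc2, r Bc2, Bd2, r Bd2, Sc0,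
    r Sc0, Sd0, r Sd0, Sc1, r Sc1, Sd1, r Sd1, Sc2, r Sc2, Sd2, r Sd2, Tc0, r Tc0, Td0, r Td0,
    Tc1, r Tc1, Td1, r Td1, Tc2, r Tc2, Td2, r Td2, XY, r XY, hX, r hX, hY, r hY, BX, r BX, SX, r
    SX, TX, r TX, BY, r BY, SY, r SY, TY, r TY, Bh, r Bh, Sh, r Sh, Th, r Th]
  refine ⟨⟨?_, ?_, ?_⟩, ?_, ?_, ?_⟩ <;> abel

/-- Anticommuting elements. -/
def AntiComm (x y : R) : Prop := x * y = -(y * x)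

namespace AntiComm

variable {t x y : R}

theorem symm (h : AntiComm x y) : AntiComm y x := by
  have h : x * y = -(y * x) := h
  change y * x = -(x * y)
  rw [h, neg_neg]

theorem add (hx : AntiComm t x) (hy : AntiComm t y) : AntiComm t (x + y) := by
  have hx : t * x = -(x * t) := hx
  have hy : t * y = -(y * t) := hy
  change t * (x + y) = -((x + y) * t)
  rw [mul_add, add_mul, hx, hy, neg_add]

theorem neg (hx : AntiComm t x) : AntiComm t (-x) := by
  have hx : t * x = -(x * t) := hx
  change t * (-x) = -(-x * t)
  rw [mul_neg, neg_mul, hx]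

theorem sub (hx : AntiComm t x) (hy : AntiComm t y) : AntiComm t (x - y) := by
  rw [sub_eq_add_neg]; exact hx.add hy.neg

theorem mul_comm_right (hx : AntiComm t x) (hy : Commute t y) : AntiComm t (x * y) := by
  have hx : t * x = -(x * t) := hx
  change t * (x * y) = -(x * y * t)
  rw [← mul_assoc, hx, neg_mul, mul_assoc, mul_assoc, hy.eq]

theorem mul_comm_left (hx : Commute t x) (hy : AntiComm t y) : AntiComm t (x * y) := by
  have hy : t * y = -(y * t) := hy
  change t * (x * y) = -(x * y * t)
  rw [← mul_assoc, hx.eq, mul_assoc, hy, mul_neg, mul_assoc]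

theorem mul (hx : AntiComm t x) (hy : AntiComm t y) : Commute t (x * y) := by
  have hx : t * x = -(x * t) := hx
  have hy : t * y = -(y * t) := hy
  change t * (x * y) = x * y * t
  rw [← mul_assoc, hx, neg_mul, mul_assoc, hy, mul_neg, neg_neg, mul_assoc]

theorem sum {ι : Type*} {s : Finset ι} {f : ι → R} (h : ∀ i ∈ s, AntiComm t (f i)) :
    AntiComm t (∑ i ∈ s, f i) := by
  change t * _ = -(_ * t)
  rw [Finset.mul_sum, Finset.sum_mul, ← Finset.sum_neg_distrib]
  exact Finset.sum_congr rfl h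

end AntiComm

theorem add_mul_self_eq_zero {x y : R} (hx : x * x = 0) (hy : y * y = 0) (hxy : AntiComm x y) :
    (x + y) * (x + y) = 0 := by
  have hxy : x * y = -(y * x) := hxy
  rw [add_mul, mul_add, mul_add, hx, hy, hxy]
  abel

/-- The mechanism of the de Rham differential: anticommuting symbols contracted with commuting
derivatives. -/
theorem sum_mul_self_eq_zero {ι : Type*} [Fintype ι] {t D : ι → R} (htt : ∀ i, t i * t i = 0)
    (ht : ∀ i j, i ≠ j → AntiComm (t i) (t j)) (htD : ∀ i j, Commute (t i) (D j))
    (hD : ∀ i j, Commute (D i) (D j)) :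
    (∑ i, t i * D i) * ∑ i, t i * D i = 0 := by
  classical
  have key : ∀ i j, t i * D i * (t j * D j) = -(t j * D j * (t i * D i)) ∨ i = j := by
    intro i j
    by_cases h : i = j
    · exact Or.inr h
    · left
      have h' : t i * t j = -(t j * t i) := ht i j h
      rw [(htD j i).symm.mul_mul_mul_comm, (htD i j).symm.mul_mul_mul_comm, h', (hD i j).eq, neg_mul]
  have diag0 : ∀ i, t i * D i * (t i * D i) = 0 := fun i => by
    rw [(htD i i).symm.mul_mul_mul_comm, htt, zero_mul]
  have main : ∀ s : Finset ι, (∑ i ∈ s, t i * D i) * ∑ i ∈ s, t i * D i = 0 := by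
    intro s
    induction s using Finset.induction_on with
    | empty => simp
    | insert a s ha ih =>
      rw [Finset.sum_insert ha]
      refine add_mul_self_eq_zero (diag0 a) ih (AntiComm.sum fun i hi => ?_)
      rcases key a i with h | h
      · exact h
      · exact absurd (h ▸ hi) ha
  exact main Finset.univ

end GhostIdentities

/-! ### Commutators as derivations -/

section Commutators

variable {R : Type*} [Ring R]

/-- The commutator. -/
def ad (x y : R) : R := x * y - y * x

theorem ad_add (x y z : R) : ad x (y + z) = ad x y + ad x z := by
  unfold ad; rw [mul_add, add_mul]; abel

theorem ad_sub (x y z : R) : ad x (y - z) = ad x y - ad x z := by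
  unfold ad; rw [mul_sub, sub_mul]; abel

theorem ad_mul (x y z : R) : ad x (y * z) = ad x y * z + y * ad x z := by
  unfold ad; noncomm_ring

theorem add_ad (x y z : R) : ad (x + y) z = ad x z + ad y z := by
  unfold ad; rw [mul_add, add_mul]; abel

theorem sub_ad (x y z : R) : ad (x - y) z = ad x z - ad y z := by
  unfold ad; rw [mul_sub, sub_mul]; abel

theorem mul_ad (x y z : R) : ad (x * y) z = ad x z * y + x * ad y z := by
  unfold ad; noncomm_ring

theorem ad_swap (x y : R) : ad x y = -ad y x := by
  unfold ad; abel

theorem ad_sum {ι : Type*} (s : Finset ι) (x : R) (f : ι → R) :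
    ad x (∑ i ∈ s, f i) = ∑ i ∈ s, ad x (f i) := by
  simp only [ad, Finset.mul_sum, Finset.sum_mul, Finset.sum_sub_distrib]

theorem sum_ad {ι : Type*} (s : Finset ι) (x : R) (f : ι → R) :
    ad (∑ i ∈ s, f i) x = ∑ i ∈ s, ad (f i) x := by
  simp only [ad, Finset.mul_sum, Finset.sum_mul, Finset.sum_sub_distrib]

theorem ad_smul [Algebra ℝ R] (r : ℝ) (x y : R) : ad x (r • y) = r • ad x y := by
  simp only [ad, mul_smul_comm, smul_mul_assoc, smul_sub]

theorem ad_eq_zero_iff {x y : R} : ad x y = 0 ↔ Commute x y := sub_eq_zero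

theorem ad_of_commute {x y : R} (h : Commute x y) : ad x y = 0 := ad_eq_zero_iff.2 h

end Commutators

/-! ### Quadratic operators in Weyl generators -/

section Weyl

variable {R : Type*} [Ring R] {ι : Type*} [Fintype ι] [DecidableEq ι]

/-- Canonical commutation relations for the pairs `(p, z)` and `(q, a)`. -/
structure IsWeyl (p q z a : ι → R) : Prop where
  pp : ∀ A B, Commute (p A) (p B)
  qq : ∀ A B, Commute (q A) (q B)
  pq : ∀ A B, Commute (p A) (q B)
  pa : ∀ A B, Commute (p A) (a B)
  qz : ∀ A B, Commute (q A) (z B)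
  az : ∀ A B, Commute (a A) (z B)
  aa : ∀ A B, Commute (a A) (a B)
  zz : ∀ A B, Commute (z A) (z B)
  pz : ∀ A B, ad (p A) (z B) = if A = B then 1 else 0
  qa : ∀ A B, ad (q A) (a B) = if A = B then 1 else 0

namespace IsWeyl

variable {p q z a : ι → R} (w : IsWeyl p q z a)
include w

theorem zp (A B : ι) : ad (z A) (p B) = if A = B then -1 else 0 := by
  rw [ad_swap, w.pz]
  simp only [eq_comm (a := B)]
  split_ifs <;> simp

theorem aq (A B : ι) : ad (a A) (q B) = if A = B then -1 else 0 := by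
  rw [ad_swap, w.qa]
  simp only [eq_comm (a := B)]
  split_ifs <;> simp

theorem ap_p (B : ι) : ad (∑ A, a A * p A) (p B) = 0 := by
  simp [sum_ad, mul_ad, ad_of_commute (w.pp _ _), ad_of_commute (w.pa _ _).symm]

theorem ap_q (B : ι) : ad (∑ A, a A * p A) (q B) = -p B := by
  simp [sum_ad, mul_ad, ad_of_commute (w.pq _ _), w.aq]

theorem ap_z (B : ι) : ad (∑ A, a A * p A) (z B) = a B := by
  simp [sum_ad, mul_ad, ad_of_commute (w.az _ _), w.pz]

theorem zq_p (B : ι) : ad (∑ A, z A * q A) (p B) = -q B := by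
  simp [sum_ad, mul_ad, ad_of_commute (w.pq _ _).symm, w.zp]

theorem zq_q (B : ι) : ad (∑ A, z A * q A) (q B) = 0 := by
  simp [sum_ad, mul_ad, ad_of_commute (w.qq _ _), ad_of_commute (w.qz _ _).symm]

theorem h_p (B : ι) : ad (∑ A, a A * q A - ∑ A, z A * p A) (p B) = p B := by
  simp [sum_ad, mul_ad, sub_ad, ad_of_commute (w.pq _ _).symm, ad_of_commute (w.pp _ _),
    ad_of_commute (w.pa _ _).symm, w.zp]

theorem h_q (B : ι) : ad (∑ A, a A * q A - ∑ A, z A * p A) (q B) = -q B := by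
  simp [sum_ad, mul_ad, sub_ad, ad_of_commute (w.pq _ _), ad_of_commute (w.qq _ _),
    ad_of_commute (w.qz _ _).symm, w.aq]

theorem h_z (B : ι) : ad (∑ A, a A * q A - ∑ A, z A * p A) (z B) = -z B := by
  simp [sum_ad, mul_ad, sub_ad, ad_of_commute (w.qz _ _), ad_of_commute (w.az _ _),
    ad_of_commute (w.zz _ _), w.pz]

theorem h_a (B : ι) : ad (∑ A, a A * q A - ∑ A, z A * p A) (a B) = a B := by
  simp [sum_ad, mul_ad, sub_ad, ad_of_commute (w.aa _ _), ad_of_commute (w.pa _ _),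
    ad_of_commute (w.az _ _).symm, w.qa]

theorem ap_zq : ad (∑ A, a A * p A) (∑ A, z A * q A) = ∑ A, a A * q A - ∑ A, z A * p A := by
  rw [ad_sum, ← Finset.sum_sub_distrib]
  refine Finset.sum_congr rfl fun A _ => ?_
  rw [ad_mul, w.ap_z, w.ap_q]; simp [sub_eq_add_neg]

theorem h_ap : ad (∑ A, a A * q A - ∑ A, z A * p A) (∑ A, a A * p A)
    = ∑ A, a A * p A + ∑ A, a A * p A := by
  rw [ad_sum, ← Finset.sum_add_distrib]
  refine Finset.sum_congr rfl fun A _ => ?_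
  rw [ad_mul, w.h_a, w.h_p]

theorem h_zq : ad (∑ A, a A * q A - ∑ A, z A * p A) (∑ A, z A * q A)
    = -(∑ A, z A * q A + ∑ A, z A * q A) := by
  rw [ad_sum, ← Finset.sum_add_distrib, ← Finset.sum_neg_distrib]
  refine Finset.sum_congr rfl fun A _ => ?_
  rw [ad_mul, w.h_z, w.h_q]; simp

variable [Algebra ℝ R] (η : ι → ℝ)

theorem ap_pp : ad (∑ A, a A * p A) (∑ A, η A • (p A * p A)) = 0 := by
  rw [ad_sum]
  refine Finset.sum_eq_zero fun A _ => ?_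
  rw [ad_smul, ad_mul, w.ap_p]; simp

theorem ap_qp : ad (∑ A, a A * p A) (∑ A, η A • (q A * p A)) = -∑ A, η A • (p A * p A) := by
  rw [ad_sum, ← Finset.sum_neg_distrib]
  refine Finset.sum_congr rfl fun A _ => ?_
  rw [ad_smul, ad_mul, w.ap_p, w.ap_q]; simp

theorem ap_qq : ad (∑ A, a A * p A) (∑ A, η A • (q A * q A))
    = -(∑ A, η A • (q A * p A) + ∑ A, η A • (q A * p A)) := by
  rw [ad_sum, ← Finset.sum_add_distrib, ← Finset.sum_neg_distrib]
  refine Finset.sum_congr rfl fun A _ => ?_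
  rw [ad_smul, ad_mul, w.ap_q, ← smul_add, ← smul_neg, neg_mul, mul_neg, (w.pq A A).eq, neg_add]

theorem zq_pp : ad (∑ A, z A * q A) (∑ A, η A • (p A * p A))
    = -(∑ A, η A • (q A * p A) + ∑ A, η A • (q A * p A)) := by
  rw [ad_sum, ← Finset.sum_add_distrib, ← Finset.sum_neg_distrib]
  refine Finset.sum_congr rfl fun A _ => ?_
  rw [ad_smul, ad_mul, w.zq_p, ← smul_add, ← smul_neg, neg_mul, mul_neg, (w.pq A A).eq, neg_add]

theorem zq_qp : ad (∑ A, z A * q A) (∑ A, η A • (q A * p A)) = -∑ A, η A • (q A * q A) := by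
  rw [ad_sum, ← Finset.sum_neg_distrib]
  refine Finset.sum_congr rfl fun A _ => ?_
  rw [ad_smul, ad_mul, w.zq_p, w.zq_q]; simp

theorem zq_qq : ad (∑ A, z A * q A) (∑ A, η A • (q A * q A)) = 0 := by
  rw [ad_sum]
  refine Finset.sum_eq_zero fun A _ => ?_
  rw [ad_smul, ad_mul, w.zq_q]; simp

theorem h_pp : ad (∑ A, a A * q A - ∑ A, z A * p A) (∑ A, η A • (p A * p A))
    = ∑ A, η A • (p A * p A) + ∑ A, η A • (p A * p A) := by
  rw [ad_sum, ← Finset.sum_add_distrib]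
  refine Finset.sum_congr rfl fun A _ => ?_
  rw [ad_smul, ad_mul, w.h_p, smul_add]

theorem h_qp : ad (∑ A, a A * q A - ∑ A, z A * p A) (∑ A, η A • (q A * p A)) = 0 := by
  rw [ad_sum]
  refine Finset.sum_eq_zero fun A _ => ?_
  rw [ad_smul, ad_mul, w.h_p, w.h_q]; simp

theorem h_qq : ad (∑ A, a A * q A - ∑ A, z A * p A) (∑ A, η A • (q A * q A))
    = -(∑ A, η A • (q A * q A) + ∑ A, η A • (q A * q A)) := by
  rw [ad_sum, ← Finset.sum_add_distrib, ← Finset.sum_neg_distrib]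
  refine Finset.sum_congr rfl fun A _ => ?_
  rw [ad_smul, ad_mul, w.h_q, ← smul_add, ← smul_neg, neg_mul, mul_neg, neg_add]

end IsWeyl

end Weyl

/-! ### Matrix actions, invariant contractions and flatness -/

section Covariance

variable {R : Type*} [Ring R] {ι : Type*} [Fintype ι] [DecidableEq ι]
  {C : Type*} [CommRing C] (c : C →+* R)

/-- The matrix acts on u and v by opposite transposed rules, so the two contributions cancel after
exchanging the summed indices. -/
theorem ad_contract_eq_zero {x : R} {u v : ι → R} {Γ : ι → ι → C}
    (hu : ∀ A, ad x (u A) = -∑ B, c (Γ A B) * u B) (hv : ∀ A, ad x (v A) = ∑ B, c (Γ B A) * v B)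
    (hc : ∀ f A, Commute (c f) (u A)) : ad x (∑ A, u A * v A) = 0 := by
  rw [ad_sum]
  have : ∀ A, ad x (u A * v A)
      = ∑ B, c (Γ B A) * (u A * v B) - ∑ B, c (Γ A B) * (u B * v A) := fun A => by
    rw [ad_mul, hu, hv, neg_mul, Finset.sum_mul, Finset.mul_sum, neg_add_eq_sub]
    congr 1
    · exact Finset.sum_congr rfl fun B _ => by rw [← mul_assoc, ← (hc _ A).eq, mul_assoc]
    · exact Finset.sum_congr rfl fun B _ => by rw [mul_assoc]
  rw [Finset.sum_congr rfl fun A _ => this A, Finset.sum_sub_distrib, Finset.sum_comm, sub_self]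

/-- Here both factors transform alike, and the cancellation comes from antisymmetry of the matrix
with respect to η. -/
theorem ad_metric_eq_zero [Algebra ℝ R] {x : R} {u v : ι → R} {Γ : ι → ι → C} {η : ι → ℝ}
    (hu : ∀ A, ad x (u A) = ∑ B, c (Γ B A) * u B) (hv : ∀ A, ad x (v A) = ∑ B, c (Γ B A) * v B)
    (hc : ∀ f A, Commute (c f) (u A))
    (hη : ∀ A B, η A • c (Γ B A) + η B • c (Γ A B) = 0) :
    ad x (∑ A, η A • (u A * v A)) = 0 := by
  rw [ad_sum]
  have : ∀ A, ad x (η A • (u A * v A))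
      = ∑ B, η A • c (Γ B A) * (u B * v A) + ∑ B, η A • c (Γ B A) * (u A * v B) := fun A => by
    rw [ad_smul, ad_mul, hu, hv, Finset.sum_mul, Finset.mul_sum, smul_add, Finset.smul_sum,
      Finset.smul_sum]
    congr 1
    · exact Finset.sum_congr rfl fun B _ => by rw [mul_assoc, smul_mul_assoc]
    · exact Finset.sum_congr rfl fun B _ => by
        rw [← mul_assoc, ← (hc _ A).eq, mul_assoc, smul_mul_assoc]
  rw [Finset.sum_congr rfl fun A _ => this A, Finset.sum_add_distrib,
    Finset.sum_comm (f := fun A B => η A • c (Γ B A) * (u B * v A)), ← Finset.sum_add_distrib]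
  refine Finset.sum_eq_zero fun A _ => ?_
  rw [← Finset.sum_add_distrib]
  refine Finset.sum_eq_zero fun B _ => ?_
  rw [← add_mul, add_comm, hη, zero_mul]

/-- The action of a matrix `α` on the pairs `(z, p)` and `(a, q)`. -/
def glAct (p q z a : ι → R) (α : ι → ι → C) : R :=
  ∑ K, ∑ B, c (α K B) * (z B * p K + a B * q K)

variable {c}

theorem glAct_sub (p q z a : ι → R) (α β : ι → ι → C) :
    glAct c p q z a (fun K B => α K B - β K B) = glAct c p q z a α - glAct c p q z a β := by
  simp only [glAct, map_sub, sub_mul, Finset.sum_sub_distrib]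

namespace IsWeyl

variable {p q z a : ι → R} (w : IsWeyl p q z a)
include w

section

variable (hp : ∀ f A, Commute (c f) (p A)) (hq : ∀ f A, Commute (c f) (q A))
  (hz : ∀ f A, Commute (c f) (z A)) (ha : ∀ f A, Commute (c f) (a A)) (α β : ι → ι → C)
include hp hq hz ha

theorem glAct_p (A : ι) : ad (glAct c p q z a α) (p A) = -∑ K, c (α K A) * p K := by
  have : ∀ K B, ad (c (α K B) * (z B * p K + a B * q K)) (p A)
      = if B = A then -(c (α K A) * p K) else 0 := fun K B => by
    rw [mul_ad, add_ad, mul_ad, mul_ad, w.zp, ad_of_commute (w.pp _ _),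
      ad_of_commute (w.pa _ _).symm, ad_of_commute (w.pq _ _).symm, ad_of_commute (hp _ _)]
    split_ifs with h
    · simp [h]
    · simp
  simp [glAct, sum_ad, this]

theorem glAct_q (A : ι) : ad (glAct c p q z a α) (q A) = -∑ K, c (α K A) * q K := by
  have : ∀ K B, ad (c (α K B) * (z B * p K + a B * q K)) (q A)
      = if B = A then -(c (α K A) * q K) else 0 := fun K B => by
    rw [mul_ad, add_ad, mul_ad, mul_ad, w.aq, ad_of_commute (w.qq _ _),
      ad_of_commute (w.qz _ _).symm, ad_of_commute (w.pq _ _), ad_of_commute (hq _ _)]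
    split_ifs with h
    · simp [h]
    · simp
  simp [glAct, sum_ad, this]

theorem glAct_z (A : ι) : ad (glAct c p q z a α) (z A) = ∑ B, c (α A B) * z B := by
  have : ∀ K B, ad (c (α K B) * (z B * p K + a B * q K)) (z A)
      = if K = A then c (α A B) * z B else 0 := fun K B => by
    rw [mul_ad, add_ad, mul_ad, mul_ad, w.pz, ad_of_commute (w.zz _ _),
      ad_of_commute (w.az _ _), ad_of_commute (w.qz _ _), ad_of_commute (hz _ _)]
    split_ifs with h
    · simp [h]
    · simp
  rw [glAct, Finset.sum_comm]
  simp [sum_ad, this]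

theorem glAct_a (A : ι) : ad (glAct c p q z a α) (a A) = ∑ B, c (α A B) * a B := by
  have : ∀ K B, ad (c (α K B) * (z B * p K + a B * q K)) (a A)
      = if K = A then c (α A B) * a B else 0 := fun K B => by
    rw [mul_ad, add_ad, mul_ad, mul_ad, w.qa, ad_of_commute (w.aa _ _),
      ad_of_commute (w.az _ _).symm, ad_of_commute (w.pa _ _), ad_of_commute (ha _ _)]
    split_ifs with h
    · simp [h]
    · simp
  rw [glAct, Finset.sum_comm]
  simp [sum_ad, this]

theorem commute_glAct (f : C) : Commute (c f) (glAct c p q z a α) :=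
  Commute.sum_right _ _ _ fun K _ => Commute.sum_right _ _ _ fun B _ =>
    Commute.mul_right (by rw [commute_iff_eq, ← map_mul, mul_comm, map_mul])
      (((hz _ _).mul_right (hp _ _)).add_right ((ha _ _).mul_right (hq _ _)))

/-- The realisation reverses matrix commutators. With the minus sign in the covariant derivative x −
`glAct` α, this produces exactly the curvature expression in `ad_covariant_eq_zero`. -/
theorem glAct_glAct : ad (glAct c p q z a α) (glAct c p q z a β)
    = glAct c p q z a (fun K B => ∑ L, (β K L * α L B - α K L * β L B)) := by
  have hcc : ∀ f g, c f * c g = c (f * g) := fun f g => (map_mul c f g).symm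
  have h1 : ∀ K B, ad (glAct c p q z a α) (c (β K B) * (z B * p K + a B * q K))
      = ∑ L, c (β K B * α B L) * (z L * p K + a L * q K)
        - ∑ L, c (α L K * β K B) * (z B * p L + a B * q L) := by
    intro K B
    rw [ad_mul, ad_of_commute (w.commute_glAct hp hq hz ha α _).symm, zero_mul, zero_add, ad_add,
      ad_mul, ad_mul, w.glAct_p hp hq hz ha, w.glAct_q hp hq hz ha, w.glAct_z hp hq hz ha,
      w.glAct_a hp hq hz ha]
    have e1 : z B * -∑ L, c (α L K) * p L = -∑ L, c (α L K) * (z B * p L) := by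
      rw [mul_neg, Finset.mul_sum]
      refine congrArg _ (Finset.sum_congr rfl fun L _ => ?_)
      rw [← mul_assoc, ← (hz _ B).eq, mul_assoc]
    have e2 : a B * -∑ L, c (α L K) * q L = -∑ L, c (α L K) * (a B * q L) := by
      rw [mul_neg, Finset.mul_sum]
      refine congrArg _ (Finset.sum_congr rfl fun L _ => ?_)
      rw [← mul_assoc, ← (ha _ B).eq, mul_assoc]
    rw [e1, e2]
    simp only [map_mul, mul_add, Finset.sum_add_distrib, Finset.mul_sum, Finset.sum_mul, mul_neg,
      mul_assoc]
    have e3 : ∀ L (y : R), c (α L K) * (c (β K B) * y) = c (β K B) * (c (α L K) * y) := by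
      intro L y
      rw [← mul_assoc, ← mul_assoc, hcc, hcc, mul_comm (α L K)]
    simp only [e3]
    abel
  have h2 : ∀ K B, c (∑ L, (β K L * α L B - α K L * β L B)) * (z B * p K + a B * q K)
      = ∑ L, c (β K L * α L B) * (z B * p K + a B * q K)
        - ∑ L, c (α K L * β L B) * (z B * p K + a B * q K) := by
    intro K B
    rw [map_sum, Finset.sum_mul, ← Finset.sum_sub_distrib]
    exact Finset.sum_congr rfl fun L _ => by rw [map_sub, sub_mul]
  change ad (glAct c p q z a α) (∑ K, ∑ B, c (β K B) * (z B * p K + a B * q K))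
    = ∑ K, ∑ B, c (∑ L, (β K L * α L B - α K L * β L B)) * (z B * p K + a B * q K)
  simp only [ad_sum, h1, h2]
  simp only [Finset.sum_sub_distrib]
  refine congrArg₂ (· - ·) (Finset.sum_congr rfl fun K _ => ?_) ?_
  · rw [Finset.sum_comm]
  · rw [Finset.sum_comm]
    conv_rhs => rw [Finset.sum_comm]
    refine Finset.sum_congr rfl fun B _ => ?_
    rw [Finset.sum_comm]

variable {x : R} {δ : C → C} (hδ : ∀ f, ad x (c f) = c (δ f)) (hxp : ∀ A, Commute x (p A))
  (hxq : ∀ A, Commute x (q A)) (hxz : ∀ A, Commute x (z A)) (hxa : ∀ A, Commute x (a A))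
include hδ hxp hxq hxz hxa

theorem ad_glAct : ad x (glAct c p q z a β) = glAct c p q z a (fun K B => δ (β K B)) := by
  simp only [glAct, ad_sum]
  refine Finset.sum_congr rfl fun K _ => Finset.sum_congr rfl fun B _ => ?_
  rw [ad_mul, hδ, ad_of_commute (((hxz B).mul_right (hxp K)).add_right
    ((hxa B).mul_right (hxq K))), mul_zero, add_zero]

/-- Flatness: covariant derivatives with vanishing curvature commute. -/
theorem ad_covariant_eq_zero {x' : R} {δ' : C → C} (hδ' : ∀ f, ad x' (c f) = c (δ' f))
    (hxp' : ∀ A, Commute x' (p A)) (hxq' : ∀ A, Commute x' (q A)) (hxz' : ∀ A, Commute x' (z A))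
    (hxa' : ∀ A, Commute x' (a A)) (hxx : Commute x x')
    (hflat : ∀ K B, δ (β K B) - δ' (α K B) + ∑ L, (α K L * β L B - β K L * α L B) = 0) :
    Commute (x - glAct c p q z a α) (x' - glAct c p q z a β) := by
  rw [← ad_eq_zero_iff, sub_ad, ad_sub, ad_sub, ad_of_commute hxx,
    w.ad_glAct hp hq hz ha β hδ hxp hxq hxz hxa, ad_swap _ x',
    w.ad_glAct hp hq hz ha α hδ' hxp' hxq' hxz' hxa', w.glAct_glAct hp hq hz ha]
  have e : (fun K B => ∑ L, (β K L * α L B - α K L * β L B))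
      = fun K B => δ (β K B) - δ' (α K B) := by
    funext K B
    rw [eq_comm, ← sub_eq_zero, ← hflat K B, sub_eq_add_neg, ← Finset.sum_neg_distrib]
    simp only [neg_sub]
  rw [e, glAct_sub]
  abel

end

end IsWeyl

end Covariance

/-! ### Leibniz rule and commuting partial derivatives on C^∞(U) -/

section PartialDerivatives

variable {d : ℕ} {U : TopologicalSpace.Opens (Fin d → ℝ)}

theorem smoothFn_contDiffAt (f : smoothFn U) (x : U) :
    ContDiffAt ℝ ∞ (Function.extend Subtype.val f.1 0) x.1 :=
  ContDiffOn.contDiffAt f.2 (U.isOpen.mem_nhds x.2)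

theorem partialX_apply (μ : Fin d) (f : smoothFn U) (x : U) : (partialX U μ f).1 x =
    fderiv ℝ (Function.extend Subtype.val f.1 0) x.1 (Pi.single μ 1) := rfl

theorem partialX_mul (μ : Fin d) (f g : smoothFn U) :
    partialX U μ (f * g) = partialX U μ f * g + f * partialX U μ g := by
  ext x
  have hd : ∀ k : smoothFn U,
      DifferentiableAt ℝ (Function.extend Subtype.val k.1 0) x.1 := fun k =>
    (smoothFn_contDiffAt k x).differentiableAt (by simp)
  have e : Function.extend Subtype.val (f * g).1 0
      = Function.extend Subtype.val f.1 0 * Function.extend Subtype.val g.1 0 := by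
    rw [← Function.extend_mul]; simp
  have ev : ∀ k : smoothFn U, Function.extend Subtype.val k.1 0 x.1 = k.1 x := fun k =>
    Subtype.val_injective.extend_apply _ _ _
  change fderiv ℝ (Function.extend Subtype.val (f * g).1 0) x.1 (Pi.single μ 1)
    = fderiv ℝ (Function.extend Subtype.val f.1 0) x.1 (Pi.single μ 1) * g.1 x
      + f.1 x * fderiv ℝ (Function.extend Subtype.val g.1 0) x.1 (Pi.single μ 1)
  rw [e, fderiv_mul (hd f) (hd g)]
  simp only [add_apply, smul_apply, smul_eq_mul, ev]
  ring

theorem partialX_comm (μ ν : Fin d) (f : smoothFn U) :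
    partialX U μ (partialX U ν f) = partialX U ν (partialX U μ f) := by
  ext x
  set F := Function.extend Subtype.val f.1 0 with hF
  have key : ∀ μ ν : Fin d, (partialX U μ (partialX U ν f)).1 x
      = fderiv ℝ (fderiv ℝ F) x.1 (Pi.single μ 1) (Pi.single ν 1) := by
    intro μ ν
    -- Outside U the extension by zero has no relation to the derivative; agreement near x suffices
    -- because U is open.
    have e : Function.extend Subtype.val (partialX U ν f).1 0
        =ᶠ[nhds x.1] fun y => fderiv ℝ F y (Pi.single ν 1) := by
      filter_upwards [U.isOpen.mem_nhds x.2] with y hy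
      exact Subtype.val_injective.extend_apply (partialX U ν f).1 0 ⟨y, hy⟩
    have hd : DifferentiableAt ℝ (fderiv ℝ F) x.1 :=
      ((smoothFn_contDiffAt f x).fderiv_right (m := 1) (by norm_cast)).differentiableAt (by simp)
    rw [partialX_apply, e.fderiv_eq, fderiv_clm_apply hd (differentiableAt_const _)]
    simp
  change (partialX U μ (partialX U ν f)).1 x = (partialX U ν (partialX U μ f)).1 x
  rw [key, key]
  exact (smoothFn_contDiffAt f x).isSymmSndFDerivAt
    (by rw [minSmoothness_of_isRCLikeNormedField]; norm_cast) _ _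

end PartialDerivatives

/-! ### Translation from Y to Y + V -/

section Translation

variable {R : Type*} [Ring R] {ι : Type*} [Fintype ι] [DecidableEq ι]
  {C : Type*} [CommRing C] {c : C →+* R}

namespace IsWeyl

variable {p q y a : ι → R} (w : IsWeyl p q y a)
  (hp : ∀ f A, Commute (c f) (p A)) (hq : ∀ f A, Commute (c f) (q A))
  (hy : ∀ f A, Commute (c f) (y A)) (ha : ∀ f A, Commute (c f) (a A)) (V : ι → C)
include w hp hq hy ha

theorem translate : IsWeyl p q (fun A => y A + c (V A)) a where
  pp := w.pp
  qq := w.qq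
  pq := w.pq
  pa := w.pa
  qz A B := (w.qz A B).add_right (hq _ A).symm
  az A B := (w.az A B).add_right (ha _ A).symm
  aa := w.aa
  zz A B := ((w.zz A B).add_right (hy _ A).symm).add_left ((hy _ B).add_right
    (by rw [commute_iff_eq, ← map_mul, mul_comm, map_mul]))
  pz A B := by rw [ad_add, w.pz, ad_of_commute (hp _ _).symm, add_zero]
  qa := w.qa

variable {x x' : R} {δ δ' : C → C} (hδ : ∀ f, ad x (c f) = c (δ f))
  (hxp : ∀ A, Commute x (p A)) (hxq : ∀ A, Commute x (q A)) (hxy : ∀ A, Commute x (y A))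
  (hxa : ∀ A, Commute x (a A))

omit hq hy ha in
include hδ in
theorem ad_translated (f : C) : ad (x - ∑ K, c (δ (V K)) * p K) (c f) = c (δ f) := by
  rw [sub_ad, hδ, sum_ad, Finset.sum_eq_zero, sub_zero]
  intro K _
  refine ad_of_commute (Commute.mul_left ?_ (hp _ _).symm)
  rw [commute_iff_eq, ← map_mul, mul_comm, map_mul]

omit hq hy ha in
include hxp in
theorem translated_p (A : ι) : Commute (x - ∑ K, c (δ (V K)) * p K) (p A) :=
  (hxp A).sub_left (Commute.sum_left _ _ _ fun _ _ => (hp _ _).mul_left (w.pp _ _))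

omit hp hy ha in
include hxq in
theorem translated_q (A : ι) : Commute (x - ∑ K, c (δ (V K)) * p K) (q A) :=
  (hxq A).sub_left (Commute.sum_left _ _ _ fun _ _ => (hq _ _).mul_left (w.pq _ _))

omit hp hq hy in
include hxa in
theorem translated_a (A : ι) : Commute (x - ∑ K, c (δ (V K)) * p K) (a A) :=
  (hxa A).sub_left (Commute.sum_left _ _ _ fun _ _ => (ha _ _).mul_left (w.pa _ _))

omit hq ha in
include hδ hxy in
-- The derivative of V in Y + V is cancelled by the commutator of the subtracted term with Y. The
-- translated derivation thus treats Y + V as a constant.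
theorem translated_z (A : ι) :
    Commute (x - ∑ K, c (δ (V K)) * p K) (y A + c (V A)) := by
  rw [← ad_eq_zero_iff, ad_add, w.ad_translated hp V hδ, sub_ad, ad_of_commute (hxy A), sum_ad]
  simp [mul_ad, w.pz, ad_of_commute (hy _ _)]

omit hq hy ha in
include hδ hxp in
-- The commutator produces the two mixed second derivatives of V, which agree.
theorem commute_translated (hδ' : ∀ f, ad x' (c f) = c (δ' f)) (hxp' : ∀ A, Commute x' (p A))
    (hxx : Commute x x') (hδδ : ∀ f, δ (δ' f) = δ' (δ f)) :
    Commute (x - ∑ K, c (δ (V K)) * p K) (x' - ∑ K, c (δ' (V K)) * p K) := by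
  rw [← ad_eq_zero_iff, ad_sub, ad_swap _ x', ad_sum]
  have h1 : ad x' (x - ∑ K, c (δ (V K)) * p K) = -∑ K, c (δ' (δ (V K))) * p K := by
    rw [ad_sub, ad_of_commute hxx.symm, ad_sum, zero_sub]
    refine congrArg _ (Finset.sum_congr rfl fun K _ => ?_)
    rw [ad_mul, hδ', ad_of_commute (hxp' K), mul_zero, add_zero]
  have h2 : ∀ K, ad (x - ∑ K, c (δ (V K)) * p K) (c (δ' (V K)) * p K)
      = c (δ' (δ (V K))) * p K := fun K => by
    rw [ad_mul, w.ad_translated hp V hδ, ad_of_commute (w.translated_p hp V hxp K), mul_zero,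
      add_zero, hδδ]
  rw [h1, neg_neg, Finset.sum_congr rfl fun K _ => h2 K, sub_self]

end IsWeyl

end Translation

/-! ### The sl(2) relations on states -/

section Operators

variable {C : Type*} [CommRing C] [Algebra ℝ C] {d : ℕ}

variable (C d) in
/-- Multiplication by functions, as a ring homomorphism. -/
def mulCHom : C →+* Op C d where
  toFun := mulC
  map_one' := op_ext fun φ S m n => by simp [cf_mulC]
  map_mul' f g := op_ext fun φ S m n => by simp [cf_mulC, mul_assoc]
  map_zero' := op_ext fun φ S m n => by simp [cf_mulC]
  map_add' f g := op_ext fun φ S m n => by simp [cf_mulC, add_mul]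

theorem mulCHom_apply (f : C) : mulCHom C d f = mulC f := rfl

theorem isWeyl_states : IsWeyl (dY C (d := d)) (dA C) (mulY C) (mulA C) where
  pp A B := commute_dY_dY C A B
  qq A B := commute_dA_dA C A B
  pq A B := (commute_dA_dY C B A).symm
  pa A B := (commute_mulA_dY C B A).symm
  qz A B := commute_dA_mulY C A B
  az A B := commute_mulA_mulY C A B
  aa A B := commute_mulA_mulA C A B
  zz A B := commute_mulY_mulY C A B
  pz A B := sub_eq_of_eq_add' (dY_mulY C A B)
  qa A B := sub_eq_of_eq_add' (dA_mulA C A B)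

/-- Since Y + V obeys the same canonical relations as Y, the computations with `opSbd` and `opH` can
be made in the translated variable. -/
theorem isWeyl_translated (V : Fin (d + 1) → C) :
    IsWeyl (dY C) (dA C) (fun A => mulY C A + mulC (V A)) (mulA C) :=
  isWeyl_states.translate (c := mulCHom C d) (fun _ _ => commute_onBase_dY _ _)
    (fun _ _ => commute_onBase_dA _ _) (fun _ _ => commute_onBase_mulY _ _)
    (fun _ _ => commute_onBase_mulA _ _) V

theorem sl2_opSd_opSbd (V : Fin (d + 1) → C) : ad (opSd C d) (opSbd V) = opH V :=
  (isWeyl_translated V).ap_zq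

theorem sl2_opH_opSd (V : Fin (d + 1) → C) : ad (opH V) (opSd C d) = opSd C d + opSd C d :=
  (isWeyl_translated V).h_ap

theorem sl2_opH_opSbd (V : Fin (d + 1) → C) : ad (opH V) (opSbd V) = -(opSbd V + opSbd V) :=
  (isWeyl_translated V).h_zq

end Operators

/-! ### The covariant derivatives contained in ∇ + σ -/

namespace Background

variable {d : ℕ} {U : TopologicalSpace.Opens (Fin d → ℝ)} {l : ℝ} (B : Background d U l)

theorem ad_onBase_partialX (m : Fin d) (f : smoothFn U) :
    ad (onBase (partialX U m)) (mulCHom (smoothFn U) d f)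
      = mulCHom (smoothFn U) d (partialX U m f) :=
  sub_eq_of_eq_add (op_ext fun φ S k n => by
    simp only [mulCHom_apply, Module.End.mul_apply, LinearMap.add_apply, cf_add, cf_mulC, cf_onBase,
      partialX_mul])

theorem commute_onBase_partialX (m n : Fin d) :
    Commute (onBase (partialX U m) : Op (smoothFn U) d) (onBase (partialX U n)) :=
  op_ext fun φ S k r => by
    simp only [Module.End.mul_apply, cf_onBase, partialX_comm m n]

/-- The covariant derivative along `x^m`. -/
def covariant (m : Fin d) : Op (smoothFn U) d :=
  onBase (partialX U m) - ∑ K, ∑ A, mulC (B.conn m K A) * mulY (smoothFn U) A * dY (smoothFn U) K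
    - ∑ K, ∑ A, mulC (B.conn m K A) * mulA (smoothFn U) A * dA (smoothFn U) K
    - ∑ A, mulC (B.e m A) * dY (smoothFn U) A

theorem nabla_add_sigma :
    B.nabla + B.sigma = ∑ m, ghostMul (smoothFn U) (gth m) * B.covariant m := by
  have h : ∀ m, ghostMul (smoothFn U) (gth m) * B.covariant m =
      ghostMul (smoothFn U) (gth m) * (onBase (partialX U m)
    - ∑ K, ∑ A, mulC (B.conn m K A) * mulY (smoothFn U) A * dY (smoothFn U) K
    - ∑ K, ∑ A, mulC (B.conn m K A) * mulA (smoothFn U) A * dA (smoothFn U) K)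
      - ∑ A, ghostMul (smoothFn U) (gth m) * mulC (B.e m A) * dY (smoothFn U) A := fun m => by
    rw [covariant, mul_sub (ghostMul (smoothFn U) (gth m)) (_ - _ - _), Finset.mul_sum]
    simp only [mul_assoc]
  rw [Finset.sum_congr rfl fun m _ => h m, Finset.sum_sub_distrib, sub_eq_add_neg]
  rfl

end Background

section
variable {R : Type*} [Ring R] {ι : Type*} [Fintype ι] 
  {C : Type*} [CommRing C] (c : C →+* R)

/-- Of the two parts of the vielbein, dV translates the base derivative and ωV completes Y to Y + V
in the rotation term. -/
theorem glAct_translate (p q y a : ι → R) (x : R) (α : ι → ι → C) (V W e : ι → C)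
    (he : ∀ K, W K + ∑ B, α K B * V B = e K) :
    x - ∑ K, ∑ A, c (α K A) * y A * p K - ∑ K, ∑ A, c (α K A) * a A * q K - ∑ A, c (e A) * p A
      = x - ∑ K, c (W K) * p K - glAct c p q (fun A => y A + c (V A)) a α := by
  simp only [← he, glAct, map_add, map_sum, map_mul, add_mul, mul_add, Finset.sum_add_distrib,
    Finset.sum_mul, mul_assoc]
  abel

end

/-! ### The fibre operator in terms of dressed generators -/

section AbstractForm

variable {R : Type*} [Ring R]

theorem mul_eq_of_ad_eq {x y z : R} (h : ad x y = z) : x * y = y * x + z := sub_eq_iff_eq_add'.1 h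

theorem mul_eq_of_ad_eq_neg {x y z : R} (h : ad x y = -z) : x * y = y * x - z := by
  rw [mul_eq_of_ad_eq h, sub_eq_add_neg]

theorem mul_swap_of_ad_eq {x y z : R} (h : ad x y = z) : y * x = x * y - z := by
  rw [mul_eq_of_ad_eq h, add_sub_cancel_right]

theorem mul_swap_of_ad_eq_neg {x y z : R} (h : ad x y = -z) : y * x = x * y + z := by
  rw [mul_swap_of_ad_eq h, sub_neg_eq_add]

/-- The BRST operator of `sl(2)` generators `Q, H, E` with shifted weight. -/
def sl2Brst (b b' m m' n n' Q H E : R) : R :=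
  b' * Q + (m * H - m - m) + n * E + (m * b * b' + m * b * b') + (m * n * n' + m * n * n')
    + n * b' * m'

variable {b b' m m' n n' Q H E : R}

theorem AntiComm.sl2Brst {t : R} (hb : AntiComm t b) (hb' : AntiComm t b') (hm : AntiComm t m)
    (hm' : AntiComm t m') (hn : AntiComm t n) (hn' : AntiComm t n') (hQ : Commute t Q)
    (hH : Commute t H) (hE : Commute t E) :
    AntiComm t (HSParent.sl2Brst b b' m m' n n' Q H E) :=
  have h1 := mul_comm_left (hm.mul hb) hb'
  have h2 := mul_comm_left (hm.mul hn) hn'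
  (((((hb'.mul_comm_right hQ).add (((hm.mul_comm_right hH).sub hm).sub hm)).add
    (hn.mul_comm_right hE)).add (h1.add h1)).add (h2.add h2)).add (mul_comm_left (hn.mul hb') hm')

theorem commute_sl2Brst {t : R} (hb : Commute t b) (hb' : Commute t b') (hm : Commute t m)
    (hm' : Commute t m') (hn : Commute t n) (hn' : Commute t n') (hQ : Commute t Q)
    (hH : Commute t H) (hE : Commute t E) :
    Commute t (sl2Brst b b' m m' n n' Q H E) :=
  have h1 := (hm.mul_right hb).mul_right hb'
  have h2 := (hm.mul_right hn).mul_right hn'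
  (((((hb'.mul_right hQ).add_right (((hm.mul_right hH).sub_right hm).sub_right hm)).add_right
    (hn.mul_right hE)).add_right (h1.add_right h1)).add_right (h2.add_right h2)).add_right
    ((hn.mul_right hb').mul_right hm')

variable [Algebra ℝ R]

theorem sl2Brst_eq {X Y h : R} (hX : Commute X b') :
    X * b' + m * (h - 2) + n * Y + (2 : ℝ) • (m * b * b') + (2 : ℝ) • (m * n * n') + n * b' * m'
      = sl2Brst b b' m m' n n' X h Y := by
  rw [sl2Brst, hX.eq, two_smul, two_smul, ← one_add_one_eq_two, mul_sub, mul_add, mul_one]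
  abel

/-- Every term outside D that contains a trace ghost fits into one of the three dressed generators;
the signs come from moving the derivative in b† past c† and ξ. -/
theorem sl2Brst_dressed_eq {c0 d0 c1 d1 c2 d2 B S T X Y h : R} (hX : Commute X b')
    (h1 : b' * c1 = -(c1 * b')) (h2 : b' * c2 = -(c2 * b')) :
    c0 * B + c1 * S + X * b' + c2 * T + m * (h - 2) + n * Y - c1 * b' * d0
      - (2 : ℝ) • (c2 * b' * d1) - (2 : ℝ) • (m * c0 * d0) + (2 : ℝ) • (m * b * b')
      + (2 : ℝ) • (m * c2 * d2) + (2 : ℝ) • (n * c0 * d1) + (2 : ℝ) • (m * n * n') + n * c1 * d2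
      + n * b' * m'
      = c0 * B + c1 * S + c2 * T + sl2Brst b b' m m' n n' (X + c1 * d0 + (c2 * d1 + c2 * d1))
        (h - (c0 * d0 + c0 * d0) + (c2 * d2 + c2 * d2)) (Y + (c0 * d1 + c0 * d1) + c1 * d2) := by
  rw [sl2Brst, hX.eq, ← one_add_one_eq_two (R := R)]
  simp only [two_smul, mul_add, mul_sub, ← mul_assoc, h1, h2, mul_one, neg_mul]
  abel

end AbstractForm

/-! ### Nilpotency of `omegaBar` -/

section Ghosts

variable {C : Type*} [CommRing C] [Algebra ℝ C] {d : ℕ} {i j : Ghost d}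

theorem gth_ne_gth {m n : Fin d} (h : m ≠ n) : gth m ≠ gth n := by simpa [gth] using h

theorem antiComm_mul_mul (h : i ≠ j) : AntiComm (ghostMul C i) (ghostMul C j) :=
  ghostMul_ghostMul C h

theorem antiComm_der_der (h : i ≠ j) : AntiComm (ghostDer C i) (ghostDer C j) :=
  ghostDer_ghostDer C h

theorem antiComm_der_mul (h : i ≠ j) : AntiComm (ghostDer C i) (ghostMul C j) :=
  ghostDer_ghostMul C h

theorem antiComm_mul_der (h : i ≠ j) : AntiComm (ghostMul C i) (ghostDer C j) :=
  (antiComm_der_mul h.symm).symm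

theorem antiComm_mul_omegaTrace (h0 : i ≠ gc0) (h1 : i ≠ gcd) (h2 : i ≠ gxi) :
    AntiComm (ghostMul C i) (omegaTrace C d) :=
  (((antiComm_mul_mul h0).mul_comm_right (isCoeffOp_box.commute_ghostMul i)).add
    ((antiComm_mul_mul h1).mul_comm_right (isCoeffOp_opS.commute_ghostMul i))).add
    ((antiComm_mul_mul h2).mul_comm_right (isCoeffOp_opT.commute_ghostMul i))

theorem antiComm_der_omegaTrace (h0 : i ≠ gc0) (h1 : i ≠ gcd) (h2 : i ≠ gxi) :
    AntiComm (ghostDer C i) (omegaTrace C d) :=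
  (((antiComm_der_mul h0).mul_comm_right (isCoeffOp_box.commute_ghostDer i)).add
    ((antiComm_der_mul h1).mul_comm_right (isCoeffOp_opS.commute_ghostDer i))).add
    ((antiComm_der_mul h2).mul_comm_right (isCoeffOp_opT.commute_ghostDer i))

variable (C d) in
/-- `S†` dressed by the trace ghosts. -/
def dressedSd : Op C d := opSd C d + ghostMul C gcd * ghostDer C gc0
  + (ghostMul C gxi * ghostDer C gcd + ghostMul C gxi * ghostDer C gcd)

/-- `h` dressed by the trace ghosts. -/
def dressedH (V : Fin (d + 1) → C) : Op C d := opH V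
  - (ghostMul C gc0 * ghostDer C gc0 + ghostMul C gc0 * ghostDer C gc0)
  + (ghostMul C gxi * ghostDer C gxi + ghostMul C gxi * ghostDer C gxi)

/-- `S̄†` dressed by the trace ghosts. -/
def dressedSbd (V : Fin (d + 1) → C) : Op C d := opSbd V
  + (ghostMul C gc0 * ghostDer C gcd + ghostMul C gc0 * ghostDer C gcd)
  + ghostMul C gcd * ghostDer C gxi

section

variable {t : Op C d} (V : Fin (d + 1) → C)

theorem commute_dressed (hX : Commute t (opSd C d)) (hh : Commute t (opH V))
    (hY : Commute t (opSbd V))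
    (hc : ∀ i j : Ghost d, (i = gc0 ∨ i = gcd ∨ i = gxi) → (j = gc0 ∨ j = gcd ∨ j = gxi) →
      Commute t (ghostMul C i * ghostDer C j)) :
    Commute t (dressedSd C d) ∧ Commute t (dressedH V) ∧ Commute t (dressedSbd V) := by
  have h1 := hc gxi gcd (by simp) (by simp)
  have h2 := hc gc0 gc0 (by simp) (by simp)
  have h3 := hc gxi gxi (by simp) (by simp)
  have h4 := hc gc0 gcd (by simp) (by simp)
  exact ⟨(hX.add_right (hc _ _ (by simp) (by simp))).add_right (h1.add_right h1),
    (hh.sub_right (h2.add_right h2)).add_right (h3.add_right h3),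
    (hY.add_right (h4.add_right h4)).add_right (hc _ _ (by simp) (by simp))⟩

theorem commute_mul_dressed (h0 : i ≠ gc0) (h1 : i ≠ gcd) (h2 : i ≠ gxi) :
    Commute (ghostMul C i) (dressedSd C d) ∧ Commute (ghostMul C i) (dressedH V) ∧
      Commute (ghostMul C i) (dressedSbd V) := by
  refine commute_dressed V (isCoeffOp_opSd.commute_ghostMul i)
    ((isCoeffOp_opH V).commute_ghostMul i) ((isCoeffOp_opSbd V).commute_ghostMul i) ?_
  rintro j k (rfl | rfl | rfl) (rfl | rfl | rfl) <;>
    exact (antiComm_mul_mul ‹_›).mul (antiComm_mul_der ‹_›)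

theorem commute_der_dressed (h0 : i ≠ gc0) (h1 : i ≠ gcd) (h2 : i ≠ gxi) :
    Commute (ghostDer C i) (dressedSd C d) ∧ Commute (ghostDer C i) (dressedH V) ∧
      Commute (ghostDer C i) (dressedSbd V) := by
  refine commute_dressed V (isCoeffOp_opSd.commute_ghostDer i)
    ((isCoeffOp_opH V).commute_ghostDer i) ((isCoeffOp_opSbd V).commute_ghostDer i) ?_
  rintro j k (rfl | rfl | rfl) (rfl | rfl | rfl) <;>
    exact (antiComm_der_mul ‹_›).mul (antiComm_der_der ‹_›)

end

/-- The `sl(2)` BRST operator on states. -/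
abbrev stateBrst (Q H E : Op C d) : Op C d :=
  sl2Brst (ghostMul C gbd) (ghostDer C gbd) (ghostMul C gmu) (ghostDer C gmu) (ghostMul C gnu)
    (ghostDer C gnu) Q H E

variable (V : Fin (d + 1) → C)

theorem omegaTilde_eq : omegaTilde V = stateBrst (opSd C d) (opH V) (opSbd V) :=
  sl2Brst_eq (isCoeffOp_opSd.commute_ghostDer gbd).symm

theorem omegaBar_eq :
    omegaBar V = omegaTrace C d + stateBrst (dressedSd C d) (dressedH V) (dressedSbd V) :=
  sl2Brst_dressed_eq (isCoeffOp_opSd.commute_ghostDer gbd).symm (ghostDer_ghostMul C gcd_ne_gbd.symm)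
    (ghostDer_ghostMul C gbd_ne_gxi)

theorem dressed_relations :
    (Commute (omegaTrace C d) (dressedSd C d) ∧ Commute (omegaTrace C d) (dressedSbd V) ∧
      Commute (omegaTrace C d) (dressedH V)) ∧
      dressedSd C d * dressedSbd V = dressedSbd V * dressedSd C d + dressedH V ∧
      dressedH V * dressedSd C d = dressedSd C d * dressedH V + (dressedSd C d + dressedSd C d) ∧
      dressedH V * dressedSbd V
        = dressedSbd V * dressedH V - (dressedSbd V + dressedSbd V) := by
  have w := isWeyl_translated V
  have m := fun {O : Op C d} (h : IsCoeffOp O) (i : Ghost d) => (h.commute_ghostMul i).symm.eq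
  have D := fun {O : Op C d} (h : IsCoeffOp O) (i : Ghost d) => (h.commute_ghostDer i).symm.eq
  have mm := fun {i j : Ghost d} (h : i ≠ j) => ghostMul_ghostMul C h
  have DD := fun {i j : Ghost d} (h : i ≠ j) => ghostDer_ghostDer C h
  have Dm := fun {i j : Ghost d} (h : i ≠ j) => ghostDer_ghostMul C h
  have mD := fun {i j : Ghost d} (h : i ≠ j) => (antiComm_mul_der h : AntiComm (ghostMul C i) _)
  have Y := isCoeffOp_opSbd V
  have H := isCoeffOp_opH V
  have X := isCoeffOp_opSd (C := C) (d := d)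
  have B := isCoeffOp_box (C := C) (d := d)
  have S := isCoeffOp_opS (C := C) (d := d)
  have T := isCoeffOp_opT (C := C) (d := d)
  have e01 := (gc0_ne_gcd (d := d)).symm
  have e02 := (gc0_ne_gxi (d := d)).symm
  have e12 := (gcd_ne_gxi (d := d)).symm
  exact dressed_sl2 (ghostMul_mul_self gc0 C) (ghostDer_mul_self gc0 C) (ghostMul_mul_self gcd C)
    (ghostDer_mul_self gcd C) (ghostMul_mul_self gxi C) (ghostDer_mul_self gxi C)
    (ghostDer_ghostMul_self gc0 C) (mm e01) (mD e01) (Dm e01) (DD e01)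
    (ghostDer_ghostMul_self gcd C) (mm e02) (mD e02) (mm e12) (mD e12) (Dm e02) (DD e02) (Dm e12)
    (DD e12) (ghostDer_ghostMul_self gxi C)
    (m Y _) (D Y _) (m Y _) (D Y _) (m Y _) (D Y _) (m X _) (D X _) (m X _) (D X _) (m X _) (D X _)
    (m H _) (D H _) (m H _) (D H _) (m H _) (D H _) (m B _) (D B _) (m B _) (D B _) (m B _) (D B _)
    (m S _) (D S _) (m S _) (D S _) (m S _) (D S _) (m T _) (D T _) (m T _) (D T _) (m T _) (D T _)
    (mul_eq_of_ad_eq w.ap_zq) (mul_eq_of_ad_eq w.h_ap) (mul_eq_of_ad_eq_neg w.h_zq)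
    (ad_eq_zero_iff.1 (w.ap_pp eta)).symm.eq (mul_swap_of_ad_eq_neg (w.ap_qp eta))
    (mul_swap_of_ad_eq_neg (w.ap_qq eta)) (mul_swap_of_ad_eq_neg (w.zq_pp eta))
    (mul_swap_of_ad_eq_neg (w.zq_qp eta)) (ad_eq_zero_iff.1 (w.zq_qq eta)).symm.eq
    (mul_swap_of_ad_eq (w.h_pp eta)) (ad_eq_zero_iff.1 (w.h_qp eta)).symm.eq
    (mul_swap_of_ad_eq_neg (w.h_qq eta)) rfl rfl rfl rfl

theorem stateBrst_dressed_mul_self :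
    stateBrst (dressedSd C d) (dressedH V) (dressedSbd V)
      * stateBrst (dressedSd C d) (dressedH V) (dressedSbd V) = 0 := by
  obtain ⟨-, hQE, hHQ, hHE⟩ := dressed_relations V
  have hb := commute_mul_dressed V (gc0_ne_gbd (d := d)).symm gcd_ne_gbd.symm gbd_ne_gxi
  have hb' := commute_der_dressed V (gc0_ne_gbd (d := d)).symm gcd_ne_gbd.symm gbd_ne_gxi
  have hm := commute_mul_dressed V (gc0_ne_gmu (d := d)).symm gcd_ne_gmu.symm gxi_ne_gmu.symm
  have hm' := commute_der_dressed V (gc0_ne_gmu (d := d)).symm gcd_ne_gmu.symm gxi_ne_gmu.symm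
  have hn := commute_mul_dressed V (gc0_ne_gnu (d := d)).symm gcd_ne_gnu.symm gxi_ne_gnu.symm
  have hn' := commute_der_dressed V (gc0_ne_gnu (d := d)).symm gcd_ne_gnu.symm gxi_ne_gnu.symm
  have bm := (gbd_ne_gmu (d := d)).symm
  have bn := (gbd_ne_gnu (d := d)).symm
  have mn := (gmu_ne_gnu (d := d)).symm
  exact brst_sl2_sq (ghostDer_mul_self gbd C) (ghostDer_ghostMul_self gbd C)
    (ghostMul_mul_self gmu C) (ghostDer_ghostMul_self gmu C) (ghostMul_mul_self gnu C)
    (ghostDer_ghostMul_self gnu C) (antiComm_mul_mul bm) (antiComm_mul_der bm)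
    (antiComm_der_mul bm) (antiComm_der_der bm) (antiComm_mul_mul bn) (antiComm_mul_der bn)
    (antiComm_der_mul bn) (antiComm_der_der bn) (antiComm_mul_mul mn) (antiComm_mul_der mn)
    (antiComm_der_mul mn) (antiComm_der_der mn)
    hb.1.symm hb'.1.symm hm.1.symm hm'.1.symm hn.1.symm hn'.1.symm
    hb.2.1.symm hb'.2.1.symm hm.2.1.symm hm'.2.1.symm hn.2.1.symm hn'.2.1.symm
    hb.2.2.symm hb'.2.2.symm hm.2.2.symm hm'.2.2.symm hn.2.2.symm hn'.2.2.symm hQE hHQ hHE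

/-- D and the sl(2) BRST operator are each nilpotent. They anticommute because D anticommutes with
the sl(2) ghosts and commutes with the dressed generators. -/
theorem omegaBar_mul_self : omegaBar V * omegaBar V = 0 := by
  rw [omegaBar_eq]
  obtain ⟨⟨hQ, hE, hH⟩, -⟩ := dressed_relations V
  refine add_mul_self_eq_zero (omegaTrace_mul_self C d) (stateBrst_dressed_mul_self V)
    (AntiComm.sl2Brst ?_ ?_ ?_ ?_ ?_ ?_ hQ hH hE)
  · exact (antiComm_mul_omegaTrace gc0_ne_gbd.symm gcd_ne_gbd.symm gbd_ne_gxi).symm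
  · exact (antiComm_der_omegaTrace gc0_ne_gbd.symm gcd_ne_gbd.symm gbd_ne_gxi).symm
  · exact (antiComm_mul_omegaTrace gc0_ne_gmu.symm gcd_ne_gmu.symm gxi_ne_gmu.symm).symm
  · exact (antiComm_der_omegaTrace gc0_ne_gmu.symm gcd_ne_gmu.symm gxi_ne_gmu.symm).symm
  · exact (antiComm_mul_omegaTrace gc0_ne_gnu.symm gcd_ne_gnu.symm gxi_ne_gnu.symm).symm
  · exact (antiComm_der_omegaTrace gc0_ne_gnu.symm gcd_ne_gnu.symm gxi_ne_gnu.symm).symm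

theorem antiComm_gth_omegaBar (m : Fin d) : AntiComm (ghostMul C (gth m)) (omegaBar V) := by
  rw [omegaBar_eq]
  obtain ⟨hQ, hH, hE⟩ := commute_mul_dressed V (gth_ne_gc0 m) (gth_ne_gcd m) (gth_ne_gxi m)
  exact (antiComm_mul_omegaTrace (gth_ne_gc0 m) (gth_ne_gcd m) (gth_ne_gxi m)).add
    (AntiComm.sl2Brst (antiComm_mul_mul (gth_ne_gbd m)) (antiComm_mul_der (gth_ne_gbd m))
      (antiComm_mul_mul (gth_ne_gmu m)) (antiComm_mul_der (gth_ne_gmu m))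
      (antiComm_mul_mul (gth_ne_gnu m)) (antiComm_mul_der (gth_ne_gnu m)) hQ hH hE)

variable {V} in
theorem IsCoeffOp.commute_omegaBar {O : Op C d} (hO : IsCoeffOp O) (hB : Commute O (box C d))
    (hS : Commute O (opS C d)) (hT : Commute O (opT C d)) (hX : Commute O (opSd C d))
    (hh : Commute O (opH V)) (hY : Commute O (opSbd V)) : Commute O (omegaBar V) := by
  have m := fun i => (hO.commute_ghostMul i).symm
  have D := fun i => (hO.commute_ghostDer i).symm
  obtain ⟨hQ, hH, hE⟩ := commute_dressed V hX hh hY fun i j _ _ => (m i).mul_right (D j)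
  rw [omegaBar_eq]
  exact ((((m _).mul_right hB).add_right ((m _).mul_right hS)).add_right
    ((m _).mul_right hT)).add_right
    (commute_sl2Brst (m _) (D _) (m _) (D _) (m _) (D _) hQ hH hE)

end Ghosts

/-! ### Order, gradings and restriction to traceless states -/

section BrstForm

variable {C : Type*} [CommRing C] [Algebra ℝ C] {d : ℕ} {Q H E : Op C d}

theorem tameOp_stateBrst (hQ : TameOp 0 Q) (hH : TameOp 0 H) (hE : TameOp 0 E) :
    TameOp 0 (stateBrst Q H E) :=
  have m := fun i : Ghost d => tameOp_ghostMul (C := C) i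
  have D := fun i : Ghost d => tameOp_ghostDer (C := C) i
  have h1 := ((m gmu).mul (m gbd)).mul (D gbd)
  have h2 := ((m gmu).mul (m gnu)).mul (D gnu)
  ((((((D gbd).mul hQ).add ((((m gmu).mul hH).sub (m gmu)).sub (m gmu))).add
    ((m gnu).mul hE)).add (h1.add h1)).add (h2.add h2)).add (((m gnu).mul (D gbd)).mul (D gmu))

theorem tameOp_dressed (V : Fin (d + 1) → C) : TameOp 0 (dressedSd C d) ∧
    TameOp 0 (dressedH V) ∧ TameOp 0 (dressedSbd V) := by
  have h := fun i j : Ghost d => (tameOp_ghostMul (C := C) i).mul (tameOp_ghostDer (C := C) j)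
  exact ⟨(tameOp_opSd.add (h _ _)).add ((h _ _).add (h _ _)),
    ((tameOp_opH V).sub ((h _ _).add (h _ _))).add ((h _ _).add (h _ _)),
    ((tameOp_opSbd V).add ((h _ _).add (h _ _))).add (h _ _)⟩

theorem tameOp_omegaBar (V : Fin (d + 1) → C) : TameOp 0 (omegaBar V) := by
  rw [omegaBar_eq]
  obtain ⟨hQ, hH, hE⟩ := tameOp_dressed V
  exact tameOp_omegaTrace.add (tameOp_stateBrst hQ hH hE)

variable {g : Ghost d → ℤ} {k : ℤ}

/-- One statement serves both gradings: k = ±1 for ghost number and its negative, k = 0 for the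
trace degree. -/
theorem shift_stateBrst (hb : g gbd = -k) (hm : g gmu = k) (hn : g gnu = k)
    (hQ : Shift (ghostWeight g) 0 Q) (hH : Shift (ghostWeight g) 0 H)
    (hE : Shift (ghostWeight g) 0 E) : Shift (ghostWeight g) k (stateBrst Q H E) := by
  have mb : Shift (ghostWeight g) (-k) (ghostMul C gbd) := hb ▸ shift_ghostMul gbd
  have mm : Shift (ghostWeight g) k (ghostMul C gmu) := hm ▸ shift_ghostMul gmu
  have mn : Shift (ghostWeight g) k (ghostMul C gnu) := hn ▸ shift_ghostMul gnu
  have Db : Shift (ghostWeight g) k (ghostDer C gbd) :=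
    (neg_eq_iff_eq_neg.2 hb) ▸ shift_ghostDer gbd
  have Dm : Shift (ghostWeight g) (-k) (ghostDer C gmu) := hm ▸ shift_ghostDer gmu
  have Dn : Shift (ghostWeight g) (-k) (ghostDer C gnu) := hn ▸ shift_ghostDer gnu
  have h1 := ((mm.mul mb).mul Db).mono (l := k) (by lia)
  have h2 := ((mm.mul mn).mul Dn).mono (l := k) (by lia)
  exact (((((((Db.mul hQ).mono (by lia)).add ((((mm.mul hH).mono (by lia)).sub mm).sub mm)).add
    ((mn.mul hE).mono (by lia))).add (h1.add h1)).add (h2.add h2)).add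
    (((mn.mul Db).mul Dm).mono (by lia)))

theorem shift_dressed (V : Fin (d + 1) → C) (h1 : g gcd = g gc0) (h2 : g gxi = g gc0) :
    Shift (ghostWeight g) 0 (dressedSd C d) ∧ Shift (ghostWeight g) 0 (dressedH V) ∧
      Shift (ghostWeight g) 0 (dressedSbd V) := by
  have h : ∀ i j : Ghost d, g i = g j → Shift (ghostWeight g) 0 (ghostMul C i * ghostDer C j) :=
    fun i j hij => ((shift_ghostMul i).mul (shift_ghostDer j)).mono
      (by simp only [ghostWeight]; lia)
  have a := h gxi gcd (h2.trans h1.symm)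
  have b := h gc0 gc0 rfl
  have c := h gxi gxi rfl
  have e := h gc0 gcd h1.symm
  exact ⟨((isCoeffOp_opSd.shift g).add (h _ _ h1)).add (a.add a),
    (((isCoeffOp_opH V).shift g).sub (b.add b)).add (c.add c),
    (((isCoeffOp_opSbd V).shift g).add (e.add e)).add (h _ _ (h1.trans h2.symm))⟩

theorem shift_omegaTilde (V : Fin (d + 1) → C) (hb : g gbd = -k) (hm : g gmu = k)
    (hn : g gnu = k) : Shift (ghostWeight g) k (omegaTilde V) := by
  rw [omegaTilde_eq]
  exact shift_stateBrst hb hm hn (isCoeffOp_opSd.shift g) ((isCoeffOp_opH V).shift g)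
    ((isCoeffOp_opSbd V).shift g)

/-- Traceless states do not contain the trace ghosts, so the dressing acts by zero, and D vanishes
on them. -/
theorem omegaBar_apply_of_mem {V : Fin (d + 1) → C} {φ : States C d} (hφ : φ ∈ traceless C d) :
    omegaBar V φ = omegaTilde V φ := by
  obtain ⟨hdeg, hD⟩ := mem_traceless_iff.1 hφ
  have h0 : ghostDer C gc0 φ = 0 := ghostDer_apply_eq_zero hdeg (by simp)
  have h1 : ghostDer C gcd φ = 0 := ghostDer_apply_eq_zero hdeg (by simp)
  have h2 : ghostDer C gxi φ = 0 := ghostDer_apply_eq_zero hdeg (by simp)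
  have hQ : dressedSd C d φ = opSd C d φ := by simp [dressedSd, h0, h1]
  have hH : dressedH V φ = opH V φ := by simp [dressedH, h0, h2]
  have hE : dressedSbd V φ = opSbd V φ := by simp [dressedSbd, h1, h2]
  rw [omegaBar_eq, omegaTilde_eq]
  simp [stateBrst, sl2Brst, hQ, hH, hE, hD]

end BrstForm

/-! ### Values of the gradings on the ghosts -/

section GhostValues

variable {d : ℕ}

theorem gh_values : gh (gc0 : Ghost d) = 1 ∧ gh (gcd : Ghost d) = 1 ∧
    gh (gxi : Ghost d) = 1 ∧ gh (gbd : Ghost d) = -1 ∧ (gh (gmu : Ghost d) = 1 ∧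
    gh (gnu : Ghost d) = 1) ∧ ∀ m : Fin d, gh (gth m) = 1 := by
  simp [gh, gc0_ne_gbd, gcd_ne_gbd, gbd_ne_gxi.symm, gbd_ne_gmu.symm, gbd_ne_gnu.symm, gth_ne_gbd]

theorem tdeg_values : tdeg (gc0 : Ghost d) = -1 ∧ tdeg (gcd : Ghost d) = -1 ∧
    tdeg (gxi : Ghost d) = -1 ∧ tdeg (gbd : Ghost d) = 0 ∧ tdeg (gmu : Ghost d) = 0 ∧
    tdeg (gnu : Ghost d) = 0 ∧ ∀ m : Fin d, tdeg (gth m) = 0 := by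
  simp [tdeg, gc0_ne_gbd.symm, gcd_ne_gbd.symm, gbd_ne_gxi, gc0_ne_gmu.symm, gcd_ne_gmu.symm,
    gxi_ne_gmu.symm, gc0_ne_gnu.symm, gcd_ne_gnu.symm, gxi_ne_gnu.symm, gth_ne_gc0, gth_ne_gcd,
    gth_ne_gxi]

end GhostValues

/-! ### Nilpotency and gradings of the parent and reduced systems -/

namespace Background

variable {d : ℕ} {U : TopologicalSpace.Opens (Fin d → ℝ)} {l : ℝ} (B : Background d U l)

section Covariant

theorem covariant_eq (m : Fin d) : B.covariant m
    = onBase (partialX U m)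
      - ∑ K, mulCHom (smoothFn U) d (partialX U m (B.V K)) * dY (smoothFn U) K
      - glAct (mulCHom (smoothFn U) d) (dY (smoothFn U)) (dA (smoothFn U))
        (fun A => mulY (smoothFn U) A + mulC (B.V A)) (mulA (smoothFn U)) (B.conn m) :=
  glAct_translate (mulCHom (smoothFn U) d) _ _ _ _ _ _ _ _ _ fun K => B.vielbein m K

theorem mulCHom_commute : (∀ f A, Commute (mulCHom (smoothFn U) d f) (dY (smoothFn U) A)) ∧
    (∀ f A, Commute (mulCHom (smoothFn U) d f) (dA (smoothFn U) A)) ∧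
    (∀ f A, Commute (mulCHom (smoothFn U) d f) (mulY (smoothFn U) A)) ∧
    ∀ f A, Commute (mulCHom (smoothFn U) d f) (mulA (smoothFn U) A) :=
  ⟨fun _ _ => commute_onBase_dY _ _, fun _ _ => commute_onBase_dA _ _,
    fun _ _ => commute_onBase_mulY _ _, fun _ _ => commute_onBase_mulA _ _⟩

theorem mulCHom_commute_translated (f : smoothFn U) (A : Fin (d + 1)) :
    Commute (mulCHom (smoothFn U) d f) (mulY (smoothFn U) A + mulC (B.V A)) :=
  (mulCHom_commute.2.2.1 f A).add_right (commute_mulC_mulC f (B.V A))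

theorem ad_covariant (m : Fin d) :
    (∀ A, ad (B.covariant m) (dY _ A)
      = ∑ K, mulCHom (smoothFn U) d (B.conn m K A) * dY _ K) ∧
    (∀ A, ad (B.covariant m) (dA _ A)
      = ∑ K, mulCHom (smoothFn U) d (B.conn m K A) * dA _ K) ∧
    (∀ A, ad (B.covariant m) (mulY _ A + mulC (B.V A))
      = -∑ K, mulCHom (smoothFn U) d (B.conn m A K) * (mulY _ K + mulC (B.V K))) ∧
    ∀ A, ad (B.covariant m) (mulA _ A)
      = -∑ K, mulCHom (smoothFn U) d (B.conn m A K) * mulA _ K := by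
  obtain ⟨hp, hq, hy, ha⟩ := mulCHom_commute (U := U) (d := d)
  have hz := B.mulCHom_commute_translated
  have w := isWeyl_translated B.V
  have w0 := isWeyl_states (C := smoothFn U) (d := d)
  have hδ := ad_onBase_partialX (U := U) m
  rw [covariant_eq]
  refine ⟨fun A => ?_, fun A => ?_, fun A => ?_, fun A => ?_⟩
  · rw [sub_ad, w.glAct_p hp hq hz ha, ad_of_commute (w0.translated_p hp B.V
      (δ := partialX U m) (fun A => commute_onBase_dY A _) A), zero_sub, neg_neg]
  · rw [sub_ad, w.glAct_q hp hq hz ha, ad_of_commute (w0.translated_q hq B.V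
      (δ := partialX U m) (fun A => commute_onBase_dA A _) A), zero_sub, neg_neg]
  · have h : ad _ (mulY (smoothFn U) A + mulC (B.V A)) = 0 :=
      ad_of_commute (w0.translated_z hp hy B.V hδ (fun A => commute_onBase_mulY A _) A)
    rw [sub_ad, w.glAct_z hp hq hz ha, h, zero_sub]
  · rw [sub_ad, w.glAct_a hp hq hz ha, ad_of_commute (w0.translated_a ha B.V
      (δ := partialX U m) (fun A => commute_onBase_mulA A _) A), zero_sub]

theorem commute_covariant (m n : Fin d) : Commute (B.covariant m) (B.covariant n) := by
  obtain ⟨hp, hq, hy, ha⟩ := mulCHom_commute (U := U) (d := d)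
  have hz := B.mulCHom_commute_translated
  have w := isWeyl_translated B.V
  have w0 := isWeyl_states (C := smoothFn U) (d := d)
  have hx := fun m : Fin d => ad_onBase_partialX (U := U) m
  have xp := fun m : Fin d => w0.translated_p hp B.V (δ := partialX U m)
    (fun A => commute_onBase_dY A (partialX U m))
  have xq := fun m : Fin d => w0.translated_q hq B.V (δ := partialX U m)
    (fun A => commute_onBase_dA A (partialX U m))
  have xz := fun m : Fin d => w0.translated_z hp hy B.V (hx m)
    (fun A => commute_onBase_mulY A (partialX U m))
  have xa := fun m : Fin d => w0.translated_a ha B.V (δ := partialX U m)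
    (fun A => commute_onBase_mulA A (partialX U m))
  have xc := fun m : Fin d => w0.ad_translated hp B.V (hx m)
  rw [covariant_eq, covariant_eq]
  exact w.ad_covariant_eq_zero hp hq hz ha _ _ (xc m) (xp m) (xq m) (xz m) (xa m) (xc n) (xp n)
    (xq n) (xz n) (xa n) (w0.commute_translated hp B.V (hx m)
      (fun A => commute_onBase_dY A _) (hx n) (fun A => commute_onBase_dY A _)
      (commute_onBase_partialX m n) (partialX_comm m n)) (B.flat m n)

/-- Metric compatibility is given with a lowered first index. Multiplying by both diagonal entries
of η, whose squares are one, moves it to the form with a raised index. -/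
theorem metric_mulC (m : Fin d) (A K : Fin (d + 1)) :
    eta A • mulCHom (smoothFn U) d (B.conn m K A) + eta K • mulCHom (smoothFn U) d (B.conn m A K)
      = 0 := by
  have h2 : ∀ A : Fin (d + 1), eta A * eta A = 1 := fun A => by
    unfold eta; split_ifs <;> norm_num
  have hs : ∀ (r : ℝ) (f : smoothFn U), r • mulCHom (smoothFn U) d f = mulCHom _ d (r • f) :=
    fun r f => op_ext fun φ S k n => by simp [mulCHom_apply, cf_mulC]
  have h := congrArg (fun f : smoothFn U => (eta A * eta K) • f) (B.metric m A K)
  simp only [smul_add, smul_smul, smul_zero] at h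
  rw [show eta A * eta K * eta A = eta K by rw [mul_right_comm, h2, one_mul],
    show eta A * eta K * eta K = eta A by rw [mul_assoc, h2, mul_one]] at h
  rw [hs, hs, ← map_add]
  exact (congrArg (mulCHom (smoothFn U) d) ((add_comm _ _).trans h)).trans (map_zero _)

theorem isCoeffOp_covariant (m : Fin d) : IsCoeffOp (B.covariant m) :=
  (((isCoeffOp_onBase _).sub (.sum fun _ => .sum fun _ => ((isCoeffOp_mulC _).mul
    (isCoeffOp_mulY _)).mul (isCoeffOp_dY _))).sub (.sum fun _ => .sum fun _ =>
    ((isCoeffOp_mulC _).mul (isCoeffOp_mulA _)).mul (isCoeffOp_dA _))).sub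
    (.sum fun _ => (isCoeffOp_mulC _).mul (isCoeffOp_dY _))

/-- Each generator in the fibre part is an invariant contraction: □, S, T through η, and the sl(2)
operators by pairing Y + V or a† with a derivative. -/
theorem commute_covariant_omegaBar (m : Fin d) : Commute (B.covariant m) (omegaBar B.V) := by
  obtain ⟨hp, hq, hy, ha⟩ := mulCHom_commute (U := U) (d := d)
  obtain ⟨cp, cq, cz, ca⟩ := B.ad_covariant m
  have hz := B.mulCHom_commute_translated
  have hη := B.metric_mulC m
  refine (B.isCoeffOp_covariant m).commute_omegaBar ?_ ?_ ?_ ?_ ?_ ?_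
  · exact ad_eq_zero_iff.1 (ad_metric_eq_zero (mulCHom (smoothFn U) d) cp cp hp hη)
  · exact ad_eq_zero_iff.1 (ad_metric_eq_zero (mulCHom (smoothFn U) d) cq cp hq hη)
  · exact ad_eq_zero_iff.1 (ad_metric_eq_zero (mulCHom (smoothFn U) d) cq cq hq hη)
  · exact ad_eq_zero_iff.1 (ad_contract_eq_zero (mulCHom (smoothFn U) d) ca cp ha)
  · exact (ad_eq_zero_iff.1 (ad_contract_eq_zero (mulCHom (smoothFn U) d) ca cq ha)).sub_right
      (ad_eq_zero_iff.1 (ad_contract_eq_zero (mulCHom (smoothFn U) d) cz cp hz))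
  · exact ad_eq_zero_iff.1 (ad_contract_eq_zero (mulCHom (smoothFn U) d) cz cq hz)

theorem tameOp_onBase_partialX (m : Fin d) :
    TameOp 1 (onBase (partialX U m) : Op (smoothFn U) d) :=
  ⟨fun f => by
    have h := ad_onBase_partialX (U := U) m f
    change HasOrderLE 0 (ad (onBase (partialX U m)) (mulCHom (smoothFn U) d f))
    rw [h]
    exact (tameOp_mulC _).order, _, shift_onBase _⟩

theorem tameOp_covariant (m : Fin d) : TameOp 1 (B.covariant m) := by
  have h1 : ∀ K A, TameOp 0 (mulC (B.conn m K A) * mulY (smoothFn U) A * dY (smoothFn U) K) :=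
    fun K A => ((tameOp_mulC _).mul (tameOp_mulY _)).mul (tameOp_dY _)
  have h2 : ∀ K A, TameOp 0 (mulC (B.conn m K A) * mulA (smoothFn U) A * dA (smoothFn U) K) :=
    fun K A => ((tameOp_mulC _).mul (tameOp_mulA _)).mul (tameOp_dA _)
  have h3 : ∀ A, TameOp 0 (mulC (B.e m A) * dY (smoothFn U) A) :=
    fun A => (tameOp_mulC _).mul (tameOp_dY _)
  have h1' := TameOp.sum (s := Finset.univ) fun K => TameOp.sum (s := Finset.univ) (h1 K)
  have h2' := TameOp.sum (s := Finset.univ) fun K => TameOp.sum (s := Finset.univ) (h2 K)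
  have h3' := TameOp.sum (s := Finset.univ) h3
  exact (((tameOp_onBase_partialX m).sub (h1'.mono zero_le_one)).sub
    (h2'.mono zero_le_one)).sub (h3'.mono zero_le_one)

end Covariant

theorem tameOp_nabla_add_sigma : TameOp 1 (B.nabla + B.sigma) := by
  rw [nabla_add_sigma]
  exact .sum fun m => (tameOp_ghostMul _).zero_mul (B.tameOp_covariant m)

theorem nabla_add_sigma_mul_self : (B.nabla + B.sigma) * (B.nabla + B.sigma) = 0 := by
  rw [nabla_add_sigma]
  exact sum_mul_self_eq_zero (fun m => ghostMul_mul_self (gth m) (smoothFn U))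
    (fun m n h => antiComm_mul_mul (gth_ne_gth h))
    (fun m n => (B.isCoeffOp_covariant n).commute_ghostMul _) B.commute_covariant

theorem parentOp_mul_self : B.parentOp * B.parentOp = 0 := by
  refine add_mul_self_eq_zero B.nabla_add_sigma_mul_self (omegaBar_mul_self B.V) ?_
  rw [nabla_add_sigma]
  exact (AntiComm.sum fun m _ => (antiComm_gth_omegaBar B.V m).symm.mul_comm_right
    (B.commute_covariant_omegaBar m).symm).symm

theorem shift_nabla_add_sigma {g : Ghost d → ℤ} {k : ℤ} (h : ∀ m, g (gth m) = k) :
    Shift (ghostWeight g) k (B.nabla + B.sigma) := by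
  rw [nabla_add_sigma]
  refine .sum fun m _ => ?_
  have := (shift_ghostMul (C := smoothFn U) (w := ghostWeight g) (gth m)).mul
    ((B.isCoeffOp_covariant m).shift g)
  exact this.mono (by simp [ghostWeight, h])

theorem shift_parentOp_sub {g : Ghost d → ℤ} {k : ℤ} (h0 : g gcd = g gc0) (h1 : g gxi = g gc0)
    (hb : g gbd = -k) (hm : g gmu = k) (hn : g gnu = k) (h : ∀ m, g (gth m) = k) :
    Shift (ghostWeight g) k (B.parentOp - omegaTrace (smoothFn U) d) := by
  obtain ⟨hQ, hH, hE⟩ := shift_dressed B.V h0 h1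
  have e : B.parentOp - omegaTrace (smoothFn U) d = B.nabla + B.sigma
      + stateBrst (dressedSd (smoothFn U) d) (dressedH B.V) (dressedSbd B.V) := by
    rw [parentOp, omegaBar_eq]; abel
  rw [e]
  exact (B.shift_nabla_add_sigma h).add (shift_stateBrst hb hm hn hQ hH hE)

theorem shift_reducedOp {g : Ghost d → ℤ} {k : ℤ} (hb : g gbd = -k) (hm : g gmu = k)
    (hn : g gnu = k) (h : ∀ m, g (gth m) = k) : Shift (ghostWeight g) k B.reducedOp :=
  (B.shift_nabla_add_sigma h).add (shift_omegaTilde B.V hb hm hn)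

theorem reducedOp_apply_of_mem {φ : States (smoothFn U) d}
    (hφ : φ ∈ traceless (smoothFn U) d) : B.reducedOp φ = B.parentOp φ := by
  rw [parentOp, reducedOp, LinearMap.add_apply, LinearMap.add_apply _ (omegaBar B.V),
    omegaBar_apply_of_mem hφ]

theorem shift_parentOp_gh : Shift (ghostWeight gh) 1 B.parentOp ∧
    Shift (ghostWeight (-gh)) (-1) B.parentOp := by
  obtain ⟨h1, h2, h3, h4, h5, h6⟩ := gh_values (d := d)
  have e : B.parentOp = B.parentOp - omegaTrace (smoothFn U) d + omegaTrace (smoothFn U) d := by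
    abel
  rw [e]
  constructor
  · refine (B.shift_parentOp_sub ?_ ?_ ?_ ?_ ?_ fun m => ?_).add shift_omegaTrace_gh <;>
      simp [*]
  · refine (B.shift_parentOp_sub ?_ ?_ ?_ ?_ ?_ fun m => ?_).add shift_omegaTrace_neg_gh <;>
      simp [*]

theorem shift_reducedOp_gh : Shift (ghostWeight gh) 1 B.reducedOp ∧
    Shift (ghostWeight (-gh)) (-1) B.reducedOp := by
  obtain ⟨h1, h2, h3, h4, h5, h6⟩ := gh_values (d := d)
  constructor <;> refine B.shift_reducedOp ?_ ?_ ?_ fun m => ?_ <;> simp [*]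

theorem shift_parentOp_tdeg :
    Shift (ghostWeight tdeg) 0 (B.parentOp - omegaTrace (smoothFn U) d) ∧
    Shift (ghostWeight (-tdeg)) 0 (B.parentOp - omegaTrace (smoothFn U) d) := by
  obtain ⟨h1, h2, h3, h4, h5, h6, h7⟩ := tdeg_values (d := d)
  constructor <;> refine B.shift_parentOp_sub ?_ ?_ ?_ ?_ ?_ fun m => ?_ <;> simp [*]

/-- Ω − D preserves the degree and D φ = 0, so Ωφ has degree zero. In Ω(Ωφ) = 0 the part from Ω − D
has degree zero, while D(Ωφ) has no component there; hence both vanish. -/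
theorem parentOp_mem {φ : States (smoothFn U) d} (hφ : φ ∈ traceless (smoothFn U) d) :
    B.parentOp φ ∈ traceless (smoothFn U) d := by
  obtain ⟨hdeg, hD⟩ := mem_traceless_iff.1 hφ
  obtain ⟨s1, s2⟩ := B.shift_parentOp_tdeg
  have hc : Commute (B.parentOp - omegaTrace (smoothFn U) d) (degZero (smoothFn U) d) :=
    commute_trunc_eq s1 (by rw [neg_ghostWeight]; exact s2) 0
  have h1 : ∀ ψ, B.parentOp ψ
      = (B.parentOp - omegaTrace (smoothFn U) d) ψ + omegaTrace (smoothFn U) d ψ := fun ψ => by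
    simp
  have h2 : ∀ ψ, degZero (smoothFn U) d ((B.parentOp - omegaTrace (smoothFn U) d) ψ)
      = (B.parentOp - omegaTrace (smoothFn U) d) (degZero (smoothFn U) d ψ) := fun ψ =>
    (LinearMap.congr_fun hc.eq ψ).symm
  have h3 : degZero (smoothFn U) d (B.parentOp φ) = B.parentOp φ := by
    rw [h1 φ, hD, add_zero, h2, hdeg]
  refine mem_traceless_iff.2 ⟨h3, ?_⟩
  have h4 : B.parentOp (B.parentOp φ) = 0 := LinearMap.congr_fun B.parentOp_mul_self φ
  have h5 := congrArg (degZero (smoothFn U) d) h4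
  have h6 : degZero (smoothFn U) d (omegaTrace (smoothFn U) d (B.parentOp φ)) = 0 :=
    LinearMap.congr_fun (degZero_mul_eq_zero shift_omegaTrace_neg_tdeg) (B.parentOp φ)
  rw [h1 (B.parentOp φ)] at h4 h5
  rw [map_add, h6, h2, h3, add_zero, map_zero] at h5
  rwa [h5, zero_add] at h4

theorem isBRSTSystem_parentOp : IsBRSTSystem ⊤ B.parentOp where
  diffOp := ⟨1, (B.tameOp_nabla_add_sigma.add ((tameOp_omegaBar B.V).mono zero_le_one)).isDiffOp⟩
  mapsTo _ _ := Submodule.mem_top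
  ghost _ _ _ := hasGhostNumber_apply B.shift_parentOp_gh.1 B.shift_parentOp_gh.2
  nilpotent φ _ := LinearMap.congr_fun B.parentOp_mul_self φ

theorem isBRSTSystem_reducedOp : IsBRSTSystem (traceless (smoothFn U) d) B.reducedOp where
  diffOp := ⟨1, (B.tameOp_nabla_add_sigma.add ((tameOp_omegaTilde B.V).mono zero_le_one)).isDiffOp⟩
  mapsTo φ hφ := by rw [B.reducedOp_apply_of_mem hφ]; exact B.parentOp_mem hφ
  ghost _ _ _ := hasGhostNumber_apply B.shift_reducedOp_gh.1 B.shift_reducedOp_gh.2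
  nilpotent φ hφ := by
    rw [B.reducedOp_apply_of_mem hφ, B.reducedOp_apply_of_mem (B.parentOp_mem hφ)]
    exact LinearMap.congr_fun B.parentOp_mul_self φ

end Background
end
end HSParent

/-! ### The proposition -/

theorem mainTheorem4 (d : ℕ) (hd : 3 ≤ d + 1) (l : ℝ) (hl : 0 < l)
    (U : TopologicalSpace.Opens (Fin d → ℝ)) (B : HSParent.Background d U l) :
    -- the cohomology of `Ω_trace` in the fibre is `Ẽ`, concentrated in degree zero
    (∃ ι : HSParent.traceless ℝ d ≃ₗ[ℝ] HSParent.traceCohomology ℝ d 0,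
      ∀ φ : HSParent.traceless ℝ d, ∃ h : φ.1 ∈ HSParent.traceCocycles ℝ d 0,
        ι φ = HSParent.traceClass ℝ d 0 ⟨φ.1, h⟩) ∧
    (∀ n : ℤ, n ≠ 0 → Subsingleton (HSParent.traceCohomology ℝ d n)) ∧
    -- the parent system, and the system it is reduced to
    HSParent.IsBRSTSystem ⊤ B.parentOp ∧
    HSParent.IsBRSTSystem (HSParent.traceless (HSParent.smoothFn U) d) B.reducedOp ∧
    -- the consistent reduction, through the cohomology of `Ω_trace`
    (∃ D : HSParent.BundleDecomposition (HSParent.smoothFn U) d,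
      LinearMap.range D.PG = LinearMap.range (HSParent.omegaTrace (HSParent.smoothFn U) d) ∧
      LinearMap.range D.PE ⊔ LinearMap.range D.PG
        = LinearMap.ker (HSParent.omegaTrace (HSParent.smoothFn U) d) ∧
      HSParent.IsConsistentReduction B.parentOp D
        (HSParent.traceless (HSParent.smoothFn U) d) B.reducedOp) ∧
    -- the `sl(2)` relations of the operators in `Ω̃`
    (⁅HSParent.opSd (HSParent.smoothFn U) d, HSParent.opSbd B.V⁆ = HSParent.opH B.V ∧
      ⁅HSParent.opH B.V, HSParent.opSd (HSParent.smoothFn U) d⁆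
        = (2 : ℝ) • HSParent.opSd (HSParent.smoothFn U) d ∧
      ⁅HSParent.opH B.V, HSParent.opSbd B.V⁆ = -((2 : ℝ) • HSParent.opSbd B.V)) := by
  -- The homotopy is used over ℝ for the cohomology of the fibre and over C^∞(U) for the reduction
  -- on sections.
  obtain ⟨s, hs⟩ := HSParent.exists_traceHomotopy ℝ hd
  obtain ⟨t, ht⟩ := HSParent.exists_traceHomotopy (HSParent.smoothFn U) hd
  refine ⟨HSParent.exists_traceless_equiv ℝ d, fun n hn => hs.subsingleton_traceCohomology hn,
    B.isBRSTSystem_parentOp, B.isBRSTSystem_reducedOp,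
    ⟨ht.decomposition, ht.range_PG, ht.range_PE_sup_range_PG, ?_⟩,
    HSParent.sl2_opSd_opSbd B.V, ?_, ?_⟩
  · exact ht.isConsistentReduction
      (B.tameOp_nabla_add_sigma.add ((HSParent.tameOp_omegaBar B.V).mono zero_le_one))
      B.shift_parentOp_tdeg.1 (fun φ hφ => B.reducedOp_apply_of_mem hφ)
      (fun φ hφ => B.parentOp_mem hφ)
  · rw [two_smul]
    exact HSParent.sl2_opH_opSd B.V
  · rw [two_smul]
    exact HSParent.sl2_opH_opSbd B.V
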